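/- **Setting.** Let $q,b_1,b_2,b_3,b_4,b_6,t\in\mathbb C$ with $q\neq0$, $|q|\ne1$, $b_1b_2b_3b_4=1$, $b_6\neq0$, $t\ne0$, and suppose that no two of the six points $b_1^{-1},b_2^{-1},b_3^{-1},b_4^{-1},b_6t,b_6^{-1}t$ lie on a common lattice $x_0q^{\mathbb Z}$. Let $$w(x;t)=\frac{(b_2x,\,b_3x,\,b_6^{-1}xt^{-1};q)_\infty}{(b_1x,\,b_4x,\,b_6xt^{-1};q)_\infty}$$ with $(a;q)_\infty=\prod_{j\ge0}(1-aq^j)$ for $|q|<1$ and $(a;q)_\infty=1/(aq^{-1};q^{-1})_\infty$ for $|q|>1$. Put $\Delta y=(q-1)x$, and let $W,V$ be the polynomials in $x$ with $$W+\Delta y\,V=b_6(1-b_1x)(1-b_4x)(t-b_6x),\qquad W-\Delta y\,V=(1-b_2x)(1-b_3x)(b_6t-x).$$ Let $\int\mathbb Dx\,F(x)=\sum_{i=1}^3c_i\sum_{s\ge0}\Delta y(e_ip^s)F(e_ip^s)$ with fixed $c_1+c_2+c_3=0$, where $p=q$ and $(e_1,e_2,e_3)=(q/b_2,q/b_3,qb_6t)$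 if $|q|<1$, and $p=q^{-1}$ and $(e_1,e_2,e_3)=(1/b_1,1/b_4,t/b_6)$ if $|q|>1$ (for two non-zero $c_i=\pm1$ this is a Thomae–Jackson integral between two terminals at zeros of the weight). Assume that at $t$ and at $qt$ (with the same $c_i$) there is a sequence of orthonormal polynomials $p_n$, $\deg p_n=n$, $\int\mathbb Dx\,w\,p_np_m=\delta_{nm}$. Let $\gamma_n$ be the leading coefficient of $p_n$, $a_n=\gamma_{n-1}/\gamma_n$ for $n\ge1$, $a_0\neq0$ arbitrary, $q_n(x)=\int\mathbb Dy\,w(y)p_n(y)/(x-y)$, $p_{-1}=0$, $q_{-1}=1/(a_0\gamma_0)$, and $$Y_n=\begin{pmatrix}p_n&q_n/w\\p_{n-1}&q_{n-1}/w\end{pmatrix}.$$ Define $A_n$ by $\dfrac{Y_n(qx)-Y_n(x)}{(q-1)x}=A_n(x)\,\tfrac12\,[Y_n(qx)+Y_n(x)]$. Then there are unique polynomials $W_n,\Omega_n,\Theta_n$ $(n\ge0)$ in $x$ such that, with $\Theta_{-1}=0$ and $$\mathfrak W_{n,\pm}=2W_n-W\pm\Delta y(\Omega_n+V),\qquad \mathfrak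 T_{n,+}=\Delta y\,a_n\Theta_n,\qquad \mathfrak T_{n,-}=\Delta y\,a_n\Theta_{n-1},$$ one has, off the lattices $zq^{\mathbb Z}$ through the six points $z$ above, for $x\neq0$ and wherever $Y_n(qx)+Y_n(x)$ is invertible, $$A_n=\frac1{W_n}\begin{pmatrix}\Omega_n&-a_n\Theta_n\\a_n\Theta_{n-1}&-\Omega_n-2V\end{pmatrix},\qquad (1-\tfrac12\Delta yA_n)^{-1}(1+\tfrac12\Delta yA_n)=\frac{1}{W+\Delta yV}\begin{pmatrix}\mathfrak W_{n,+}&-\mathfrak T_{n,+}\\ \mathfrak T_{n,-}&\mathfrak W_{n,-}\end{pmatrix};$$ the same holds at $qt$. Fix $n\ge0$, put $b_5=q^nb_1b_4b_6$, and assume $b_5^2\ne q^{-1},1,q$. Then $\Theta_n$ has a unique zero $g_n=\lambda_n$ at $t$, and a unique zero $\hat g_n$ at $qt$. Define $f_n=f_n(t)$ as follows. With $\nu_n=(2W_n-W)(\lambda_n)$ and $\mu_n=(\Omega_n+V)(\lambda_n)$, let $z_+$ be given by $-b_5b_6z_+=\nu_n/\lambda_n+(q-1)\mu_n$, put $$Z(t)=-\frac{b_5b_6t}{(\lambda_n-b_6t)(b_6\lambda_n-t)}\,z_++\frac{b_5t\lambda_n-1}{\lambda_n},$$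 and set $f_n(t)=b_5qt-Z(qt)$, where $Z(qt)$ is formed from the data at $qt$. **Statement.** (1) One has $$\mathfrak T_{n,+}=\frac{b_6}{b_5}\big(q^{-1}-b_5^2\big)a_nx(x-g_n)$$ and, if $n\ge1$, $\Theta_{n-1}$ has a unique zero $g_{n-1}$ and $$\mathfrak T_{n,-}=\frac{b_6}{b_5}\big(1-q^{-1}b_5^2\big)a_nx(x-g_{n-1}).$$ (2) Suppose $g_n\ne0,b_6t,b_6^{-1}t$, $\ \hat g_n\neq0,b_6qt,b_6^{-1}qt$ and $f_ng_n\ne1$. Write $f=f_n$, $g=g_n$, $S=b_1+b_2+b_3+b_4$, $S'=b_1^{-1}+b_2^{-1}+b_3^{-1}+b_4^{-1}$, $\Pi(x)=\prod_{i=1}^4(1-b_ix)$, $\Phi=\prod_{i=1}^4(f-b_i)$ and $$B=\frac{b_5^2(1+b_6^2)t}{b_6}+\frac{b_5g}{f}(t-b_5f)+\frac{b_5}{f^2}\big[t+b_5f-tfS'\big].$$ Then for all $x\ne0,g$: if $f\ne0$, $$\begin{aligned}\frac{\mathfrak W_{n,+}}{x(x-g)}={}&-xb_5b_6+\frac{b_6}{1-b_5^2}\Big[-\frac{b_5^2}{t}+b_5S'\Big]-\frac{b_6(b_5f-t)}{(1-b_5^2)t}\Big[\frac{g(t-fb_5)}{f}+\frac{tb_5(1+b_6^2)}{b_6}\Big]\\&+\frac{b_6t}{1-b_5^2}\Big[\frac{b_5^2}{g^2}-\frac{1-b_5^2}{xg}-\frac{Sb_5^2}{g}+\frac{b_5^2f}{g}-\frac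 gf+\frac{\Pi(g)(g-xb_5^2)}{(1-fg)g^2(x-g)}\Big];\end{aligned}$$ if $f\neq0$ and $fx\ne1$, $$\frac{\mathfrak W_{n,+}}{x(x-g)}=-\frac{b_6t}{1-b_5^2}\,\frac{\Phi\,(1-b_5^2fx)}{f^2(1-fg)(1-fx)}+\frac{b_6t\,\Pi(x)}{x(1-xf)(x-g)}-\frac{b_6(b_5f-t)}{f}x-\frac{b_6(b_5f-t)}{b_5(1-b_5^2)t}\,B;$$ if $tg\neq b_5$, $$\begin{aligned}\frac{t\,\mathfrak W_{n,-}}{x(x-g)}={}&\frac{(1-xf)(x-b_6t)(xb_6-t)}{x(x-g)}-\frac{b_6}{1-b_5^2}\,\frac{\prod_{i=1}^4(t-b_ib_5)}{b_5(tg-b_5)}\\&+\frac{b_6(b_5f-t)}{b_5(1-b_5^2)}\Big[(1-b_5^2)x-\frac{t^2}{g}-gb_5^2+\frac{b_5^2(1+b_6^2)t}{b_6}-\frac{b_5t^2\,\Pi(g)}{g(1-fg)(tg-b_5)}\Big];\end{aligned}$$ and if $f\ne0$, $$\frac{t\,\mathfrak W_{n,-}}{x(x-g)}=\frac{(1-xf)(x-b_6t)(b_6x-t)}{x(x-g)}+\frac{b_6t^2}{1-b_5^2}\,\frac{\Phi}{f^2(1-fg)}+\frac{b_6(b_5f-t)}{b_5(1-b_5^2)}\Big\{(1-b_5^2)x+B\Big\}.$$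 -/

import Mathlib

open Polynomial

/-- The `q`-shifted factorial `(a; q)_∞ = ∏_{j ≥ 0} (1 - a q^j)` for `|q| < 1`, extended to `|q| > 1` by
the usual convention `(a; q)_∞ = 1 / (a q⁻¹; q⁻¹)_∞`, so that `(a; q)_∞ = (1 - a) (a q; q)_∞` in both
cases. -/
noncomputable def qPochInf (q a : ℂ) : ℂ :=
  if ‖q‖ < 1 then ∏' j : ℕ, (1 - a * q ^ j) else (∏' j : ℕ, (1 - a * q⁻¹ ^ (j + 1)))⁻¹

/-- Divided-difference operator on the `q`-linear lattice, `ι₊(x) = q x`, `ι₋(x) = x`. -/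
noncomputable def divDiff (q : ℂ) (Y : ℂ → Matrix (Fin 2) (Fin 2) ℂ) (x : ℂ) :
    Matrix (Fin 2) (Fin 2) ℂ :=
  (q * x - x)⁻¹ • (Y (q * x) - Y x)

/-- Mean operator on the `q`-linear lattice. -/
noncomputable def meanOp (q : ℂ) (Y : ℂ → Matrix (Fin 2) (Fin 2) ℂ) (x : ℂ) :
    Matrix (Fin 2) (Fin 2) ℂ :=
  (2 : ℂ)⁻¹ • (Y (q * x) + Y x)

/-- Cayley transform `(1 - ½ δ A)⁻¹ (1 + ½ δ A)`. -/
noncomputable def cayley (δ : ℂ) (A : Matrix (Fin 2) (Fin 2) ℂ) : Matrix (Fin 2) (Fin 2) ℂ :=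
  (1 - (δ / 2) • A)⁻¹ * (1 + (δ / 2) • A)

/-- The free data: base `q`, weight parameters, the conventional value `a₀` of the recurrence coefficient
`a_0` (it multiplies `p_{-1} = 0`), and the coefficients `c i` of the three elementary `D`-integrals
`∫_0^{e_i}` out of which the integral defining orthogonality is formed. -/
structure LaxParams where
  q : ℂ
  b₁ : ℂ
  b₂ : ℂ
  b₃ : ℂ
  b₄ : ℂ
  b₆ : ℂ
  a₀ : ℂ
  c : Fin 3 → ℂ

/-- Spectral coefficients `W_n`, `Ω_n`, `Θ_n`, `n ≥ 0`. -/
structure SpectralCoeffs where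
  W : ℕ → ℂ[X]
  Ω : ℕ → ℂ[X]
  Θ : ℕ → ℂ[X]

noncomputable instance : Inhabited SpectralCoeffs := ⟨⟨0, 0, 0⟩⟩

/-- `Θ_{n-1}`, with `Θ_{-1} = 0`. -/
noncomputable def SpectralCoeffs.Θprev (σ : SpectralCoeffs) : ℕ → ℂ[X]
  | 0 => 0
  | n + 1 => σ.Θ n

namespace LaxParams

/-- `Δy(x) = ι₊(x) - ι₋(x) = (q - 1) x`. -/
noncomputable def Δy (P : LaxParams) (x : ℂ) : ℂ := (P.q - 1) * x

/-- `Δy` as a polynomial in `x`. -/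
noncomputable def ΔyPoly (P : LaxParams) : ℂ[X] := C (P.q - 1) * X

/-- The deformed big `q`-Jacobi weight
`w(x; t) = (b₂x, b₃x, b₆⁻¹xt⁻¹; q)_∞ / (b₁x, b₄x, b₆xt⁻¹; q)_∞`. -/
noncomputable def weight (P : LaxParams) (t x : ℂ) : ℂ :=
  (qPochInf P.q (P.b₂ * x) * qPochInf P.q (P.b₃ * x) * qPochInf P.q (x / (P.b₆ * t))) /
    (qPochInf P.q (P.b₁ * x) * qPochInf P.q (P.b₄ * x) * qPochInf P.q (P.b₆ * x / t))

/-- `q` or `q⁻¹`, whichever has modulus less than one. -/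
noncomputable def base (P : LaxParams) : ℂ := if ‖P.q‖ < 1 then P.q else P.q⁻¹

/-- The terminals `e_i` of the elementary `D`-integrals. The lattice `e_i, e_i p, e_i p², …`
(`p = base`) tends to `0`, and the weight vanishes at `e_i p⁻¹`, the next lattice point outwards. -/
noncomputable def terminal (P : LaxParams) (t : ℂ) : Fin 3 → ℂ :=
  if ‖P.q‖ < 1 then ![P.q / P.b₂, P.q / P.b₃, P.q * P.b₆ * t] else ![1 / P.b₁, 1 / P.b₄, t / P.b₆]

/-- The `D`-integral `∑_i c_i ∑_s Δy(x_s) F(x_s)`, the inner sum being over the lattice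
`x_s = e_i p^s`, `s ≥ 0`. With `c = (-1, 1, 0)` this is, up to an overall sign, the Thomae-Jackson
integral between the terminals `e_0` and `e_1`, and likewise for every other pair of terminals. -/
noncomputable def dIntegral (P : LaxParams) (t : ℂ) (F : ℂ → ℂ) : ℂ :=
  ∑ i : Fin 3, P.c i *
    ∑' s : ℕ, P.Δy (P.terminal t i * P.base ^ s) * F (P.terminal t i * P.base ^ s)

/-- `p` is the sequence of orthonormal polynomials (`p n` of exact degree `n`) for the weight at the
value `t` of the deformation variable. -/
def IsOPS (P : LaxParams) (t : ℂ) (p : ℕ → ℂ[X]) : Prop :=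
  (∀ n, (p n).natDegree = n) ∧
    ∀ n m, P.dIntegral t (fun x => P.weight t x * (p n).eval x * (p m).eval x) =
      if n = m then 1 else 0

/-- The coefficients `a_n` in `a_{n+1} p_{n+1} = (x - b_n) p_n - a_n p_{n-1}`: comparison of leading
coefficients gives `a_{n+1} = γ_n / γ_{n+1}`. -/
noncomputable def a (P : LaxParams) (p : ℕ → ℂ[X]) : ℕ → ℂ
  | 0 => P.a₀
  | n + 1 => (p n).leadingCoeff / (p (n + 1)).leadingCoeff

/-- Functions of the second kind `q_n(x) = ∫ w(y) p_n(y) / (x - y)`. -/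
noncomputable def assoc (P : LaxParams) (t : ℂ) (p : ℕ → ℂ[X]) (n : ℕ) (x : ℂ) : ℂ :=
  P.dIntegral t (fun y => P.weight t y * (p n).eval y / (x - y))

/-- The matrix `Y_n = (p_n, q_n / w; p_{n-1}, q_{n-1} / w)`, with `p_{-1} = 0` and
`q_{-1} = 1 / (a_0 γ_0)`. -/
noncomputable def Y (P : LaxParams) (t : ℂ) (p : ℕ → ℂ[X]) :
    ℕ → ℂ → Matrix (Fin 2) (Fin 2) ℂ
  | 0, x => !![(p 0).eval x, P.assoc t p 0 x / P.weight t x;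
               0, (P.a₀ * (p 0).leadingCoeff)⁻¹ / P.weight t x]
  | n + 1, x => !![(p (n + 1)).eval x, P.assoc t p (n + 1) x / P.weight t x;
                   (p n).eval x, P.assoc t p n x / P.weight t x]

/-- The spectral matrix `A_n`, defined by `D_x Y_n = A_n M_x Y_n`. -/
noncomputable def spectralMatrix (P : LaxParams) (t : ℂ) (p : ℕ → ℂ[X]) (n : ℕ) (x : ℂ) :
    Matrix (Fin 2) (Fin 2) ℂ :=
  divDiff P.q (P.Y t p n) x * (meanOp P.q (P.Y t p n) x)⁻¹

/-- `W + Δy V`. -/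
noncomputable def WplusV (P : LaxParams) (t : ℂ) : ℂ[X] :=
  C P.b₆ * (1 - C P.b₁ * X) * (1 - C P.b₄ * X) * (C t - C P.b₆ * X)

/-- `W - Δy V`. -/
noncomputable def WminusV (P : LaxParams) (t : ℂ) : ℂ[X] :=
  (1 - C P.b₂ * X) * (1 - C P.b₃ * X) * (C (P.b₆ * t) - X)

/-- The spectral polynomial `W`. -/
noncomputable def W (P : LaxParams) (t : ℂ) : ℂ[X] :=
  C (2 : ℂ)⁻¹ * (P.WplusV t + P.WminusV t)

/-- The spectral polynomial `V`: the difference of `W + Δy V` and `W - Δy V` vanishes at `x = 0`, and is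
divided by `2 Δy = 2 (q - 1) x`. -/
noncomputable def V (P : LaxParams) (t : ℂ) : ℂ[X] :=
  C (2 * (P.q - 1))⁻¹ * (P.WplusV t - P.WminusV t).divX

/-- The zeros of `W² - Δy² V²`. -/
noncomputable def singularPoints (P : LaxParams) (t : ℂ) : Fin 6 → ℂ :=
  ![1 / P.b₁, 1 / P.b₂, 1 / P.b₃, 1 / P.b₄, P.b₆ * t, t / P.b₆]

/-- Standing assumptions. The last clause is the genericity of the semi-classical weight (no two zeros of
`W² - Δy² V²` lie on one lattice); the vanishing of `∑ c_i` says that the boundary terms of the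
`D`-integral at the accumulation point `0` of the lattices cancel, as they do for every integral between two
terminals. -/
structure Standing (P : LaxParams) (t : ℂ) : Prop where
  q_ne_zero : P.q ≠ 0
  norm_q_ne_one : ‖P.q‖ ≠ 1
  prod_b : P.b₁ * P.b₂ * P.b₃ * P.b₄ = 1
  b₆_ne_zero : P.b₆ ≠ 0
  t_ne_zero : t ≠ 0
  a₀_ne_zero : P.a₀ ≠ 0
  sum_c : ∑ i, P.c i = 0
  generic : ∀ i j, i ≠ j → ∀ m : ℤ, P.singularPoints t i ≠ P.singularPoints t j * P.q ^ m

/-- Points at which the definition of `A_n` makes literal sense: `x` is neither `0` nor on a lattice through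
a zero of `W² - Δy² V²` (which contain the support and all zeros and poles of the weight), and `M_x Y_n` is
invertible. -/
def IsRegularPoint (P : LaxParams) (t : ℂ) (p : ℕ → ℂ[X]) (n : ℕ) (x : ℂ) : Prop :=
  x ≠ 0 ∧ (∀ i, ∀ m : ℤ, x ≠ P.singularPoints t i * P.q ^ m) ∧
    IsUnit (meanOp P.q (P.Y t p n) x).det

/-- `𝔚_{n,+} = 2 W_n - W + Δy (Ω_n + V)`. -/
noncomputable def frakWplus (P : LaxParams) (t : ℂ) (σ : SpectralCoeffs) (n : ℕ) : ℂ[X] :=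
  2 * σ.W n - P.W t + P.ΔyPoly * (σ.Ω n + P.V t)

/-- `𝔚_{n,-} = 2 W_n - W - Δy (Ω_n + V)`. -/
noncomputable def frakWminus (P : LaxParams) (t : ℂ) (σ : SpectralCoeffs) (n : ℕ) : ℂ[X] :=
  2 * σ.W n - P.W t - P.ΔyPoly * (σ.Ω n + P.V t)

/-- `𝔗_{n,+} = Δy a_n Θ_n`. -/
noncomputable def frakTplus (P : LaxParams) (p : ℕ → ℂ[X]) (σ : SpectralCoeffs) (n : ℕ) : ℂ[X] :=
  P.ΔyPoly * C (P.a p n) * σ.Θ n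

/-- `𝔗_{n,-} = Δy a_n Θ_{n-1}`. -/
noncomputable def frakTminus (P : LaxParams) (p : ℕ → ℂ[X]) (σ : SpectralCoeffs) (n : ℕ) : ℂ[X] :=
  P.ΔyPoly * C (P.a p n) * σ.Θprev n

/-- `σ` consists of the spectral coefficients:
`A_n = W_n⁻¹ (Ω_n, -a_n Θ_n; a_n Θ_{n-1}, -Ω_n - 2V)`, normalised so that the Cayley transform of `A_n` is
`(W + Δy V)⁻¹ A*_n` with `A*_n = (𝔚_{n,+}, -𝔗_{n,+}; 𝔗_{n,-}, 𝔚_{n,-})`. -/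
def IsSpectral (P : LaxParams) (t : ℂ) (p : ℕ → ℂ[X]) (σ : SpectralCoeffs) : Prop :=
  ∀ n x, P.IsRegularPoint t p n x →
    P.spectralMatrix t p n x =
      ((σ.W n).eval x)⁻¹ •
        !![(σ.Ω n).eval x, -(P.a p n * (σ.Θ n).eval x);
           P.a p n * (σ.Θprev n).eval x, -(σ.Ω n).eval x - 2 * (P.V t).eval x] ∧
    cayley (P.Δy x) (P.spectralMatrix t p n x) =
      ((P.WplusV t).eval x)⁻¹ •
        !![(P.frakWplus t σ n).eval x, -(P.frakTplus p σ n).eval x;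
           (P.frakTminus p σ n).eval x, (P.frakWminus t σ n).eval x]

/-- The spectral coefficients. -/
noncomputable def spectral (P : LaxParams) (t : ℂ) (p : ℕ → ℂ[X]) : SpectralCoeffs :=
  Classical.epsilon (P.IsSpectral t p)

/-- `b₅ = q^n b₁ b₄ b₆`. -/
noncomputable def b₅ (P : LaxParams) (n : ℕ) : ℂ := P.q ^ n * P.b₁ * P.b₄ * P.b₆

/-- `g_n(t) = λ_n(t)`, the zero of `Θ_n(·; t)`. -/
noncomputable def g (P : LaxParams) (t : ℂ) (p : ℕ → ℂ[X]) (n : ℕ) : ℂ :=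
  Classical.epsilon fun z => ((P.spectral t p).Θ n).IsRoot z

/-- `ν_n = (2 W_n - W)(λ_n, t)`. -/
noncomputable def ν (P : LaxParams) (t : ℂ) (p : ℕ → ℂ[X]) (n : ℕ) : ℂ :=
  (2 * (P.spectral t p).W n - P.W t).eval (P.g t p n)

/-- `μ_n = (Ω_n + V)(λ_n, t)`. -/
noncomputable def μ (P : LaxParams) (t : ℂ) (p : ℕ → ℂ[X]) (n : ℕ) : ℂ :=
  ((P.spectral t p).Ω n + P.V t).eval (P.g t p n)

/-- The variable `z₊` determined by `ν_n = ½ λ_n (κ₊ z₊ + κ₋ z₋)` and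
`μ_n = (κ₊ z₊ - κ₋ z₋) / (2 (q - 1))`, where `κ₊ = -b₅ b₆`. -/
noncomputable def zPlus (P : LaxParams) (t : ℂ) (p : ℕ → ℂ[X]) (n : ℕ) : ℂ :=
  (P.ν t p n / P.g t p n + (P.q - 1) * P.μ t p n) / (-(P.b₅ n * P.b₆))

/-- The variable `Z = -b₅ b₆ t z₊ / ((λ_n - b₆ t)(b₆ λ_n - t)) + (b₅ t λ_n - 1) / λ_n`. -/
noncomputable def Zvar (P : LaxParams) (t : ℂ) (p : ℕ → ℂ[X]) (n : ℕ) : ℂ :=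
  -(P.b₅ n * P.b₆ * t) / ((P.g t p n - P.b₆ * t) * (P.b₆ * P.g t p n - t)) * P.zPlus t p n +
    (P.b₅ n * t * P.g t p n - 1) / P.g t p n

/-- `f_n(t)`, defined by `Z(t) = b₅ t - f_n(q⁻¹ t)`, i.e. `f_n(t) = b₅ q t - Z(q t)`. Here `p s` are the
orthonormal polynomials at the value `s` of the deformation variable. -/
noncomputable def f (P : LaxParams) (t : ℂ) (p : ℂ → ℕ → ℂ[X]) (n : ℕ) : ℂ :=
  P.b₅ n * (P.q * t) - P.Zvar (P.q * t) (p (P.q * t)) n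

end LaxParams

section

open Filter Topology

/-! ### The infinite `q`-shifted factorial -/

/-! Write U = W + Δy V and D = W - Δy V. The recursion of the shifted factorial gives the Pearson
equation w(qx) D(x) = w(x) U(x) (`pearson`). The terminals are chosen so that the change of variable
y ↦ qy in the integral leaves no boundary term at the outer ends, while the boundary terms at 0 are
the same for each lattice and cancel because the c_i sum to zero (`dIntegral_shift`,
`moment_divX_eq_zero`). So the Stieltjes transform F of w satisfies D(x) F(qx) = U(x) F(x) + R(x)
with R a polynomial and R(0) = 0 (`exists_stieltjes_one_shift`).

Since q_n = p_n F - ρ_n with ρ_n a polynomial, this relation eliminates F from the entries of U(x)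
Y_n(qx) Y_n(x)⁻¹, which are therefore polynomials: A_n and B_n on the diagonal, -a_n τ_n and a_n
τ_{n-1} off it. Their degrees and top coefficients follow from p_n ~ γ_n x^n and q_n ~ γ_n⁻¹
x^{-n-1} at infinity, their constant terms from R(0) = 0 (`exists_spectralPolys`). The Cayley
transform of the spectral matrix is Y_n(qx) Y_n(x)⁻¹, so these polynomials are the 𝔚_{n,±} and
𝔗_{n,±}, and they determine W_n, Ω_n, Θ_n (`existsUnique_isSpectral`). Part (1) follows: τ_n is
quadratic, vanishes at 0 and has a known leading coefficient.

For part (2) the diagonal entries are cubics with known top and constant coefficients, so four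
numbers are missing. The determinant A_n B_n + a_n² τ_n τ_{n-1} = U D gives two linear equations,
from the coefficients of x and x⁵, which the off-diagonal product does not reach. At the zero g of
τ_n it also gives A_n(g) B_n(g), so one more relation, expressing B_n(g) through f, suffices. But f
is defined by the data at qt. The relation is transported to t by the deformation t ↦ qt: w(x;
qt)/w(x; t) and w(qx; qt)/w(x; t) are rational, so mixed brackets of the functions at t and at qt
are polynomials of degree 0 and 1, and the linear one is, up to a constant, 1 - f x
(`exists_deformation_variable`). The system is then solved (`DiagonalConditions.solve`), and the
four displayed formulas are rational identities. -/

theorem summable_norm_neg_mul_pow {p : ℂ} (hp : ‖p‖ < 1) (a : ℂ) :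
    Summable fun j : ℕ => ‖-(a * p ^ j)‖ := by
  simpa [norm_mul] using (summable_geometric_of_lt_one (norm_nonneg p) hp).mul_left ‖a‖

theorem multipliable_one_sub_mul_pow {p : ℂ} (hp : ‖p‖ < 1) (a : ℂ) :
    Multipliable fun j : ℕ => (1 - a * p ^ j) := by
  simpa [sub_eq_add_neg] using multipliable_one_add_of_summable (summable_norm_neg_mul_pow hp a)

theorem tprod_one_sub_mul_pow_eq {p : ℂ} (hp : ‖p‖ < 1) (a : ℂ) :
    ∏' j : ℕ, (1 - a * p ^ j) = (1 - a) * ∏' j : ℕ, (1 - a * p * p ^ j) := by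
  have h : ∀ j : ℕ, 1 - a * p ^ (j + 1) = 1 - a * p * p ^ j := fun j => by ring
  rw [tprod_eq_zero_mul' (f := fun j : ℕ => 1 - a * p ^ j)]
  · simp only [h, pow_zero, mul_one]
  · simp only [h]
    exact multipliable_one_sub_mul_pow hp _

theorem tprod_one_sub_mul_pow_ne_zero {p : ℂ} (hp : ‖p‖ < 1) {a : ℂ} (h : ∀ j : ℕ, a * p ^ j ≠ 1) :
    ∏' j : ℕ, (1 - a * p ^ j) ≠ 0 := by
  have := tprod_one_add_ne_zero_of_summable (f := fun j : ℕ => -(a * p ^ j))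
    (fun j => by simpa [← sub_eq_add_neg, sub_eq_zero] using (h j).symm)
    (summable_norm_neg_mul_pow hp a)
  simpa [← sub_eq_add_neg] using this

/-- The finite products satisfy |∏(1 + z_j) - 1| ≤ exp(∑|z_j|) - 1, uniformly in the number of
factors, and the full sum of the |z_j| is |a| / (1 - |p|). -/
theorem tendsto_tprod_one_sub_mul_pow {p : ℂ} (hp : ‖p‖ < 1) :
    Tendsto (fun a : ℂ => ∏' j : ℕ, (1 - a * p ^ j)) (𝓝 0) (𝓝 1) := by
  have hbound : ∀ a : ℂ, ‖∏' j : ℕ, (1 - a * p ^ j) - 1‖ ≤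
      Real.exp (‖a‖ * (1 - ‖p‖)⁻¹) - 1 := by
    intro a
    have h1 := ((multipliable_one_sub_mul_pow hp a).hasProd.sub_const 1).norm
    refine le_of_tendsto h1 (Eventually.of_forall fun s => ?_)
    have h2 := s.norm_prod_one_add_sub_one_le fun j : ℕ => -(a * p ^ j)
    simp only [← sub_eq_add_neg] at h2
    refine h2.trans (sub_le_sub_right (Real.exp_le_exp.2 ?_) 1)
    refine ((summable_norm_neg_mul_pow hp a).sum_le_tsum s fun _ _ => norm_nonneg _).trans ?_
    simp [tsum_mul_left, tsum_geometric_of_lt_one (norm_nonneg p) hp]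
  rw [tendsto_iff_norm_sub_tendsto_zero]
  refine squeeze_zero (fun _ => norm_nonneg _) hbound ?_
  have : Continuous fun a : ℂ => Real.exp (‖a‖ * (1 - ‖p‖)⁻¹) - 1 := by fun_prop
  simpa using this.tendsto 0

theorem norm_inv_lt_one_of_not {q : ℂ} (hq1 : ‖q‖ ≠ 1) (h : ¬ ‖q‖ < 1) :
    ‖q⁻¹‖ < 1 := by
  rw [norm_inv]
  exact inv_lt_one_of_one_lt₀ (lt_of_le_of_ne (not_lt.1 h) hq1.symm)

theorem qPochInf_of_not_lt {q : ℂ} (h : ¬ ‖q‖ < 1) (a : ℂ) :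
    qPochInf q a = (∏' j : ℕ, (1 - a * q⁻¹ * q⁻¹ ^ j))⁻¹ := by
  simp only [qPochInf, if_neg h]
  congr 2
  funext j
  ring

/-- The exclusion of a = 1 matters for |q| > 1: there (aq; q)_∞ has a pole at a = 1, represented by
the value 0, and the recursion would break. -/
theorem qPochInf_eq_mul {q : ℂ} (hq : q ≠ 0) (hq1 : ‖q‖ ≠ 1) {a : ℂ} (ha : a ≠ 1) :
    qPochInf q a = (1 - a) * qPochInf q (a * q) := by
  by_cases h : ‖q‖ < 1
  · simp only [qPochInf, if_pos h]
    exact tprod_one_sub_mul_pow_eq h a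
  · have hi := norm_inv_lt_one_of_not hq1 h
    rw [qPochInf_of_not_lt h, qPochInf_of_not_lt h, mul_inv_cancel_right₀ hq,
      tprod_one_sub_mul_pow_eq hi a, mul_inv, mul_inv_cancel_left₀ (sub_ne_zero.2 ha.symm)]

theorem qPochInf_ne_zero {q : ℂ} (hq1 : ‖q‖ ≠ 1) {a : ℂ}
    (ha : ∀ m : ℤ, a * q ^ m ≠ 1) : qPochInf q a ≠ 0 := by
  by_cases h : ‖q‖ < 1
  · simp only [qPochInf, if_pos h]
    exact tprod_one_sub_mul_pow_ne_zero h fun j => by exact_mod_cast ha j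
  · rw [qPochInf_of_not_lt h]
    refine inv_ne_zero (tprod_one_sub_mul_pow_ne_zero (norm_inv_lt_one_of_not hq1 h) fun j => ?_)
    have := ha (-(j + 1 : ℕ))
    rwa [zpow_neg, zpow_natCast, ← inv_pow, pow_succ', ← mul_assoc] at this

theorem tendsto_qPochInf {q : ℂ} (hq1 : ‖q‖ ≠ 1) :
    Tendsto (qPochInf q) (𝓝 0) (𝓝 1) := by
  by_cases h : ‖q‖ < 1
  · refine (tendsto_tprod_one_sub_mul_pow h).congr fun a => ?_
    simp only [qPochInf, if_pos h]
  · have h1 : Tendsto (fun a : ℂ => a * q⁻¹) (𝓝 0) (𝓝 0) := by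
      have : Continuous fun a : ℂ => a * q⁻¹ := by fun_prop
      simpa using this.tendsto 0
    have h2 := ((tendsto_tprod_one_sub_mul_pow (norm_inv_lt_one_of_not hq1 h)).comp h1).inv₀
      one_ne_zero
    rw [inv_one] at h2
    exact h2.congr fun a => (qPochInf_of_not_lt h a).symm

/-! ### The singular points, the weight and the Pearson equation. -/

namespace LaxParams

variable {P : LaxParams} {t : ℂ}

namespace Standing

theorem q_ne_one (hP : P.Standing t) : P.q ≠ 1 := fun h => hP.norm_q_ne_one (by simp [h])

theorem b₁_ne_zero (hP : P.Standing t) : P.b₁ ≠ 0 := fun h => by simpa [h] using hP.prod_b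

theorem b₂_ne_zero (hP : P.Standing t) : P.b₂ ≠ 0 := fun h => by simpa [h] using hP.prod_b

theorem b₃_ne_zero (hP : P.Standing t) : P.b₃ ≠ 0 := fun h => by simpa [h] using hP.prod_b

theorem b₄_ne_zero (hP : P.Standing t) : P.b₄ ≠ 0 := fun h => by simpa [h] using hP.prod_b

theorem zpow_q_eq_one (hP : P.Standing t) {m : ℤ} (h : P.q ^ m = 1) : m = 0 := by
  have h1 : ‖P.q‖ ^ m = 1 := by rw [← norm_zpow, h, norm_one]
  exact (zpow_eq_one_iff_right₀ (norm_nonneg _) hP.norm_q_ne_one).1 h1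

theorem singularPoints_ne_zero (hP : P.Standing t) (i : Fin 6) : P.singularPoints t i ≠ 0 := by
  have h1 := hP.b₁_ne_zero
  have h2 := hP.b₂_ne_zero
  have h3 := hP.b₃_ne_zero
  have h4 := hP.b₄_ne_zero
  have h6 := hP.b₆_ne_zero
  have ht := hP.t_ne_zero
  fin_cases i <;> simp [singularPoints, *]

/-- A point on the lattice of a singular point is singular only if it is that point. -/
theorem singularPoints_mul_zpow_ne (hP : P.Standing t) (i j : Fin 6) {m : ℤ} (hm : m ≠ 0) :
    P.singularPoints t i * P.q ^ m ≠ P.singularPoints t j := by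
  intro h
  by_cases hij : i = j
  · subst hij
    exact hm (hP.zpow_q_eq_one (mul_left_cancel₀ (hP.singularPoints_ne_zero i) (by rw [h, mul_one])))
  · exact hP.generic j i (Ne.symm hij) m h.symm

theorem _root_.LaxParams.singularPoints_shift (P : LaxParams) (t : ℂ) (i : Fin 6) :
    ∃ k : ℤ, P.singularPoints (P.q * t) i = P.singularPoints t i * P.q ^ k := by
  fin_cases i
  · exact ⟨0, by simp [singularPoints]⟩
  · exact ⟨0, by simp [singularPoints]⟩
  · exact ⟨0, by simp [singularPoints]⟩
  · exact ⟨0, by simp [singularPoints]⟩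
  · exact ⟨1, by simp [singularPoints]; ring⟩
  · exact ⟨1, by simp [singularPoints]; ring⟩

/-- Replacing t by qt moves each singular point along its own lattice, so the set of lattices, and
with it genericity, is unchanged. -/
theorem shift (hP : P.Standing t) : P.Standing (P.q * t) where
  q_ne_zero := hP.q_ne_zero
  norm_q_ne_one := hP.norm_q_ne_one
  prod_b := hP.prod_b
  b₆_ne_zero := hP.b₆_ne_zero
  t_ne_zero := mul_ne_zero hP.q_ne_zero hP.t_ne_zero
  a₀_ne_zero := hP.a₀_ne_zero
  sum_c := hP.sum_c
  generic := by
    intro i j hij m h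
    obtain ⟨k, hk⟩ := P.singularPoints_shift t i
    obtain ⟨l, hl⟩ := P.singularPoints_shift t j
    refine hP.generic i j hij (l + m - k) ?_
    rw [zpow_sub₀ hP.q_ne_zero, zpow_add₀ hP.q_ne_zero]
    rw [hk, hl] at h
    field_simp [zpow_ne_zero k hP.q_ne_zero]
    linear_combination h

end Standing

/-- `x` is neither `0` nor on a lattice through a singular point. -/
def OffLattice (P : LaxParams) (t x : ℂ) : Prop :=
  x ≠ 0 ∧ ∀ i, ∀ m : ℤ, x ≠ P.singularPoints t i * P.q ^ m

theorem OffLattice.mul_q (hP : P.Standing t) {x : ℂ} (hx : P.OffLattice t x) :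
    P.OffLattice t (P.q * x) := by
  refine ⟨mul_ne_zero hP.q_ne_zero hx.1, fun i m h => hx.2 i (m - 1) ?_⟩
  rw [zpow_sub_one₀ hP.q_ne_zero, ← mul_assoc, ← h, mul_comm P.q, mul_inv_cancel_right₀ hP.q_ne_zero]

theorem OffLattice.ne (hx : P.OffLattice t x) (i : Fin 6) : x ≠ P.singularPoints t i := by
  simpa using hx.2 i 0

/-- The six zeros of `W² - Δy² V²`, in terms of the arguments of the shifted factorials. -/
theorem args_ne_one (hP : P.Standing t) {x : ℂ} (hx : ∀ i, x ≠ P.singularPoints t i) :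
    P.b₁ * x ≠ 1 ∧ P.b₂ * x ≠ 1 ∧ P.b₃ * x ≠ 1 ∧ P.b₄ * x ≠ 1 ∧ x / (P.b₆ * t) ≠ 1 ∧
      P.b₆ * x / t ≠ 1 := by
  have h1 := hP.b₁_ne_zero
  have h2 := hP.b₂_ne_zero
  have h3 := hP.b₃_ne_zero
  have h4 := hP.b₄_ne_zero
  have h6 := hP.b₆_ne_zero
  have ht := hP.t_ne_zero
  refine ⟨fun h => hx 0 ?_, fun h => hx 1 ?_, fun h => hx 2 ?_, fun h => hx 3 ?_,
    fun h => hx 4 ?_, fun h => hx 5 ?_⟩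
  · rw [show P.singularPoints t 0 = 1 / P.b₁ from rfl, eq_div_iff h1, mul_comm, h]
  · rw [show P.singularPoints t 1 = 1 / P.b₂ from rfl, eq_div_iff h2, mul_comm, h]
  · rw [show P.singularPoints t 2 = 1 / P.b₃ from rfl, eq_div_iff h3, mul_comm, h]
  · rw [show P.singularPoints t 3 = 1 / P.b₄ from rfl, eq_div_iff h4, mul_comm, h]
  · rw [show P.singularPoints t 4 = P.b₆ * t from rfl, (div_eq_one_iff_eq (mul_ne_zero h6 ht)).1 h]
  · rw [show P.singularPoints t 5 = t / P.b₆ from rfl, eq_div_iff h6, mul_comm,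
      (div_eq_one_iff_eq ht).1 h]

theorem weight_ne_zero (hP : P.Standing t) {x : ℂ} (hx : P.OffLattice t x) :
    P.weight t x ≠ 0 := by
  have key : ∀ m : ℤ, ∀ i, x * P.q ^ m ≠ P.singularPoints t i := fun m i h => by
    refine hx.2 i (-m) ?_
    rw [← h, mul_assoc, ← zpow_add₀ hP.q_ne_zero]
    simp
  have H := fun m => args_ne_one hP (key m)
  have hz := fun {a : ℂ} => qPochInf_ne_zero hP.norm_q_ne_one (a := a)
  refine div_ne_zero (mul_ne_zero (mul_ne_zero (hz fun m => ?_) (hz fun m => ?_)) (hz fun m => ?_))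
    (mul_ne_zero (mul_ne_zero (hz fun m => ?_) (hz fun m => ?_)) (hz fun m => ?_))
  · rw [mul_assoc]; exact (H m).2.1
  · rw [mul_assoc]; exact (H m).2.2.1
  · rw [div_mul_eq_mul_div]; exact (H m).2.2.2.2.1
  · rw [mul_assoc]; exact (H m).1
  · rw [mul_assoc]; exact (H m).2.2.2.1
  · rw [div_mul_eq_mul_div, mul_assoc]; exact (H m).2.2.2.2.2

theorem tendsto_weight (hP : P.Standing t) : Tendsto (P.weight t) (𝓝 0) (𝓝 1) := by
  have H : ∀ u : ℂ → ℂ, Continuous u → u 0 = 0 →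
      Tendsto (fun x => qPochInf P.q (u x)) (𝓝 0) (𝓝 1) := fun u hu h0 =>
    (tendsto_qPochInf hP.norm_q_ne_one).comp (by simpa [h0] using hu.tendsto 0)
  have h := (((H (fun x => P.b₂ * x) (by fun_prop) (by simp)).mul
    (H (fun x => P.b₃ * x) (by fun_prop) (by simp))).mul
    (H (fun x => x / (P.b₆ * t)) (by fun_prop) (by simp))).div
    (((H (fun x => P.b₁ * x) (by fun_prop) (by simp)).mul
    (H (fun x => P.b₄ * x) (by fun_prop) (by simp))).mul
    (H (fun x => P.b₆ * x / t) (by fun_prop) (by simp))) (by simp)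
  rw [show (1 : ℂ) * 1 * 1 / (1 * 1 * 1) = 1 by norm_num] at h
  exact h

theorem eval_WplusV (P : LaxParams) (t x : ℂ) : (P.WplusV t).eval x =
    P.b₆ * (1 - P.b₁ * x) * (1 - P.b₄ * x) * (t - P.b₆ * x) := by simp [WplusV]

theorem eval_WminusV (P : LaxParams) (t x : ℂ) : (P.WminusV t).eval x =
    (1 - P.b₂ * x) * (1 - P.b₃ * x) * (P.b₆ * t - x) := by simp [WminusV]

theorem eval_WplusV_ne_zero (hP : P.Standing t) {x : ℂ} (hx : ∀ i, x ≠ P.singularPoints t i) :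
    (P.WplusV t).eval x ≠ 0 := by
  obtain ⟨h1, -, -, h4, -, h6⟩ := args_ne_one hP hx
  rw [eval_WplusV]
  refine mul_ne_zero (mul_ne_zero (mul_ne_zero hP.b₆_ne_zero (sub_ne_zero.2 h1.symm))
    (sub_ne_zero.2 h4.symm)) (sub_ne_zero.2 fun h => h6 ?_)
  rw [← h, div_self hP.t_ne_zero]

/-- The Pearson equation of the weight. -/
theorem pearson (hP : P.Standing t) {x : ℂ} (hx : ∀ i, x ≠ P.singularPoints t i) :
    P.weight t (P.q * x) * (P.WminusV t).eval x = P.weight t x * (P.WplusV t).eval x := by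
  obtain ⟨h1, h2, h3, h4, h5, h6⟩ := args_ne_one hP hx
  have hU := eval_WplusV_ne_zero hP hx
  have hr := fun {a : ℂ} => qPochInf_eq_mul hP.q_ne_zero hP.norm_q_ne_one (a := a)
  have hb := hP.b₆_ne_zero
  have ht := hP.t_ne_zero
  rw [weight, weight, hr h1, hr h2, hr h3, hr h4, hr h5, hr h6]
  rw [show P.b₁ * (P.q * x) = P.b₁ * x * P.q by ring, show P.b₂ * (P.q * x) = P.b₂ * x * P.q by ring,
    show P.b₃ * (P.q * x) = P.b₃ * x * P.q by ring, show P.b₄ * (P.q * x) = P.b₄ * x * P.q by ring,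
    show P.q * x / (P.b₆ * t) = x / (P.b₆ * t) * P.q by ring,
    show P.b₆ * (P.q * x) / t = P.b₆ * x / t * P.q by ring]
  generalize qPochInf P.q (P.b₁ * x * P.q) = A1
  generalize qPochInf P.q (P.b₂ * x * P.q) = A2
  generalize qPochInf P.q (P.b₃ * x * P.q) = A3
  generalize qPochInf P.q (P.b₄ * x * P.q) = A4
  generalize qPochInf P.q (x / (P.b₆ * t) * P.q) = A5
  generalize qPochInf P.q (P.b₆ * x / t * P.q) = A6
  have hD' : (P.WminusV t).eval x =
      (1 - P.b₂ * x) * (1 - P.b₃ * x) * (1 - x / (P.b₆ * t)) * (P.b₆ * t) := by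
    rw [eval_WminusV]; field_simp
  have hU' : (P.WplusV t).eval x =
      (1 - P.b₁ * x) * (1 - P.b₄ * x) * (1 - P.b₆ * x / t) * (P.b₆ * t) := by
    rw [eval_WplusV]; field_simp
  rw [hD', hU']
  have e1 := sub_ne_zero.2 h1.symm
  have e4 := sub_ne_zero.2 h4.symm
  have e6 := sub_ne_zero.2 h6.symm
  generalize 1 - P.b₁ * x = B1 at *
  generalize 1 - P.b₄ * x = B4 at *
  generalize 1 - P.b₆ * x / t = B6 at *
  generalize 1 - x / (P.b₆ * t) = B5
  simp only [div_eq_mul_inv, mul_inv]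
  field_simp

/-! ### The support of the integral -/

/-- The support points of the integral. -/
noncomputable def pt (P : LaxParams) (t : ℂ) (i : Fin 3) (s : ℕ) : ℂ := P.terminal t i * P.base ^ s

theorem norm_base_lt_one (hP : P.Standing t) : ‖P.base‖ < 1 := by
  unfold base
  split_ifs with h
  · exact h
  · exact norm_inv_lt_one_of_not hP.norm_q_ne_one h

theorem tendsto_pt (hP : P.Standing t) (i : Fin 3) : Tendsto (P.pt t i) atTop (𝓝 0) := by
  have h := (tendsto_pow_atTop_nhds_zero_of_norm_lt_one (norm_base_lt_one hP)).const_mul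
    (P.terminal t i)
  rw [mul_zero] at h
  exact h

theorem pt_succ_of_lt (h : ‖P.q‖ < 1) (i : Fin 3) (s : ℕ) : P.pt t i (s + 1) = P.q * P.pt t i s := by
  simp only [pt, base, if_pos h]; ring

theorem q_mul_pt_succ_of_not (hP : P.Standing t) (h : ¬ ‖P.q‖ < 1) (i : Fin 3) (s : ℕ) :
    P.q * P.pt t i (s + 1) = P.pt t i s := by
  have := hP.q_ne_zero
  simp only [pt, base, if_neg h, pow_succ]; field_simp

theorem pt_eq_of_lt (h : ‖P.q‖ < 1) (i : Fin 3) :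
    ∃ j, ∀ s, P.pt t i s = P.singularPoints t j * P.q ^ ((s : ℤ) + 1) := by
  have e : ∀ s : ℕ, P.q ^ ((s : ℤ) + 1) = P.q ^ (s + 1) := fun s => by exact_mod_cast rfl
  fin_cases i
  · exact ⟨1, fun s => by rw [e]; simp [pt, base, terminal, h, singularPoints]; ring⟩
  · exact ⟨2, fun s => by rw [e]; simp [pt, base, terminal, h, singularPoints]; ring⟩
  · exact ⟨4, fun s => by rw [e]; simp [pt, base, terminal, h, singularPoints]; ring⟩

theorem pt_eq_of_not (h : ¬ ‖P.q‖ < 1) (i : Fin 3) :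
    ∃ j, ∀ s, P.pt t i s = P.singularPoints t j * P.q ^ (-(s : ℤ)) := by
  have e : ∀ s : ℕ, P.q ^ (-(s : ℤ)) = P.q⁻¹ ^ s := fun s => by simp
  fin_cases i
  · exact ⟨0, fun s => by rw [e]; simp [pt, base, terminal, h, singularPoints]⟩
  · exact ⟨3, fun s => by rw [e]; simp [pt, base, terminal, h, singularPoints]⟩
  · exact ⟨5, fun s => by rw [e]; simp [pt, base, terminal, h, singularPoints]⟩

theorem exists_pt_eq (P : LaxParams) (t : ℂ) (i : Fin 3) (s : ℕ) :
    ∃ j, ∃ m : ℤ, P.pt t i s = P.singularPoints t j * P.q ^ m := by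
  by_cases h : ‖P.q‖ < 1
  · obtain ⟨j, hj⟩ := pt_eq_of_lt (t := t) h i
    exact ⟨j, _, hj s⟩
  · obtain ⟨j, hj⟩ := pt_eq_of_not (t := t) h i
    exact ⟨j, _, hj s⟩

theorem pt_ne_of_lt (hP : P.Standing t) (h : ‖P.q‖ < 1) (i : Fin 3) (s : ℕ) (j : Fin 6) :
    P.pt t i s ≠ P.singularPoints t j := by
  obtain ⟨k, hk⟩ := pt_eq_of_lt (t := t) h i
  rw [hk]
  exact hP.singularPoints_mul_zpow_ne k j (by omega)

theorem pt_succ_ne_of_not (hP : P.Standing t) (h : ¬ ‖P.q‖ < 1) (i : Fin 3) (s : ℕ) (j : Fin 6) :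
    P.pt t i (s + 1) ≠ P.singularPoints t j := by
  obtain ⟨k, hk⟩ := pt_eq_of_not (t := t) h i
  rw [hk]
  exact hP.singularPoints_mul_zpow_ne k j (by push_cast; omega)

/-- Outer boundary condition for |q| < 1: the point one step outwards from the terminal is a zero of
W - Δy V. For |q| > 1 the next lemma puts a zero of W + Δy V at the terminal itself. -/
theorem eval_WminusV_pt_zero (hP : P.Standing t) (h : ‖P.q‖ < 1) (i : Fin 3) :
    (P.WminusV t).eval (P.q⁻¹ * P.pt t i 0) = 0 := by
  have h2 := hP.b₂_ne_zero
  have h3 := hP.b₃_ne_zero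
  have hq := hP.q_ne_zero
  rw [eval_WminusV]
  fin_cases i <;> simp [pt, terminal, h] <;> field_simp <;> simp

theorem eval_WplusV_pt_zero (hP : P.Standing t) (h : ¬ ‖P.q‖ < 1) (i : Fin 3) :
    (P.WplusV t).eval (P.pt t i 0) = 0 := by
  have h2 := hP.b₁_ne_zero
  have h3 := hP.b₄_ne_zero
  have h6 := hP.b₆_ne_zero
  rw [eval_WplusV]
  fin_cases i <;> simp [pt, terminal, h] <;> field_simp <;> simp

/-! ### The integral as a linear functional -/

/-- Boundedness on the support of the integral. -/
def BddOnSupport (P : LaxParams) (t : ℂ) (F : ℂ → ℂ) : Prop := ∃ C, ∀ i s, ‖F (P.pt t i s)‖ ≤ C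

theorem BddOnSupport.mul {F G : ℂ → ℂ} (hF : P.BddOnSupport t F) (hG : P.BddOnSupport t G) :
    P.BddOnSupport t fun y => F y * G y := by
  obtain ⟨C, hC⟩ := hF
  obtain ⟨D, hD⟩ := hG
  refine ⟨C * D, fun i s => ?_⟩
  rw [norm_mul]
  exact mul_le_mul (hC i s) (hD i s) (norm_nonneg _) ((norm_nonneg _).trans (hC i s))

theorem bddOnSupport_of_tendsto (hP : P.Standing t) {F : ℂ → ℂ} {l : ℂ}
    (hF : Tendsto F (𝓝 0) (𝓝 l)) : P.BddOnSupport t F := by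
  have h : ∀ i, ∃ C, ∀ s, ‖F (P.pt t i s)‖ ≤ C := fun i => by
    obtain ⟨C, hC⟩ := (Metric.isBounded_range_of_tendsto _
      (hF.comp (tendsto_pt hP i))).exists_norm_le
    exact ⟨C, fun s => hC _ ⟨s, rfl⟩⟩
  choose C hC using h
  refine ⟨∑ i, |C i|, fun i s => (hC i s).trans ((le_abs_self _).trans ?_)⟩
  exact Finset.single_le_sum (f := fun i => |C i|) (fun _ _ => abs_nonneg _) (Finset.mem_univ i)

theorem bddOnSupport_weight (hP : P.Standing t) : P.BddOnSupport t (P.weight t) :=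
  bddOnSupport_of_tendsto hP (tendsto_weight hP)

theorem bddOnSupport_eval (hP : P.Standing t) (r : ℂ[X]) : P.BddOnSupport t fun y => r.eval y :=
  bddOnSupport_of_tendsto hP r.continuous.continuousAt

/-- The factor Δy decays geometrically along each lattice, so boundedness of the integrand is
enough. -/
theorem BddOnSupport.summable (hP : P.Standing t) {F : ℂ → ℂ} (hF : P.BddOnSupport t F)
    (i : Fin 3) : Summable fun s => P.Δy (P.pt t i s) * F (P.pt t i s) := by
  obtain ⟨C, hC⟩ := hF
  have h := (summable_geometric_of_lt_one (norm_nonneg _) (norm_base_lt_one hP)).mul_left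
    (‖(P.q - 1) * P.terminal t i‖ * C)
  refine .of_norm_bounded h fun s => ?_
  rw [Δy, pt, ← mul_assoc, norm_mul, norm_mul, norm_pow, mul_right_comm]
  exact mul_le_mul_of_nonneg_right (mul_le_mul_of_nonneg_left (hC i s) (norm_nonneg _))
    (by positivity)

theorem dIntegral_eq (P : LaxParams) (t : ℂ) (F : ℂ → ℂ) :
    P.dIntegral t F = ∑ i, P.c i * ∑' s, P.Δy (P.pt t i s) * F (P.pt t i s) := rfl

theorem dIntegral_congr {F G : ℂ → ℂ} (h : ∀ i s, F (P.pt t i s) = G (P.pt t i s)) :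
    P.dIntegral t F = P.dIntegral t G := by simp only [dIntegral_eq, h]

theorem dIntegral_add (hP : P.Standing t) {F G : ℂ → ℂ} (hF : P.BddOnSupport t F)
    (hG : P.BddOnSupport t G) :
    P.dIntegral t (fun y => F y + G y) = P.dIntegral t F + P.dIntegral t G := by
  simp only [dIntegral_eq, mul_add, ← Finset.sum_add_distrib]
  refine Finset.sum_congr rfl fun i _ => ?_
  rw [(hF.summable hP i).tsum_add (hG.summable hP i), mul_add]

theorem dIntegral_const_mul (P : LaxParams) (t a : ℂ) (F : ℂ → ℂ) :
    P.dIntegral t (fun y => a * F y) = a * P.dIntegral t F := by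
  simp only [dIntegral_eq, Finset.mul_sum, ← tsum_mul_left]
  refine Finset.sum_congr rfl fun i _ => tsum_congr fun s => ?_
  ring

/-- `x` has positive distance from the support of the integral. -/
def AwaySupport (P : LaxParams) (t x : ℂ) : Prop := ∃ ε > 0, ∀ i s, ε ≤ ‖x - P.pt t i s‖

theorem exists_norm_pt_le (hP : P.Standing t) : ∃ R, ∀ i s, ‖P.pt t i s‖ ≤ R :=
  bddOnSupport_of_tendsto hP (F := fun y => y) tendsto_id

theorem eventually_awaySupport (hP : P.Standing t) :
    ∀ᶠ x in Bornology.cobounded ℂ, P.AwaySupport t x := by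
  obtain ⟨R, hR⟩ := exists_norm_pt_le hP
  filter_upwards [tendsto_norm_cobounded_atTop.eventually_ge_atTop (R + 1)] with x hx
  refine ⟨1, one_pos, fun i s => ?_⟩
  have := norm_sub_norm_le x (P.pt t i s)
  linarith [hR i s]

theorem AwaySupport.ne {x : ℂ} (hx : P.AwaySupport t x) (i : Fin 3) (s : ℕ) :
    x - P.pt t i s ≠ 0 := by
  obtain ⟨ε, hε, h⟩ := hx
  exact norm_pos_iff.1 (hε.trans_le (h i s))

theorem AwaySupport.bddOnSupport {x : ℂ} (hx : P.AwaySupport t x) :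
    P.BddOnSupport t fun y => (x - y)⁻¹ := by
  obtain ⟨ε, hε, h⟩ := hx
  refine ⟨ε⁻¹, fun i s => ?_⟩
  rw [norm_inv]
  exact inv_anti₀ hε (h i s)

/-- The support accumulates only at 0, and x ≠ 0: thus 1/(x - y) has a limit along the support and
is bounded there. -/
theorem OffLattice.awaySupport (hP : P.Standing t) {x : ℂ} (hx : P.OffLattice t x) :
    P.AwaySupport t x := by
  have h1 : Tendsto (fun y => (x - y)⁻¹) (𝓝 0) (𝓝 x⁻¹) := by
    have : ContinuousAt (fun y : ℂ => (x - y)⁻¹) 0 :=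
      ContinuousAt.inv₀ (by fun_prop) (by simpa using hx.1)
    simpa [ContinuousAt] using this
  obtain ⟨C, hC⟩ := bddOnSupport_of_tendsto hP h1
  have hne : ∀ i s, 0 < ‖x - P.pt t i s‖ := fun i s => norm_pos_iff.2 (sub_ne_zero.2 fun h => by
    obtain ⟨j, m, hj⟩ := exists_pt_eq P t i s
    exact hx.2 j m (h.trans hj))
  have hC0 : 0 < C := lt_of_lt_of_le (by rw [norm_inv]; exact inv_pos.2 (hne 0 0)) (hC 0 0)
  refine ⟨C⁻¹, inv_pos.2 hC0, fun i s => ?_⟩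
  have := hC i s
  rw [norm_inv] at this
  exact inv_le_of_inv_le₀ (hne i s) this

/-! ### Moments and Stieltjes transforms -/

/-- The moment functional of the weight. -/
noncomputable def moment (P : LaxParams) (t : ℂ) (r : ℂ[X]) : ℂ :=
  P.dIntegral t fun y => P.weight t y * r.eval y

/-- The Stieltjes transform of a polynomial multiple of the weight. -/
noncomputable def stieltjes (P : LaxParams) (t : ℂ) (r : ℂ[X]) (x : ℂ) : ℂ :=
  P.dIntegral t fun y => P.weight t y * r.eval y / (x - y)

theorem bddOnSupport_weight_mul (hP : P.Standing t) (r : ℂ[X]) :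
    P.BddOnSupport t fun y => P.weight t y * r.eval y :=
  (bddOnSupport_weight hP).mul (bddOnSupport_eval hP r)

theorem bddOnSupport_weight_mul_div (hP : P.Standing t) (r : ℂ[X]) {x : ℂ}
    (hx : P.AwaySupport t x) : P.BddOnSupport t fun y => P.weight t y * r.eval y / (x - y) := by
  simpa only [div_eq_mul_inv] using (bddOnSupport_weight_mul hP r).mul hx.bddOnSupport

theorem moment_add (hP : P.Standing t) (r s : ℂ[X]) :
    P.moment t (r + s) = P.moment t r + P.moment t s := by
  simp only [moment, eval_add, mul_add]
  exact dIntegral_add hP (bddOnSupport_weight_mul hP r) (bddOnSupport_weight_mul hP s)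

theorem moment_C_mul (P : LaxParams) (t a : ℂ) (r : ℂ[X]) :
    P.moment t (C a * r) = a * P.moment t r := by
  simp only [moment, ← dIntegral_const_mul, eval_mul, eval_C]
  refine dIntegral_congr fun i s => ?_
  ring

theorem moment_zero (P : LaxParams) (t : ℂ) : P.moment t 0 = 0 := by
  simpa using moment_C_mul P t 0 0

theorem moment_sub (hP : P.Standing t) (r s : ℂ[X]) :
    P.moment t (r - s) = P.moment t r - P.moment t s := by
  have := moment_add hP (r - s) s
  rw [sub_add_cancel] at this
  rw [this, add_sub_cancel_right]

theorem stieltjes_add (hP : P.Standing t) {x : ℂ} (hx : P.AwaySupport t x) (r s : ℂ[X]) :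
    P.stieltjes t (r + s) x = P.stieltjes t r x + P.stieltjes t s x := by
  simp only [stieltjes, eval_add, mul_add, add_div]
  exact dIntegral_add hP (bddOnSupport_weight_mul_div hP r hx)
    (bddOnSupport_weight_mul_div hP s hx)

theorem stieltjes_C_mul (P : LaxParams) (t a x : ℂ) (r : ℂ[X]) :
    P.stieltjes t (C a * r) x = a * P.stieltjes t r x := by
  simp only [stieltjes, ← dIntegral_const_mul, eval_mul, eval_C]
  refine dIntegral_congr fun i s => ?_
  ring

theorem stieltjes_X_mul (hP : P.Standing t) {x : ℂ} (hx : P.AwaySupport t x) (r : ℂ[X]) :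
    P.stieltjes t (X * r) x = x * P.stieltjes t r x - P.moment t r := by
  rw [eq_sub_iff_add_eq, stieltjes, stieltjes, moment, ← dIntegral_add hP
    (bddOnSupport_weight_mul_div hP _ hx) (bddOnSupport_weight_mul hP r), ← dIntegral_const_mul]
  refine dIntegral_congr fun i s => ?_
  have := hx.ne i s
  simp only [eval_mul, eval_X]
  field_simp
  ring

/-- Split r(y)/(x - y) into r(x)/(x - y) and minus the divided difference of r. Here ρ(x) is the
integral of w(y) (r(x) - r(y))/(x - y), and at x = 0 the divided difference is (r(y) - r(0))/y. -/
theorem exists_stieltjes_eq (hP : P.Standing t) (r : ℂ[X]) :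
    ∃ ρ : ℂ[X], (∀ x, P.AwaySupport t x →
      P.stieltjes t r x = r.eval x * P.stieltjes t 1 x - ρ.eval x) ∧
      ρ.eval 0 = P.moment t r.divX := by
  induction r using Polynomial.induction_on with
  | C a =>
    refine ⟨0, fun x _ => ?_, by simp [moment_zero]⟩
    have := stieltjes_C_mul P t a x 1
    rw [mul_one] at this
    simp [this]
  | add r s hr hs =>
    obtain ⟨ρ, h1, h2⟩ := hr
    obtain ⟨σ, h3, h4⟩ := hs
    refine ⟨ρ + σ, fun x hx => ?_, by rw [divX_add, moment_add hP, eval_add, h2, h4]⟩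
    rw [stieltjes_add hP hx, h1 x hx, h3 x hx, eval_add, eval_add]
    ring
  | monomial n a ih =>
    obtain ⟨ρ, h1, -⟩ := ih
    have e : C a * X ^ (n + 1) = X * (C a * X ^ n) := by ring
    refine ⟨X * ρ + C (P.moment t (C a * X ^ n)), fun x hx => ?_, ?_⟩
    · rw [e, stieltjes_X_mul hP hx, h1 x hx]
      simp
      ring
    · have hd : (X * (C a * X ^ n) : ℂ[X]).divX = C a * X ^ n := by
        ext m
        rw [coeff_divX, coeff_X_mul]
      rw [e, hd]
      simp

/-! ### The `q`-difference equation of the Stieltjes transform -/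

theorem tsum_eq_tsum_succ {f : ℕ → ℂ} (h : f 0 = 0) : ∑' s, f s = ∑' s, f (s + 1) := by
  refine ((add_left_injective 1).tsum_eq (f := f) fun s hs => ?_).symm
  cases s with
  | zero => exact absurd h hs
  | succ s => exact ⟨s, rfl⟩

/-- The change of variable `y ↦ q y` in the integral, by the Pearson equation. -/
theorem dIntegral_shift (hP : P.Standing t) (G : ℂ → ℂ) :
    P.dIntegral t (fun y => P.weight t y * ((P.WminusV t).eval (P.q⁻¹ * y) * G y)) =
      P.q * P.dIntegral t (fun y => P.weight t y * ((P.WplusV t).eval y * G (P.q * y))) := by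
  simp only [dIntegral_eq, Finset.mul_sum]
  refine Finset.sum_congr rfl fun i _ => ?_
  rw [mul_left_comm, ← tsum_mul_left (a := P.q)]
  congr 1
  have key : ∀ y, (∀ j, y ≠ P.singularPoints t j) →
      P.Δy (P.q * y) * (P.weight t (P.q * y) *
        ((P.WminusV t).eval (P.q⁻¹ * (P.q * y)) * G (P.q * y))) =
      P.q * (P.Δy y * (P.weight t y * ((P.WplusV t).eval y * G (P.q * y)))) := fun y hy => by
    rw [inv_mul_cancel_left₀ hP.q_ne_zero, Δy, Δy]
    linear_combination (P.q - 1) * P.q * y * G (P.q * y) * pearson hP hy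
  -- Multiplication by q steps inwards when |q| < 1 and outwards when |q| > 1. The unmatched
  -- terminal point belongs to the left sum in the first case and to the right sum in the second,
  -- and its term vanishes in both.
  by_cases h : ‖P.q‖ < 1
  · rw [tsum_eq_tsum_succ (by simp [eval_WminusV_pt_zero hP h])]
    refine tsum_congr fun s => ?_
    rw [pt_succ_of_lt h]
    exact key _ (pt_ne_of_lt hP h i s)
  · rw [tsum_eq_tsum_succ (f := fun s => P.q * (P.Δy (P.pt t i s) * (P.weight t (P.pt t i s) *
      ((P.WplusV t).eval (P.pt t i s) * G (P.q * P.pt t i s)))))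
      (by simp [eval_WplusV_pt_zero hP h])]
    refine tsum_congr fun s => ?_
    rw [← q_mul_pt_succ_of_not hP h]
    exact key _ (pt_succ_ne_of_not hP h i s)

/-- `(W - Δy V)(q⁻¹ x)`. -/
noncomputable def WminusVShift (P : LaxParams) (t : ℂ) : ℂ[X] := (P.WminusV t).comp (C P.q⁻¹ * X)

theorem eval_WminusVShift (P : LaxParams) (t x : ℂ) :
    (P.WminusVShift t).eval x = (P.WminusV t).eval (P.q⁻¹ * x) := by simp [WminusVShift]

theorem tsum_sub_succ_of_tendsto {h : ℕ → ℂ} {l : ℂ} (hl : Tendsto h atTop (𝓝 l))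
    (hs : Summable fun s => h (s + 1) - h s) : ∑' s, (h (s + 1) - h s) = l - h 0 := by
  refine tendsto_nhds_unique hs.hasSum.tendsto_sum_nat ?_
  simp only [Finset.sum_range_sub]
  exact hl.sub_const _

/-- The boundary terms of the integral cancel. -/
theorem moment_divX_eq_zero (hP : P.Standing t) :
    P.moment t (P.WminusVShift t - P.WplusV t).divX = 0 := by
  set r := (P.WminusVShift t - P.WplusV t).divX with hr
  have hr' : ∀ y, y * r.eval y = (P.WminusV t).eval (P.q⁻¹ * y) - (P.WplusV t).eval y := by
    intro y
    have h1 := congrArg (eval y) (divX_mul_X_add (P.WminusVShift t - P.WplusV t))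
    have h2 : (P.WminusVShift t - P.WplusV t).coeff 0 = 0 := by
      rw [coeff_zero_eq_eval_zero]
      simp [eval_WminusVShift, eval_WminusV, eval_WplusV]
    rw [h2] at h1
    simp only [← hr, eval_mul, eval_X, C_0, add_zero, eval_sub,
      eval_WminusVShift] at h1
    rw [mul_comm, h1]
  have hlim : ∀ i, Tendsto (fun s => P.weight t (P.pt t i s) * (P.WplusV t).eval (P.pt t i s))
      atTop (𝓝 (P.b₆ * t)) := fun i => by
    have h1 := ((tendsto_weight hP).mul (P.WplusV t).continuous.continuousAt).comp
      (tendsto_pt hP i)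
    simpa [eval_WplusV, Function.comp_def] using h1
  have hterm : ∀ i s, P.Δy (P.pt t i s) * (P.weight t (P.pt t i s) * r.eval (P.pt t i s)) =
      (P.q - 1) * (P.weight t (P.pt t i s) * (P.WminusV t).eval (P.q⁻¹ * P.pt t i s) -
        P.weight t (P.pt t i s) * (P.WplusV t).eval (P.pt t i s)) := fun i s => by
    rw [Δy]
    linear_combination (P.q - 1) * P.weight t (P.pt t i s) * hr' (P.pt t i s)
  have hsum := fun i => (bddOnSupport_weight_mul hP r).summable hP i
  -- Each lattice sum telescopes. Its value depends only on the limit b₆t of w · (W + Δy V) at 0,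
  -- hence not on i, and the c_i sum to zero.
  suffices H : ∃ l, ∀ i, ∑' s, P.Δy (P.pt t i s) *
      (P.weight t (P.pt t i s) * r.eval (P.pt t i s)) = l by
    obtain ⟨l, H⟩ := H
    rw [moment, dIntegral_eq]
    simp only [H]
    rw [← Finset.sum_mul, hP.sum_c, zero_mul]
  by_cases h : ‖P.q‖ < 1
  · refine ⟨-((P.q - 1) * (P.b₆ * t)), fun i => ?_⟩
    set u : ℕ → ℂ := fun s => P.weight t (P.pt t i s) * (P.WplusV t).eval (P.pt t i s) with hu
    have hs : ∀ s, P.Δy (P.pt t i (s + 1)) *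
        (P.weight t (P.pt t i (s + 1)) * r.eval (P.pt t i (s + 1))) =
        -(P.q - 1) * (u (s + 1) - u s) := fun s => by
      have hp := pearson hP (pt_ne_of_lt hP h i s)
      rw [hterm]
      simp only [hu]
      have e : P.q⁻¹ * P.pt t i (s + 1) = P.pt t i s := by
        rw [pt_succ_of_lt h, inv_mul_cancel_left₀ hP.q_ne_zero]
      rw [e, ← hp, ← pt_succ_of_lt h]
      ring
    have h0 : P.Δy (P.pt t i 0) * (P.weight t (P.pt t i 0) * r.eval (P.pt t i 0)) =
        -(P.q - 1) * u 0 := by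
      rw [hterm, eval_WminusV_pt_zero hP h]
      ring
    have hs1 := (summable_nat_add_iff 1).2 (hsum i)
    rw [(hsum i).tsum_eq_zero_add, h0]
    simp only [hs] at hs1 ⊢
    rw [tsum_mul_left, tsum_sub_succ_of_tendsto (hlim i)
      ((summable_mul_left_iff (neg_ne_zero.2 (sub_ne_zero.2 hP.q_ne_one))).1 hs1)]
    ring
  · refine ⟨(P.q - 1) * (P.b₆ * t), fun i => ?_⟩
    set u : ℕ → ℂ := fun s => P.weight t (P.pt t i s) * (P.WplusV t).eval (P.pt t i s) with hu
    have hs : ∀ s, P.Δy (P.pt t i s) *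
        (P.weight t (P.pt t i s) * r.eval (P.pt t i s)) =
        (P.q - 1) * (u (s + 1) - u s) := fun s => by
      have hp := pearson hP (pt_succ_ne_of_not hP h i s)
      rw [q_mul_pt_succ_of_not hP h] at hp
      rw [hterm]
      simp only [hu]
      have e : P.q⁻¹ * P.pt t i s = P.pt t i (s + 1) := by
        rw [← q_mul_pt_succ_of_not hP h, inv_mul_cancel_left₀ hP.q_ne_zero]
      rw [e, hp]
    have hs1 := hsum i
    simp only [hs] at hs1 ⊢
    rw [tsum_mul_left, tsum_sub_succ_of_tendsto (hlim i)
      ((summable_mul_left_iff (sub_ne_zero.2 hP.q_ne_one)).1 hs1)]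
    simp [eval_WplusV_pt_zero hP h]

theorem stieltjes_shift (hP : P.Standing t) (x : ℂ) :
    P.stieltjes t (P.WminusVShift t) (P.q * x) = P.stieltjes t (P.WplusV t) x := by
  have h := dIntegral_shift hP fun y => (P.q * x - y)⁻¹
  rw [← dIntegral_const_mul] at h
  have hq := hP.q_ne_zero
  rw [stieltjes, stieltjes]
  refine (dIntegral_congr fun i s => ?_).trans (h.trans (dIntegral_congr fun i s => ?_))
  · rw [eval_WminusVShift]
    ring
  · rw [← mul_sub, mul_inv]
    field_simp

/-- R is a difference of two associated polynomials, and R(0) is the moment that measures the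
boundary terms at 0. Its vanishing is what later fixes the constant terms of the spectral
polynomials. -/
theorem exists_stieltjes_one_shift (hP : P.Standing t) :
    ∃ R : ℂ[X], R.eval 0 = 0 ∧ ∀ x, P.AwaySupport t x → P.AwaySupport t (P.q * x) →
      (P.WminusV t).eval x * P.stieltjes t 1 (P.q * x) =
        (P.WplusV t).eval x * P.stieltjes t 1 x + R.eval x := by
  obtain ⟨ρ, h1, h2⟩ := exists_stieltjes_eq hP (P.WminusVShift t)
  obtain ⟨σ, h3, h4⟩ := exists_stieltjes_eq hP (P.WplusV t)
  refine ⟨ρ.comp (C P.q * X) - σ, ?_, fun x hx hqx => ?_⟩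
  · have h5 := moment_divX_eq_zero hP
    rw [show (P.WminusVShift t - P.WplusV t).divX =
      (P.WminusVShift t).divX - (P.WplusV t).divX by ext; simp [coeff_divX], moment_sub hP] at h5
    simpa [h2, h4] using h5
  · have h6 := stieltjes_shift hP x
    rw [h1 _ hqx, h3 _ hx, eval_WminusVShift, inv_mul_cancel_left₀ hP.q_ne_zero] at h6
    simp only [eval_sub, eval_comp, eval_mul, eval_C, eval_X]
    linear_combination h6

end LaxParams

/-! ### Leading behaviour at infinity -/

/-- `φ x / x ^ k` tends to `c` at infinity. -/
def LeadAt (φ : ℂ → ℂ) (k : ℤ) (c : ℂ) : Prop :=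
  Tendsto (fun x => φ x / x ^ k) (Bornology.cobounded ℂ) (𝓝 c)

theorem eventually_ne_zero_cobounded : ∀ᶠ x in Bornology.cobounded ℂ, x ≠ 0 := by
  filter_upwards [tendsto_norm_cobounded_atTop.eventually_gt_atTop 0] with x hx
  exact norm_pos_iff.1 hx

theorem tendsto_const_mul_cobounded {q : ℂ} (hq : q ≠ 0) :
    Tendsto (fun x => q * x) (Bornology.cobounded ℂ) (Bornology.cobounded ℂ) := by
  rw [← tendsto_norm_atTop_iff_cobounded]
  simp only [norm_mul]
  exact tendsto_norm_cobounded_atTop.const_mul_atTop (norm_pos_iff.2 hq)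

namespace LeadAt

variable {φ ψ : ℂ → ℂ} {k l m : ℤ} {c d e : ℂ}

theorem congr (h : LeadAt φ k c) (he : ∀ᶠ x in Bornology.cobounded ℂ, φ x = ψ x) :
    LeadAt ψ k c :=
  Tendsto.congr' (he.mono fun x hx => by simp only [hx]) h

theorem mul (hφ : LeadAt φ k c) (hψ : LeadAt ψ l d) (hk : k + l = m) (hc : c * d = e) :
    LeadAt (fun x => φ x * ψ x) m e := by
  subst hk hc
  refine Tendsto.congr' ?_ (Tendsto.mul hφ hψ)
  filter_upwards [eventually_ne_zero_cobounded] with x hx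
  rw [zpow_add₀ hx, mul_div_mul_comm]

theorem const_mul (a : ℂ) (hφ : LeadAt φ k c) : LeadAt (fun x => a * φ x) k (a * c) := by
  simpa only [LeadAt, mul_div_assoc] using Tendsto.const_mul a hφ

theorem sub (hφ : LeadAt φ k c) (hψ : LeadAt ψ k d) :
    LeadAt (fun x => φ x - ψ x) k (c - d) := by
  simpa only [LeadAt, sub_div] using Tendsto.sub hφ hψ

theorem of_lt (hφ : LeadAt φ k c) (h : k < m) : LeadAt φ m 0 := by
  have h1 : Tendsto (fun x : ℂ => x ^ (k - m)) (Bornology.cobounded ℂ) (𝓝 0) := by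
    obtain ⟨j, hj⟩ : ∃ j : ℕ, k - m = -((j + 1 : ℕ) : ℤ) := ⟨(m - k - 1).toNat, by omega⟩
    have h2 := (tendsto_inv₀_cobounded (α := ℂ)).pow (j + 1)
    rw [zero_pow j.succ_ne_zero] at h2
    refine h2.congr fun x => ?_
    rw [hj, zpow_neg, zpow_natCast, inv_pow]
  have h2 := Tendsto.mul hφ h1
  rw [mul_zero] at h2
  refine Tendsto.congr' ?_ h2
  filter_upwards [eventually_ne_zero_cobounded] with x hx
  rw [zpow_sub₀ hx]
  field_simp [zpow_ne_zero k hx]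

theorem comp_mul {q : ℂ} (hq : q ≠ 0) (hφ : LeadAt φ k c) :
    LeadAt (fun x => φ (q * x)) k (c * q ^ k) := by
  have h := (Tendsto.comp hφ (tendsto_const_mul_cobounded hq)).mul_const (q ^ k)
  refine h.congr fun x => ?_
  have := zpow_ne_zero k hq
  simp only [Function.comp_apply, mul_zpow]
  field_simp

theorem unique (h : LeadAt φ k c) (h' : LeadAt φ k d) : c = d := tendsto_nhds_unique h h'

end LeadAt

theorem leadAt_const (c : ℂ) : LeadAt (fun _ => c) 0 c := by simp [LeadAt]

theorem leadAt_id : LeadAt (fun x => x) 1 1 := by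
  refine (tendsto_const_nhds (x := (1 : ℂ))).congr' ?_
  filter_upwards [eventually_ne_zero_cobounded] with x hx
  rw [zpow_one, div_self hx]

theorem leadAt_sub_mul (α β : ℂ) : LeadAt (fun x => α - β * x) 1 (-β) := by
  simpa using ((leadAt_const α).of_lt one_pos).sub (leadAt_id.const_mul β)

theorem leadAt_eval {r : ℂ[X]} {n : ℕ} (hr : r.natDegree ≤ n) :
    LeadAt (fun x => r.eval x) n (r.coeff n) := by
  induction n generalizing r with
  | zero =>
    rw [eq_C_of_natDegree_le_zero hr]
    simpa using leadAt_const (r.coeff 0)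
  | succ n ih =>
    have h := ((ih (r := r.divX) (by rw [natDegree_divX_eq_natDegree_tsub_one]; omega)).mul leadAt_id
      (m := (n + 1 : ℕ)) (by push_cast; rfl) (mul_one _)).sub
      (((leadAt_const (-r.coeff 0))).of_lt (m := (n + 1 : ℕ)) (by positivity))
    rw [coeff_divX, sub_zero] at h
    refine h.congr (Eventually.of_forall fun x => ?_)
    conv_rhs => rw [← divX_mul_X_add r]
    simp

/-- This turns asymptotics into algebra: once a combination of p_n and q_n is known to be a
polynomial, its growth at infinity gives its degree bound and top coefficient. -/
theorem LeadAt.natDegree_le_and_coeff {r : ℂ[X]} {n : ℕ} {c : ℂ}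
    (h : LeadAt (fun x => r.eval x) n c) : r.natDegree ≤ n ∧ r.coeff n = c := by
  have hd : r.natDegree ≤ n := by
    by_contra! hd
    have h1 := leadAt_eval (le_refl r.natDegree)
    have h2 := h.of_lt (m := r.natDegree) (by exact_mod_cast hd)
    have h3 := h1.unique h2
    rw [coeff_natDegree, leadingCoeff_eq_zero] at h3
    simp [h3] at hd
  exact ⟨hd, (leadAt_eval hd).unique h⟩

theorem Polynomial.eq_of_eventually_cobounded {r s : ℂ[X]}
    (h : ∀ᶠ x in Bornology.cobounded ℂ, r.eval x = s.eval x) : r = s := by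
  have h1 : LeadAt (fun x => (r - s).eval x) (0 : ℕ) 0 := by
    simpa using (leadAt_const 0).congr (h.mono fun x hx => by simp [hx])
  obtain ⟨h2, h3⟩ := h1.natDegree_le_and_coeff
  rw [← sub_eq_zero, eq_C_of_natDegree_le_zero h2, h3, C_0]

namespace LaxParams

variable {P : LaxParams} {t : ℂ}

/-! ### Orthogonality -/

section Orthogonality

variable {p : ℕ → ℂ[X]}

theorem IsOPS.moment_mul (hp : P.IsOPS t p) (n m : ℕ) :
    P.moment t (p n * p m) = if n = m then 1 else 0 := by
  rw [← hp.2 n m]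
  refine dIntegral_congr fun i s => ?_
  rw [eval_mul, mul_assoc]

theorem IsOPS.leadingCoeff_ne_zero (hp : P.IsOPS t p) (n : ℕ) : (p n).leadingCoeff ≠ 0 := by
  intro h
  have := hp.moment_mul n n
  rw [leadingCoeff_eq_zero.1 h, zero_mul, moment_zero, if_pos rfl] at this
  exact zero_ne_one this

theorem IsOPS.coeff_self (hp : P.IsOPS t p) (n : ℕ) : (p n).coeff n = (p n).leadingCoeff := by
  rw [leadingCoeff, hp.1]

theorem IsOPS.degree_sub_lt (hp : P.IsOPS t p) {r : ℂ[X]} {k : ℕ} (hr : r.degree < (k + 1 : ℕ)) :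
    (r - C (r.coeff k / (p k).leadingCoeff) * p k).degree < k := by
  rw [degree_lt_iff_coeff_zero] at hr ⊢
  intro m hm
  rw [coeff_sub, coeff_C_mul]
  rcases hm.eq_or_lt with rfl | hm
  · rw [hp.coeff_self, div_mul_cancel₀ _ (hp.leadingCoeff_ne_zero k), sub_self]
  · rw [hr m hm, coeff_eq_zero_of_natDegree_lt (p := p k) (by rw [hp.1]; exact hm), mul_zero, sub_zero]

theorem IsOPS.moment_mul_of_degree_lt (hP : P.Standing t) (hp : P.IsOPS t p) {n : ℕ} :
    ∀ d ≤ n, ∀ r : ℂ[X], r.degree < d → P.moment t (r * p n) = 0 := by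
  intro d
  induction d with
  | zero =>
    intro _ r hr
    rw [degree_lt_iff_coeff_zero] at hr
    rw [show r = 0 from ext fun m => by simp [hr m (Nat.zero_le m)], zero_mul, moment_zero]
  | succ d ih =>
    intro hd r hr
    have h1 := ih (by omega) _ (hp.degree_sub_lt hr)
    rwa [sub_mul, moment_sub hP, mul_assoc, moment_C_mul, hp.moment_mul, if_neg (by omega), mul_zero,
      sub_zero] at h1

theorem IsOPS.moment_X_pow_mul_self (hP : P.Standing t) (hp : P.IsOPS t p) (n : ℕ) :
    P.moment t (X ^ n * p n) = (p n).leadingCoeff⁻¹ := by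
  have h1 := hp.moment_mul_of_degree_lt hP n le_rfl _
    (hp.degree_sub_lt (r := X ^ n) (k := n) (by rw [degree_X_pow]; exact_mod_cast n.lt_succ_self))
  rw [sub_mul, moment_sub hP, mul_assoc, moment_C_mul, hp.moment_mul, if_pos rfl, coeff_X_pow_self,
    mul_one, sub_eq_zero, one_div] at h1
  exact h1

end Orthogonality

theorem tendsto_stieltjes (hP : P.Standing t) (r : ℂ[X]) : LeadAt (P.stieltjes t r) 0 0 := by
  obtain ⟨R, hR⟩ := exists_norm_pt_le hP
  obtain ⟨C, hC⟩ := bddOnSupport_weight_mul hP r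
  have hb := norm_base_lt_one hP
  set K : ℝ := ∑ i, ‖P.c i‖ * (‖(P.q - 1) * P.terminal t i‖ * C * (1 - ‖P.base‖)⁻¹) with hK
  have hbound : ∀ᶠ x in Bornology.cobounded ℂ, ‖P.stieltjes t r x‖ ≤ K * (‖x‖ - R)⁻¹ := by
    filter_upwards [tendsto_norm_cobounded_atTop.eventually_gt_atTop R] with x hx
    have hx0 : 0 < ‖x‖ - R := sub_pos.2 hx
    rw [stieltjes, dIntegral_eq, hK, Finset.sum_mul]
    refine (norm_sum_le _ _).trans (Finset.sum_le_sum fun i _ => ?_)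
    rw [norm_mul, mul_assoc]
    refine mul_le_mul_of_nonneg_left ?_ (norm_nonneg _)
    have hg := (hasSum_geometric_of_lt_one (norm_nonneg _) hb).mul_left
      (‖(P.q - 1) * P.terminal t i‖ * C * (‖x‖ - R)⁻¹)
    rw [mul_right_comm]
    refine tsum_of_norm_bounded hg fun s => ?_
    rw [Δy, pt, ← mul_assoc, norm_mul, norm_mul, norm_pow, norm_div, mul_right_comm, ← pt]
    refine mul_le_mul_of_nonneg_right ?_ (by positivity)
    rw [mul_assoc]
    refine mul_le_mul_of_nonneg_left ?_ (norm_nonneg _)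
    rw [div_eq_mul_inv]
    refine mul_le_mul (hC i s) (inv_anti₀ hx0 ?_) (by positivity)
      ((norm_nonneg _).trans (hC i s))
    linarith [norm_sub_norm_le x (P.pt t i s), hR i s]
  have hlim : Tendsto (fun x : ℂ => K * (‖x‖ - R)⁻¹) (Bornology.cobounded ℂ) (𝓝 0) := by
    have h1 : Tendsto (fun x : ℂ => ‖x‖ - R) (Bornology.cobounded ℂ) atTop :=
      tendsto_atTop_add_const_right _ (-R) tendsto_norm_cobounded_atTop
    simpa using (tendsto_inv_atTop_zero.comp h1).const_mul K
  simpa [LeadAt] using squeeze_zero_norm' hbound hlim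

/-- The transform of X r is x times that of r minus the moment of r, so every vanishing moment gains
one power of 1/x. The base case is decay of the transform at infinity. -/
theorem leadAt_stieltjes (hP : P.Standing t) {n : ℕ} : ∀ {r : ℂ[X]},
    (∀ j < n, P.moment t (X ^ j * r) = 0) →
    LeadAt (P.stieltjes t r) (-(n + 1)) (P.moment t (X ^ n * r)) := by
  have step : ∀ {r : ℂ[X]} {k : ℤ} {c : ℂ}, LeadAt (fun x => x * P.stieltjes t r x) k c →
      LeadAt (P.stieltjes t r) (k - 1) c := fun {r k c} h => by
    refine Tendsto.congr' ?_ h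
    filter_upwards [eventually_ne_zero_cobounded] with x hx
    rw [zpow_sub_one₀ hx]
    field_simp
  induction n with
  | zero =>
    intro r _
    have h1 := (tendsto_stieltjes hP (X * r)).sub (leadAt_const (-P.moment t r))
    rw [zero_sub, neg_neg] at h1
    simpa using step (h1.congr ((eventually_awaySupport hP).mono fun x hx => by
      rw [stieltjes_X_mul hP hx]; ring))
  | succ n ih =>
    intro r hr
    have h1 := ih (r := X * r) fun j hj => by
      rw [← mul_assoc, ← pow_succ]; exact hr (j + 1) (by omega)
    have h0 : P.moment t r = 0 := by simpa using hr 0 (by omega)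
    rw [← mul_assoc, ← pow_succ] at h1
    have h2 := step (r := r) (h1.congr ((eventually_awaySupport hP).mono fun x hx => by
      rw [stieltjes_X_mul hP hx, h0, sub_zero]))
    rwa [show -((n : ℤ) + 1) - 1 = -(((n + 1 : ℕ) : ℤ) + 1) by push_cast; ring] at h2

variable {p : ℕ → ℂ[X]}

/-! ### The entries of the matrix `Y_n` -/

/-- The sequence `r_{n-1}`, with `r_{-1} = 0`. -/
noncomputable def prevPoly (r : ℕ → ℂ[X]) : ℕ → ℂ[X]
  | 0 => 0
  | n + 1 => r n

/-- The functions `q_{n-1}`, with `q_{-1} = 1 / (a_0 γ_0)`. -/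
noncomputable def assocPrev (P : LaxParams) (t : ℂ) (p : ℕ → ℂ[X]) : ℕ → ℂ → ℂ
  | 0, _ => (P.a₀ * (p 0).leadingCoeff)⁻¹
  | n + 1, x => P.assoc t p n x

theorem Y_eq (P : LaxParams) (t : ℂ) (p : ℕ → ℂ[X]) (n : ℕ) (x : ℂ) :
    P.Y t p n x = !![(p n).eval x, P.assoc t p n x / P.weight t x;
      (prevPoly p n).eval x, P.assocPrev t p n x / P.weight t x] := by
  cases n <;> simp [Y, prevPoly, assocPrev]

theorem a_ne_zero (hP : P.Standing t) (hp : P.IsOPS t p) (n : ℕ) : P.a p n ≠ 0 := by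
  cases n with
  | zero => exact hP.a₀_ne_zero
  | succ n => exact div_ne_zero (hp.leadingCoeff_ne_zero _) (hp.leadingCoeff_ne_zero _)

/-- `φ = r F - ρ` with `F` the Stieltjes transform of the weight. -/
def SecondKind (P : LaxParams) (t : ℂ) (r : ℂ[X]) (φ : ℂ → ℂ) (ρ : ℂ[X]) : Prop :=
  ∀ x, P.AwaySupport t x → φ x = r.eval x * P.stieltjes t 1 x - ρ.eval x

theorem exists_secondKind_assoc (hP : P.Standing t) (p : ℕ → ℂ[X]) (n : ℕ) :
    ∃ ρ, P.SecondKind t (p n) (P.assoc t p n) ρ := by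
  obtain ⟨ρ, h, -⟩ := exists_stieltjes_eq hP (p n)
  exact ⟨ρ, h⟩

theorem exists_secondKind_assocPrev (hP : P.Standing t) (p : ℕ → ℂ[X]) (n : ℕ) :
    ∃ ρ, P.SecondKind t (prevPoly p n) (P.assocPrev t p n) ρ := by
  cases n with
  | zero => exact ⟨C (-(P.a₀ * (p 0).leadingCoeff)⁻¹), fun x _ => by simp [prevPoly, assocPrev]⟩
  | succ n => exact exists_secondKind_assoc hP p n

theorem SecondKind.eval_bracket {r s ρ σ : ℂ[X]} {φ ψ : ℂ → ℂ} (h : P.SecondKind t r φ ρ)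
    (h' : P.SecondKind t s ψ σ) {x : ℂ} (hx : P.AwaySupport t x) :
    (ρ * s - r * σ).eval x = r.eval x * ψ x - φ x * s.eval x := by
  rw [h x hx, h' x hx]
  simp
  ring

/-- With φ = rF - ρ and ψ = sF - σ, the transform enters only through (W + Δy V)(x) F(x) - (W - Δy
V)(x) F(qx), which is the polynomial -R(x). The value at 0 uses R(0) = 0 and W ± Δy V = b₆t at 0. -/
theorem SecondKind.exists_shift_bracket (hP : P.Standing t) {r s ρ σ : ℂ[X]} {φ ψ : ℂ → ℂ}
    (h : P.SecondKind t r φ ρ) (h' : P.SecondKind t s ψ σ) :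
    ∃ T : ℂ[X], (∀ x, P.AwaySupport t x → P.AwaySupport t (P.q * x) →
      T.eval x = (P.WplusV t).eval x * r.eval (P.q * x) * ψ x -
        (P.WminusV t).eval x * φ (P.q * x) * s.eval x) ∧
      T.eval 0 = P.b₆ * t * (ρ * s - r * σ).eval 0 := by
  obtain ⟨R, hR0, hR⟩ := exists_stieltjes_one_shift hP
  refine ⟨P.WminusV t * ρ.comp (C P.q * X) * s - P.WplusV t * r.comp (C P.q * X) * σ -
    R * r.comp (C P.q * X) * s, fun x hx hqx => ?_, ?_⟩
  · rw [h _ hqx, h' _ hx]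
    simp only [eval_sub, eval_mul, eval_comp, eval_C, eval_X]
    linear_combination r.eval (P.q * x) * s.eval x * hR x hx hqx
  · simp [hR0, eval_WplusV, eval_WminusV]
    ring

theorem eventually_awaySupport_q_mul (hP : P.Standing t) :
    ∀ᶠ x in Bornology.cobounded ℂ, P.AwaySupport t (P.q * x) :=
  (tendsto_const_mul_cobounded hP.q_ne_zero).eventually (eventually_awaySupport hP)

/-! ### Leading behaviour of the entries -/

theorem leadAt_WplusV (P : LaxParams) (t : ℂ) :
    LeadAt (fun x => (P.WplusV t).eval x) 3 (-(P.b₆ ^ 2 * P.b₁ * P.b₄)) := by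
  have h := (((leadAt_sub_mul 1 P.b₁).mul (leadAt_sub_mul 1 P.b₄) (m := 2) (by norm_num) rfl).mul
    (leadAt_sub_mul t P.b₆) (m := 3) (by norm_num) rfl).const_mul P.b₆
  rw [show P.b₆ * (-P.b₁ * -P.b₄ * -P.b₆) = -(P.b₆ ^ 2 * P.b₁ * P.b₄) by ring] at h
  refine h.congr (Eventually.of_forall fun x => ?_)
  rw [eval_WplusV]; ring

theorem leadAt_WminusV (P : LaxParams) (t : ℂ) :
    LeadAt (fun x => (P.WminusV t).eval x) 3 (-(P.b₂ * P.b₃)) := by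
  refine (((leadAt_sub_mul 1 P.b₂).mul (leadAt_sub_mul 1 P.b₃) (m := 2) (by norm_num) rfl).mul
    (leadAt_sub_mul (P.b₆ * t) 1) (m := 3) (by norm_num) (by ring)).congr
    (Eventually.of_forall fun x => ?_)
  rw [eval_WminusV]; ring

theorem leadAt_poly (hp : P.IsOPS t p) (n : ℕ) :
    LeadAt (fun x => (p n).eval x) n (p n).leadingCoeff := by
  rw [← hp.coeff_self]
  exact leadAt_eval (hp.1 n).le

theorem leadAt_assoc (hP : P.Standing t) (hp : P.IsOPS t p) (n : ℕ) :
    LeadAt (P.assoc t p n) (-(n + 1)) (p n).leadingCoeff⁻¹ := by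
  rw [← hp.moment_X_pow_mul_self hP]
  refine leadAt_stieltjes hP fun j hj => hp.moment_mul_of_degree_lt hP n le_rfl _ ?_
  rw [degree_X_pow]
  exact_mod_cast hj

theorem exists_leadAt_prevPoly (hp : P.IsOPS t p) (n : ℕ) :
    ∃ c, LeadAt (fun x => (prevPoly p n).eval x) (n - 1) c := by
  cases n with
  | zero => exact ⟨0, by simp [LeadAt, prevPoly]⟩
  | succ n => exact ⟨_, by simpa [prevPoly] using leadAt_poly hp n⟩

/-- For n ≥ 1 one has a_n γ_n = γ_{n-1}; the convention q_{-1} = 1/(a_0 γ_0) makes n = 0 fit the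
same formula. -/
theorem leadAt_assocPrev (hP : P.Standing t) (hp : P.IsOPS t p) (n : ℕ) :
    LeadAt (P.assocPrev t p n) (-n) (P.a p n * (p n).leadingCoeff)⁻¹ := by
  cases n with
  | zero => exact leadAt_const (P.a₀ * (p 0).leadingCoeff)⁻¹
  | succ n =>
    have h := leadAt_assoc hP hp n
    rw [a, div_mul_cancel₀ _ (hp.leadingCoeff_ne_zero _)]
    exact_mod_cast h

/-- The Casoratian of `p_n` and `q_n`. -/
theorem casoratian_eq (hP : P.Standing t) (hp : P.IsOPS t p) {n : ℕ} {ρ σ : ℂ[X]}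
    (h : P.SecondKind t (p n) (P.assoc t p n) ρ)
    (h' : P.SecondKind t (prevPoly p n) (P.assocPrev t p n) σ) :
    ρ * prevPoly p n - p n * σ = C (P.a p n)⁻¹ := by
  obtain ⟨c, hc⟩ := exists_leadAt_prevPoly hp n
  have ha := a_ne_zero hP hp n
  have hγ := hp.leadingCoeff_ne_zero n
  have h1 := ((leadAt_poly hp n).mul (leadAt_assocPrev hP hp n) (m := (0 : ℕ)) (e := (P.a p n)⁻¹)
    (by simp) (by field_simp)).sub
    (((leadAt_assoc hP hp n).mul hc (m := -2) (by ring) rfl).of_lt (m := (0 : ℕ)) (by norm_num))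
  rw [sub_zero] at h1
  obtain ⟨h2, h3⟩ := (h1.congr ((eventually_awaySupport hP).mono fun x hx =>
    (h.eval_bracket h' hx).symm)).natDegree_le_and_coeff
  rw [eq_C_of_natDegree_le_zero h2, h3]

theorem casoratian (hP : P.Standing t) (hp : P.IsOPS t p) (n : ℕ) {x : ℂ}
    (hx : P.AwaySupport t x) :
    P.a p n * ((p n).eval x * P.assocPrev t p n x - P.assoc t p n x * (prevPoly p n).eval x) = 1 := by
  obtain ⟨ρ, h⟩ := exists_secondKind_assoc hP p n
  obtain ⟨σ, h'⟩ := exists_secondKind_assocPrev hP p n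
  rw [← h.eval_bracket h' hx, casoratian_eq hP hp h h', eval_C,
    mul_inv_cancel₀ (a_ne_zero hP hp n)]

/-! ### The polynomial spectral matrix -/

theorem b₅_ne_zero (hP : P.Standing t) (n : ℕ) : P.b₅ n ≠ 0 :=
  mul_ne_zero (mul_ne_zero (mul_ne_zero (pow_ne_zero _ hP.q_ne_zero) hP.b₁_ne_zero) hP.b₄_ne_zero)
    hP.b₆_ne_zero

/-- Through b₁b₂b₃b₄ = 1, the contributions of W - Δy V at infinity are expressed by b₅, like those
of W + Δy V. -/
theorem b₂_mul_b₃_mul (hP : P.Standing t) (n : ℕ) :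
    P.b₂ * P.b₃ * (P.q ^ n)⁻¹ = P.b₆ / P.b₅ n := by
  have := b₅_ne_zero hP n
  have := pow_ne_zero n hP.q_ne_zero
  rw [eq_div_iff ‹_›, b₅]
  field_simp
  linear_combination P.b₆ * hP.prod_b

/-- Both products grow like x^{3 + n - (n+1)} = x². At 0 the bracket of the pair (p_n, q_n) with
itself vanishes, hence the zero constant term. -/
theorem exists_tau (hP : P.Standing t) (hp : P.IsOPS t p) (n : ℕ) :
    ∃ T : ℂ[X], (∀ x, P.AwaySupport t x → P.AwaySupport t (P.q * x) →
      T.eval x = (P.WplusV t).eval x * (p n).eval (P.q * x) * P.assoc t p n x -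
        (P.WminusV t).eval x * P.assoc t p n (P.q * x) * (p n).eval x) ∧
      T.natDegree ≤ 2 ∧ T.coeff 0 = 0 ∧ T.coeff 2 = P.b₆ / P.b₅ n * (P.q⁻¹ - P.b₅ n ^ 2) := by
  obtain ⟨ρ, h⟩ := exists_secondKind_assoc hP p n
  obtain ⟨T, hT, hT0⟩ := h.exists_shift_bracket hP h
  refine ⟨T, hT, ?_⟩
  have hγ := hp.leadingCoeff_ne_zero n
  have hq := hP.q_ne_zero
  have h1 := (((leadAt_WplusV P t).mul ((leadAt_poly hp n).comp_mul hq) rfl rfl).mul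
    (leadAt_assoc hP hp n) (m := (2 : ℕ)) (by push_cast; ring) rfl).sub
    (((leadAt_WminusV P t).mul ((leadAt_assoc hP hp n).comp_mul hq) rfl rfl).mul (leadAt_poly hp n)
    (m := (2 : ℕ)) (by push_cast; ring) rfl)
  obtain ⟨h2, h3⟩ := (h1.congr (((eventually_awaySupport hP).and
    (eventually_awaySupport_q_mul hP)).mono fun x hx => (hT x hx.1 hx.2).symm)).natDegree_le_and_coeff
  refine ⟨h2, by rw [coeff_zero_eq_eval_zero, hT0]; simp [mul_comm], h3.trans ?_⟩
  have h4 := b₂_mul_b₃_mul hP n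
  have e : P.q ^ (-((n : ℤ) + 1)) = (P.q ^ n)⁻¹ * P.q⁻¹ := by
    rw [zpow_neg, zpow_add_one₀ hq, mul_inv, zpow_natCast]
  have h5 : P.b₆ / P.b₅ n * P.b₅ n ^ 2 = P.b₆ ^ 2 * P.b₁ * P.b₄ * P.q ^ n := by
    have := b₅_ne_zero hP n
    field_simp
    rw [b₅]
    ring
  rw [e, zpow_natCast, mul_sub, h5, ← h4]
  field_simp
  ring

/-- The product with p_{n-1} is only of order x, so the cubic coefficient comes from the other
product alone. The constant term is b₆t times the normalised Casoratian. The same reasoning, with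
the roles of the two rows exchanged, gives the other diagonal entry below. -/
theorem exists_frakWplus (hP : P.Standing t) (hp : P.IsOPS t p) (n : ℕ) :
    ∃ T : ℂ[X], (∀ x, P.AwaySupport t x → P.AwaySupport t (P.q * x) →
      T.eval x = P.a p n * ((P.WplusV t).eval x * (p n).eval (P.q * x) * P.assocPrev t p n x -
        (P.WminusV t).eval x * P.assoc t p n (P.q * x) * (prevPoly p n).eval x)) ∧
      T.natDegree ≤ 3 ∧ T.coeff 0 = P.b₆ * t ∧ T.coeff 3 = -(P.b₅ n * P.b₆) := by
  obtain ⟨ρ, h⟩ := exists_secondKind_assoc hP p n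
  obtain ⟨σ, h'⟩ := exists_secondKind_assocPrev hP p n
  obtain ⟨T, hT, hT0⟩ := h.exists_shift_bracket hP h'
  have hT' : ∀ x, P.AwaySupport t x → P.AwaySupport t (P.q * x) →
      (C (P.a p n) * T).eval x = _ := fun x hx hqx => by rw [eval_C_mul, hT x hx hqx]
  refine ⟨C (P.a p n) * T, hT', ?_⟩
  obtain ⟨c, hc⟩ := exists_leadAt_prevPoly hp n
  have ha := a_ne_zero hP hp n
  have hγ := hp.leadingCoeff_ne_zero n
  have hq := hP.q_ne_zero
  have h1 := ((((leadAt_WplusV P t).mul ((leadAt_poly hp n).comp_mul hq) rfl rfl).mul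
    (leadAt_assocPrev hP hp n) (m := (3 : ℕ)) (by push_cast; ring) rfl).sub
    ((((leadAt_WminusV P t).mul ((leadAt_assoc hP hp n).comp_mul hq) rfl rfl).mul hc
    (m := 1) (by ring) rfl).of_lt (m := (3 : ℕ)) (by norm_num))).const_mul (P.a p n)
  obtain ⟨h2, h3⟩ := (h1.congr (((eventually_awaySupport hP).and
    (eventually_awaySupport_q_mul hP)).mono fun x hx => (hT' x hx.1 hx.2).symm)).natDegree_le_and_coeff
  refine ⟨h2, ?_, h3.trans ?_⟩
  · rw [coeff_zero_eq_eval_zero, eval_C_mul, hT0, casoratian_eq hP hp h h', eval_C]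
    field_simp
  · rw [zpow_natCast, b₅]
    field_simp
    ring

theorem exists_frakWminus (hP : P.Standing t) (hp : P.IsOPS t p) (n : ℕ) :
    ∃ T : ℂ[X], (∀ x, P.AwaySupport t x → P.AwaySupport t (P.q * x) →
      T.eval x = P.a p n * ((P.WminusV t).eval x * P.assocPrev t p n (P.q * x) * (p n).eval x -
        (P.WplusV t).eval x * (prevPoly p n).eval (P.q * x) * P.assoc t p n x)) ∧
      T.natDegree ≤ 3 ∧ T.coeff 0 = P.b₆ * t ∧ T.coeff 3 = -(P.b₆ / P.b₅ n) := by
  obtain ⟨ρ, h⟩ := exists_secondKind_assoc hP p n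
  obtain ⟨σ, h'⟩ := exists_secondKind_assocPrev hP p n
  obtain ⟨T, hT, hT0⟩ := h'.exists_shift_bracket hP h
  have hT' : ∀ x, P.AwaySupport t x → P.AwaySupport t (P.q * x) →
      (C (-P.a p n) * T).eval x = P.a p n * ((P.WminusV t).eval x *
        P.assocPrev t p n (P.q * x) * (p n).eval x -
        (P.WplusV t).eval x * (prevPoly p n).eval (P.q * x) * P.assoc t p n x) := fun x hx hqx => by
    rw [eval_C_mul, hT x hx hqx]; ring
  refine ⟨C (-P.a p n) * T, hT', ?_⟩
  obtain ⟨c, hc⟩ := exists_leadAt_prevPoly hp n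
  have ha := a_ne_zero hP hp n
  have hγ := hp.leadingCoeff_ne_zero n
  have hq := hP.q_ne_zero
  have h1 := ((((leadAt_WminusV P t).mul ((leadAt_assocPrev hP hp n).comp_mul hq) rfl rfl).mul
    (leadAt_poly hp n) (m := (3 : ℕ)) (by push_cast; ring) rfl).sub
    ((((leadAt_WplusV P t).mul (hc.comp_mul hq) rfl rfl).mul (leadAt_assoc hP hp n)
    (m := 1) (by ring) rfl).of_lt (m := (3 : ℕ)) (by norm_num))).const_mul (P.a p n)
  obtain ⟨h2, h3⟩ := (h1.congr (((eventually_awaySupport hP).and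
    (eventually_awaySupport_q_mul hP)).mono fun x hx => (hT' x hx.1 hx.2).symm)).natDegree_le_and_coeff
  refine ⟨h2, ?_, h3.trans ?_⟩
  · have e : σ * p n - prevPoly p n * ρ = -(ρ * prevPoly p n - p n * σ) := by ring
    rw [coeff_zero_eq_eval_zero, eval_C_mul, hT0, e, casoratian_eq hP hp h h', eval_neg, eval_C]
    field_simp
  · rw [← b₂_mul_b₃_mul hP n, zpow_neg, zpow_natCast]
    field_simp
    ring

/-- `τ`, `A`, `B` are the polynomials for which
`(W + Δy V) Y_n(q x) Y_n(x)⁻¹ = (A_n, -a_n τ_n; a_n τ_{n-1}, B_n)`. -/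
structure SpectralPolys (P : LaxParams) (t : ℂ) (p τ A B : ℕ → ℂ[X]) : Prop where
  tau_eval : ∀ n x, P.AwaySupport t x → P.AwaySupport t (P.q * x) →
    (τ n).eval x = (P.WplusV t).eval x * (p n).eval (P.q * x) * P.assoc t p n x -
      (P.WminusV t).eval x * P.assoc t p n (P.q * x) * (p n).eval x
  tau_natDegree : ∀ n, (τ n).natDegree ≤ 2
  tau_coeff_zero : ∀ n, (τ n).coeff 0 = 0
  tau_coeff_two : ∀ n, (τ n).coeff 2 = P.b₆ / P.b₅ n * (P.q⁻¹ - P.b₅ n ^ 2)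
  A_eval : ∀ n x, P.AwaySupport t x → P.AwaySupport t (P.q * x) →
    (A n).eval x = P.a p n * ((P.WplusV t).eval x * (p n).eval (P.q * x) * P.assocPrev t p n x -
      (P.WminusV t).eval x * P.assoc t p n (P.q * x) * (prevPoly p n).eval x)
  A_natDegree : ∀ n, (A n).natDegree ≤ 3
  A_coeff_zero : ∀ n, (A n).coeff 0 = P.b₆ * t
  A_coeff_three : ∀ n, (A n).coeff 3 = -(P.b₅ n * P.b₆)
  B_eval : ∀ n x, P.AwaySupport t x → P.AwaySupport t (P.q * x) →
    (B n).eval x = P.a p n * ((P.WminusV t).eval x * P.assocPrev t p n (P.q * x) * (p n).eval x -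
      (P.WplusV t).eval x * (prevPoly p n).eval (P.q * x) * P.assoc t p n x)
  B_natDegree : ∀ n, (B n).natDegree ≤ 3
  B_coeff_zero : ∀ n, (B n).coeff 0 = P.b₆ * t
  B_coeff_three : ∀ n, (B n).coeff 3 = -(P.b₆ / P.b₅ n)

theorem exists_spectralPolys (hP : P.Standing t) (hp : P.IsOPS t p) :
    ∃ τ A B, P.SpectralPolys t p τ A B := by
  choose τ h1 h2 h3 h4 using exists_tau hP hp
  choose A h5 h6 h7 h8 using exists_frakWplus hP hp
  choose B h9 h10 h11 h12 using exists_frakWminus hP hp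
  exact ⟨τ, A, B, h1, h2, h3, h4, h5, h6, h7, h8, h9, h10, h11, h12⟩

namespace SpectralPolys

variable {τ A B : ℕ → ℂ[X]}

theorem prevPoly_tau_eval (h : P.SpectralPolys t p τ A B) (n : ℕ) {x : ℂ}
    (hx : P.AwaySupport t x) (hqx : P.AwaySupport t (P.q * x)) :
    (prevPoly τ n).eval x = (P.WplusV t).eval x * (prevPoly p n).eval (P.q * x) *
      P.assocPrev t p n x -
      (P.WminusV t).eval x * P.assocPrev t p n (P.q * x) * (prevPoly p n).eval x := by
  cases n with
  | zero => simp [prevPoly]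
  | succ n => exact h.tau_eval n x hx hqx

/-- The determinant of the polynomial spectral matrix. -/
theorem det (hP : P.Standing t) (hp : P.IsOPS t p) (h : P.SpectralPolys t p τ A B) (n : ℕ) :
    A n * B n + C (P.a p n ^ 2) * τ n * prevPoly τ n = P.WplusV t * P.WminusV t := by
  refine eq_of_eventually_cobounded ?_
  filter_upwards [eventually_awaySupport hP, eventually_awaySupport_q_mul hP] with x hx hqx
  simp only [eval_add, eval_mul, eval_C]
  rw [h.A_eval n x hx hqx, h.B_eval n x hx hqx, h.tau_eval n x hx hqx,
    h.prevPoly_tau_eval n hx hqx]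
  -- Multiplicativity of the 2 × 2 determinant: the Casoratian has the same value 1/a_n at x and at
  -- qx.
  have c1 := casoratian hP hp n hx
  have c2 := casoratian hP hp n hqx
  linear_combination (P.WplusV t).eval x * (P.WminusV t).eval x * (P.a p n * ((p n).eval x *
    P.assocPrev t p n x - P.assoc t p n x * (prevPoly p n).eval x) * c2 + c1)

end SpectralPolys

end LaxParams

/-- If Y(qx) = R Y(x), then the mean is ½(R + 1)Y and S = 2δ⁻¹(R - 1)(R + 1)⁻¹, whose Cayley
transform is R. The second clause identifies S with an explicit matrix from an equation that
contains no inverse of R + 1. -/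
theorem cayley_eq_of_mean {δ : ℂ} (hδ : δ ≠ 0) {R Y M S : Matrix (Fin 2) (Fin 2) ℂ}
    (hM : M = (2 : ℂ)⁻¹ • (R * Y + Y)) (hu : IsUnit M.det)
    (hS : S = δ⁻¹ • (R * Y - Y) * M⁻¹) :
    cayley δ S = R ∧ ∀ T, T * ((2 : ℂ)⁻¹ • (R + 1)) = δ⁻¹ • (R - 1) → S = T := by
  set Q := (2 : ℂ)⁻¹ • (R + 1) with hQ
  have hMQ : M = Q * Y := by rw [hM, hQ, Matrix.smul_mul, Matrix.add_mul, Matrix.one_mul]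
  rw [hMQ, Matrix.det_mul, IsUnit.mul_iff] at hu
  obtain ⟨hQu, hYu⟩ := hu
  have hSQ : S = δ⁻¹ • (R - 1) * Q⁻¹ := by
    rw [hS, hMQ, Matrix.mul_inv_rev, show R * Y - Y = (R - 1) * Y by
      rw [Matrix.sub_mul, Matrix.one_mul], ← Matrix.mul_assoc, ← Matrix.smul_mul,
      Matrix.mul_nonsing_inv_cancel_right _ _ hYu]
  refine ⟨?_, fun T hT => by rw [hSQ, ← hT, Matrix.mul_nonsing_inv_cancel_right _ _ hQu]⟩
  have h1 : (δ / 2) • S = (2 : ℂ)⁻¹ • ((R - 1) * Q⁻¹) := by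
    rw [hSQ, Matrix.smul_mul, smul_smul]
    congr 1
    field_simp
  have hc : Q * R = R * Q := by
    rw [hQ, Matrix.smul_mul, Matrix.mul_smul, Matrix.add_mul, Matrix.mul_add, Matrix.one_mul,
      Matrix.mul_one]
  have hminus : (1 : Matrix (Fin 2) (Fin 2) ℂ) - (δ / 2) • S = Q⁻¹ := by
    rw [h1]
    nth_rw 1 [← Matrix.mul_nonsing_inv Q hQu]
    rw [← Matrix.smul_mul, ← Matrix.sub_mul, hQ, ← smul_sub,
      ← hQ]
    rw [show R + 1 - (R - 1) = (2 : ℂ) • (1 : Matrix (Fin 2) (Fin 2) ℂ) by rw [two_smul]; abel,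
      smul_smul, inv_mul_cancel₀ two_ne_zero, one_smul, Matrix.one_mul]
  have hplus : (1 : Matrix (Fin 2) (Fin 2) ℂ) + (δ / 2) • S = R * Q⁻¹ := by
    rw [h1]
    nth_rw 1 [← Matrix.mul_nonsing_inv Q hQu]
    rw [← Matrix.smul_mul, ← Matrix.add_mul, hQ, ← smul_add,
      ← hQ]
    rw [show R + 1 + (R - 1) = (2 : ℂ) • R by rw [two_smul]; abel,
      smul_smul, inv_mul_cancel₀ two_ne_zero, one_smul]
  rw [cayley, hminus, hplus, Matrix.nonsing_inv_nonsing_inv _ hQu, ← Matrix.mul_assoc, hc,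
    Matrix.mul_nonsing_inv_cancel_right _ _ hQu]

/-! ### Existence and uniqueness of the spectral coefficients. -/

namespace LaxParams

variable {P : LaxParams} {t : ℂ} {p : ℕ → ℂ[X]}

theorem ΔyPoly_ne_zero (hP : P.Standing t) : P.ΔyPoly ≠ 0 :=
  mul_ne_zero (C_ne_zero.2 (sub_ne_zero.2 hP.q_ne_one)) X_ne_zero

/-- Exact division by kΔy; k = 2 serves V and Ω_n + V, k = 1 serves Θ_n. -/
theorem ΔyPoly_mul_C_mul_divX (hP : P.Standing t) (k : ℂ) {r : ℂ[X]} (hr : r.coeff 0 = 0) :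
    P.ΔyPoly * (C (k * (P.q - 1))⁻¹ * r.divX) = C k⁻¹ * r := by
  have h := divX_mul_X_add r
  rw [hr, C_0, add_zero] at h
  have hq := sub_ne_zero.2 hP.q_ne_one
  have hC : C (P.q - 1) * C (k * (P.q - 1))⁻¹ = (C k⁻¹ : ℂ[X]) := by
    rw [← C_mul, mul_inv, mul_comm k⁻¹, mul_inv_cancel_left₀ hq]
  rw [ΔyPoly]
  calc C (P.q - 1) * X * (C (k * (P.q - 1))⁻¹ * r.divX)
      = (C (P.q - 1) * C (k * (P.q - 1))⁻¹) * (r.divX * X) := by ring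
    _ = _ := by rw [hC, h]

theorem ΔyPoly_mul_V (hP : P.Standing t) :
    P.ΔyPoly * P.V t = C (2 : ℂ)⁻¹ * (P.WplusV t - P.WminusV t) := by
  refine ΔyPoly_mul_C_mul_divX hP 2 ?_
  rw [coeff_zero_eq_eval_zero, eval_sub, eval_WplusV, eval_WminusV]
  ring

theorem eval_ΔyPoly (P : LaxParams) (x : ℂ) : P.ΔyPoly.eval x = P.Δy x := by simp [ΔyPoly, Δy]

theorem Δy_mul_eval_V (hP : P.Standing t) (x : ℂ) :
    P.Δy x * (P.V t).eval x = 2⁻¹ * ((P.WplusV t).eval x - (P.WminusV t).eval x) := by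
  have := congrArg (eval x) (ΔyPoly_mul_V hP)
  simpa [eval_ΔyPoly] using this

theorem eval_W (P : LaxParams) (t x : ℂ) :
    (P.W t).eval x = 2⁻¹ * ((P.WplusV t).eval x + (P.WminusV t).eval x) := by simp [W]

/-- The spectral coefficients belonging to the entries of the polynomial spectral matrix. -/
noncomputable def coeffsOf (P : LaxParams) (t : ℂ) (τ A B : ℕ → ℂ[X]) : SpectralCoeffs where
  W n := C (4 : ℂ)⁻¹ * (A n + B n + 2 * P.W t)
  Ω n := C (2 * (P.q - 1))⁻¹ * (A n - B n).divX - P.V t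
  Θ n := C (1 * (P.q - 1))⁻¹ * (τ n).divX

namespace SpectralPolys

variable {τ A B : ℕ → ℂ[X]}

theorem ΔyPoly_mul_Ω_add (hP : P.Standing t) (h : P.SpectralPolys t p τ A B) (n : ℕ) :
    P.ΔyPoly * ((P.coeffsOf t τ A B).Ω n + P.V t) = C (2 : ℂ)⁻¹ * (A n - B n) := by
  rw [coeffsOf, sub_add_cancel]
  exact ΔyPoly_mul_C_mul_divX hP 2 (by rw [coeff_sub, h.A_coeff_zero, h.B_coeff_zero, sub_self])

theorem two_mul_W_sub (P : LaxParams) (t : ℂ) (τ A B : ℕ → ℂ[X]) (n : ℕ) :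
    2 * (P.coeffsOf t τ A B).W n - P.W t = C (2 : ℂ)⁻¹ * (A n + B n) := by
  rw [coeffsOf, show (2 : ℂ[X]) = C 2 from rfl, ← mul_assoc, ← C_mul, mul_add, ← mul_assoc, ← C_mul]
  norm_num

theorem frakWplus_eq (hP : P.Standing t) (h : P.SpectralPolys t p τ A B) (n : ℕ) :
    P.frakWplus t (P.coeffsOf t τ A B) n = A n := by
  rw [frakWplus, two_mul_W_sub, h.ΔyPoly_mul_Ω_add hP, ← mul_add,
    show A n + B n + (A n - B n) = C 2 * A n by rw [show (C 2 : ℂ[X]) = 2 from rfl]; ring,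
    ← mul_assoc, ← C_mul]
  norm_num

theorem frakWminus_eq (hP : P.Standing t) (h : P.SpectralPolys t p τ A B) (n : ℕ) :
    P.frakWminus t (P.coeffsOf t τ A B) n = B n := by
  rw [frakWminus, two_mul_W_sub, h.ΔyPoly_mul_Ω_add hP, ← mul_sub,
    show A n + B n - (A n - B n) = C 2 * B n by rw [show (C 2 : ℂ[X]) = 2 from rfl]; ring,
    ← mul_assoc, ← C_mul]
  norm_num

theorem ΔyPoly_mul_Θ (hP : P.Standing t) (h : P.SpectralPolys t p τ A B) (n : ℕ) :
    P.ΔyPoly * (P.coeffsOf t τ A B).Θ n = τ n := by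
  have := ΔyPoly_mul_C_mul_divX hP 1 (h.tau_coeff_zero n)
  rw [inv_one, C_1] at this
  exact this.trans (one_mul _)

theorem frakTplus_eq (hP : P.Standing t) (h : P.SpectralPolys t p τ A B) (n : ℕ) :
    P.frakTplus p (P.coeffsOf t τ A B) n = C (P.a p n) * τ n := by
  rw [frakTplus, ← h.ΔyPoly_mul_Θ hP]
  ring

theorem frakTminus_eq (hP : P.Standing t) (h : P.SpectralPolys t p τ A B) (n : ℕ) :
    P.frakTminus p (P.coeffsOf t τ A B) n = C (P.a p n) * prevPoly τ n := by
  cases n with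
  | zero => simp [frakTminus, SpectralCoeffs.Θprev, prevPoly]
  | succ n =>
    rw [frakTminus, prevPoly, SpectralCoeffs.Θprev, ← h.ΔyPoly_mul_Θ hP]
    ring

/-- The value of the polynomial spectral matrix. -/
noncomputable def mat (P : LaxParams) (p τ A B : ℕ → ℂ[X]) (n : ℕ) (x : ℂ) :
    Matrix (Fin 2) (Fin 2) ℂ :=
  !![(A n).eval x, -(P.a p n * (τ n).eval x);
     P.a p n * (prevPoly τ n).eval x, (B n).eval x]

/-- The brackets in the entries of `mat` are those of Y_n(qx) times the adjugate of Y_n(x), and the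
Casoratian supplies the determinant of Y_n(x). -/
theorem Y_q_mul (hP : P.Standing t) (hp : P.IsOPS t p) (h : P.SpectralPolys t p τ A B) (n : ℕ)
    {x : ℂ} (hx : P.OffLattice t x) :
    P.Y t p n (P.q * x) = ((P.WplusV t).eval x)⁻¹ • mat P p τ A B n x * P.Y t p n x := by
  have hx1 := hx.awaySupport hP
  have hx2 := (hx.mul_q hP).awaySupport hP
  have hU := eval_WplusV_ne_zero hP hx.ne
  have hw := weight_ne_zero hP hx
  have hw' := weight_ne_zero hP (hx.mul_q hP)
  have hpe := pearson hP hx.ne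
  have c := casoratian hP hp n hx1
  have hA := h.A_eval n x hx1 hx2
  have hB := h.B_eval n x hx1 hx2
  have hτ := h.tau_eval n x hx1 hx2
  have hτ' := h.prevPoly_tau_eval n hx1 hx2
  -- The Pearson equation replaces the weight at qx in the second column by the weight at x.
  have hDU : ∀ z, z / P.weight t (P.q * x) =
      (P.WminusV t).eval x * z / P.weight t x / (P.WplusV t).eval x := fun z => by
    field_simp
    linear_combination -z * hpe
  rw [Y_eq, Y_eq, Matrix.smul_mul, mat, Matrix.mul_fin_two, hDU, hDU]
  ext i j
  fin_cases i <;> fin_cases j <;>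
    simp only [Fin.zero_eta, Fin.mk_one, Fin.isValue, Matrix.smul_apply, Matrix.of_apply,
      Matrix.cons_val_zero, Matrix.cons_val_one, Matrix.cons_val', Matrix.cons_val_fin_one,
      smul_eq_mul]
  · rw [eq_inv_mul_iff_mul_eq₀ hU, hA, hτ]
    linear_combination -(P.WplusV t).eval x * (p n).eval (P.q * x) * c
  · rw [div_eq_inv_mul]
    congr 1
    rw [← mul_div_assoc, ← mul_div_assoc, ← add_div, hA, hτ]
    congr 1
    linear_combination -(P.WminusV t).eval x * P.assoc t p n (P.q * x) * c
  · rw [eq_inv_mul_iff_mul_eq₀ hU, hB, hτ']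
    linear_combination -(P.WplusV t).eval x * (prevPoly p n).eval (P.q * x) * c
  · rw [div_eq_inv_mul]
    congr 1
    rw [← mul_div_assoc, ← mul_div_assoc, ← add_div, hB, hτ']
    congr 1
    linear_combination -(P.WminusV t).eval x * P.assocPrev t p n (P.q * x) * c

theorem det_Y_ne_zero (hP : P.Standing t) (hp : P.IsOPS t p) (n : ℕ) {x : ℂ}
    (hx : P.OffLattice t x) : (P.Y t p n x).det ≠ 0 := by
  have c := casoratian hP hp n (hx.awaySupport hP)
  have hw := weight_ne_zero hP hx
  intro h0
  rw [Y_eq, Matrix.det_fin_two_of] at h0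
  field_simp at h0
  simp [h0] at c

/-- For a 2 × 2 matrix, det ½(R + 1) = ¼(det R + tr R + 1), and here det R = (W - Δy V)/(W + Δy V).
This is why W_n is ¼(A_n + B_n + 2W), and why it is the denominator of the spectral matrix. -/
theorem det_smul_mat_add_one (hP : P.Standing t) (hp : P.IsOPS t p)
    (h : P.SpectralPolys t p τ A B) (n : ℕ) {x : ℂ} (hx : P.OffLattice t x) :
    ((2 : ℂ)⁻¹ • (((P.WplusV t).eval x)⁻¹ • mat P p τ A B n x + 1)).det =
      ((P.coeffsOf t τ A B).W n).eval x / (P.WplusV t).eval x := by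
  have hU := eval_WplusV_ne_zero hP hx.ne
  have hd := congrArg (eval x) (h.det hP hp n)
  simp only [eval_add, eval_mul, eval_C] at hd
  simp only [Matrix.det_fin_two, mat, Matrix.smul_apply, Matrix.add_apply, Matrix.of_apply,
    Matrix.cons_val_zero, Matrix.cons_val_one, Matrix.cons_val', Matrix.cons_val_fin_one,
    smul_eq_mul, Matrix.one_apply_eq, Fin.isValue, coeffsOf, eval_mul, eval_add, eval_C, eval_W,
    eval_ofNat, Matrix.one_apply_ne (show (0 : Fin 2) ≠ 1 by decide),
    Matrix.one_apply_ne (show (1 : Fin 2) ≠ 0 by decide)]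
  field_simp
  linear_combination 4 * hd

theorem det_meanOp (hP : P.Standing t) (hp : P.IsOPS t p)
    (h : P.SpectralPolys t p τ A B) (n : ℕ) {x : ℂ} (hx : P.OffLattice t x) :
    (meanOp P.q (P.Y t p n) x).det =
      ((P.coeffsOf t τ A B).W n).eval x / (P.WplusV t).eval x * (P.Y t p n x).det := by
  rw [meanOp, h.Y_q_mul hP hp n hx, ← h.det_smul_mat_add_one hP hp n hx, ← Matrix.det_mul,
    Matrix.smul_mul _ (_ + 1), Matrix.add_mul, Matrix.one_mul]

theorem isSpectral (hP : P.Standing t) (hp : P.IsOPS t p) (h : P.SpectralPolys t p τ A B) :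
    P.IsSpectral t p (P.coeffsOf t τ A B) := by
  rintro n x ⟨hx0, hxl, hxu⟩
  have hx : P.OffLattice t x := ⟨hx0, hxl⟩
  have hδ : P.Δy x ≠ 0 := mul_ne_zero (sub_ne_zero.2 hP.q_ne_one) hx0
  have hU := eval_WplusV_ne_zero hP hx.ne
  have hY := h.Y_q_mul hP hp n hx
  have hW : ((P.coeffsOf t τ A B).W n).eval x ≠ 0 := by
    intro h0
    rw [h.det_meanOp hP hp n hx, h0, zero_div, zero_mul] at hxu
    exact not_isUnit_zero hxu
  obtain ⟨h1, h2⟩ := cayley_eq_of_mean hδ (R := ((P.WplusV t).eval x)⁻¹ • mat P p τ A B n x)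
    (Y := P.Y t p n x) (M := meanOp P.q (P.Y t p n) x) (S := P.spectralMatrix t p n x)
    (by rw [meanOp, hY]) hxu (by
      rw [spectralMatrix, divDiff, hY, show P.q * x - x = P.Δy x by rw [Δy]; ring])
  -- In the first goal, after clearing W_n, the diagonal entries reduce to the determinant identity
  -- `hd`; the off-diagonal ones need only the formula for W_n.
  refine ⟨h2 _ ?_, ?_⟩
  · have hd := congrArg (eval x) (h.det hP hp n)
    have e1 := congrArg (eval x) (h.ΔyPoly_mul_Ω_add hP n)
    have e2 := congrArg (eval x) (h.ΔyPoly_mul_Θ hP n)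
    have e3 : P.Δy x * (((P.coeffsOf t τ A B).Θprev n).eval x) = (prevPoly τ n).eval x := by
      cases n with
      | zero => simp [SpectralCoeffs.Θprev, prevPoly]
      | succ n =>
        rw [SpectralCoeffs.Θprev, prevPoly, ← h.ΔyPoly_mul_Θ hP, eval_mul, eval_ΔyPoly]
    have e4 := congrArg (eval x) (two_mul_W_sub P t τ A B n)
    have e5 := Δy_mul_eval_V hP x
    simp only [eval_add, eval_mul, eval_sub, eval_C, eval_ΔyPoly, eval_W, eval_ofNat]
      at hd e1 e2 e4
    generalize ((P.coeffsOf t τ A B).W n).eval x = Wn at *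
    generalize ((P.coeffsOf t τ A B).Ω n).eval x = Ω at *
    generalize ((P.coeffsOf t τ A B).Θ n).eval x = Θ at *
    generalize ((P.coeffsOf t τ A B).Θprev n).eval x = Θ' at *
    simp only [mat]
    generalize (P.WplusV t).eval x = U at *
    generalize (P.WminusV t).eval x = D at *
    generalize (P.V t).eval x = V at *
    generalize (A n).eval x = α at *
    generalize (B n).eval x = β at *
    generalize P.Δy x = δ at *
    generalize P.a p n = a at *
    rw [← e2, ← e3] at hd ⊢
    have e6 : D = U - 2 * (δ * V) := by linear_combination 2 * e5
    have e7 : β = α - 2 * (δ * (Ω + V)) := by linear_combination 2 * e1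
    subst e6 e7
    have e8 : Wn = (α + U - δ * Ω - 2 * (δ * V)) / 2 := by linear_combination (1 / 2) * e4
    clear h1 h2 hY hxu hxl hx hx0
    ext i j
    fin_cases i <;> fin_cases j <;>
      simp [Matrix.mul_apply, Fin.sum_univ_two] <;> field_simp
    · linear_combination -hd - 2 * (α - U) * e8
    · linear_combination 2 * a * Θ * e8
    · linear_combination -2 * a * Θ' * e8
    · linear_combination -hd - 2 * (α - 2 * (δ * (Ω + V)) - U) * e8
  · rw [h1, mat, h.frakWplus_eq hP, h.frakWminus_eq hP, h.frakTplus_eq hP, h.frakTminus_eq hP]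
    simp

/-- The excluded points are 0, countably many lattice points and the zeros of W_n, which is a
nonzero polynomial since W_n(0) = b₆t. They form a countable set. -/
theorem infinite_isRegularPoint (hP : P.Standing t) (hp : P.IsOPS t p)
    (h : P.SpectralPolys t p τ A B) (n : ℕ) : {x | P.IsRegularPoint t p n x}.Infinite := by
  have hW : (P.coeffsOf t τ A B).W n ≠ 0 := by
    intro h0
    have h1 := congrArg (coeff · 0) (two_mul_W_sub P t τ A B n)
    rw [h0] at h1
    simp only [mul_zero, zero_sub, coeff_neg, coeff_C_mul, coeff_add, h.A_coeff_zero,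
      h.B_coeff_zero] at h1
    rw [coeff_zero_eq_eval_zero, eval_W, eval_WplusV, eval_WminusV] at h1
    have := mul_ne_zero hP.b₆_ne_zero hP.t_ne_zero
    apply this
    linear_combination (-1 / 2) * h1
  intro hfin
  have hc : (Set.univ : Set ℂ) ⊆ {x | P.IsRegularPoint t p n x} ∪ ({0} ∪
      (⋃ i : Fin 6, ⋃ m : ℤ, {P.singularPoints t i * P.q ^ m}) ∪
      {x | ((P.coeffsOf t τ A B).W n).IsRoot x}) := by
    intro x _
    by_contra hx
    simp only [Set.mem_union, Set.mem_ofPred_eq, Set.mem_singleton_iff, Set.mem_iUnion, not_or,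
      not_exists] at hx
    obtain ⟨h1, ⟨h2, h3⟩, h4⟩ := hx
    refine h1 ⟨h2, h3, isUnit_iff_ne_zero.2 ?_⟩
    have hoff : P.OffLattice t x := ⟨h2, h3⟩
    rw [h.det_meanOp hP hp n hoff]
    exact mul_ne_zero (div_ne_zero h4 (eval_WplusV_ne_zero hP hoff.ne)) (det_Y_ne_zero hP hp n hoff)
  refine not_countable_complex (Set.Countable.mono hc (hfin.countable.union (((Set.countable_singleton
    _).union (Set.countable_iUnion fun i => Set.countable_iUnion fun m =>
      Set.countable_singleton _)).union ?_)))
  exact (finite_setOfPred_isRoot hW).countable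

/-- The Cayley clause determines the polynomials 𝔚_{n,±} and 𝔗_{n,+} at infinitely many points. The
sum of the first two gives W_n, their difference Ω_n, and the third Θ_n. The first clause alone
would leave a common factor free. -/
theorem eq_coeffsOf (hP : P.Standing t) (hp : P.IsOPS t p)
    (h : P.SpectralPolys t p τ A B) {σ : SpectralCoeffs} (hσ : P.IsSpectral t p σ) :
    σ = P.coeffsOf t τ A B := by
  have key : ∀ n x, P.IsRegularPoint t p n x →
      (P.frakWplus t σ n).eval x = (P.frakWplus t (P.coeffsOf t τ A B) n).eval x ∧
      (P.frakWminus t σ n).eval x = (P.frakWminus t (P.coeffsOf t τ A B) n).eval x ∧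
      (P.frakTplus p σ n).eval x = (P.frakTplus p (P.coeffsOf t τ A B) n).eval x := by
    intro n x hx
    have h1 := (hσ n x hx).2.symm.trans ((h.isSpectral hP hp) n x hx).2
    have hU := eval_WplusV_ne_zero hP (OffLattice.ne ⟨hx.1, hx.2.1⟩)
    have h2 := smul_right_injective _ (inv_ne_zero hU) h1
    have h00 := congrFun (congrFun h2 0) 0
    have h01 := congrFun (congrFun h2 0) 1
    have h11 := congrFun (congrFun h2 1) 1
    simp at h00 h01 h11
    exact ⟨h00, h11, h01⟩
  have hWp : ∀ n, P.frakWplus t σ n = P.frakWplus t (P.coeffsOf t τ A B) n := fun n =>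
    eq_of_infinite_eval_eq _ _ ((h.infinite_isRegularPoint hP hp n).mono fun x hx => (key n x hx).1)
  have hWm : ∀ n, P.frakWminus t σ n = P.frakWminus t (P.coeffsOf t τ A B) n := fun n =>
    eq_of_infinite_eval_eq _ _ ((h.infinite_isRegularPoint hP hp n).mono fun x hx => (key n x hx).2.1)
  have hT : ∀ n, P.frakTplus p σ n = P.frakTplus p (P.coeffsOf t τ A B) n := fun n =>
    eq_of_infinite_eval_eq _ _ ((h.infinite_isRegularPoint hP hp n).mono fun x hx => (key n x hx).2.2)
  have h4 : (4 : ℂ[X]) ≠ 0 := by norm_num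
  have hΔ := ΔyPoly_ne_zero hP
  have hext : ∀ σ σ' : SpectralCoeffs, σ.W = σ'.W → σ.Ω = σ'.Ω → σ.Θ = σ'.Θ → σ = σ' := by
    rintro ⟨_, _, _⟩ ⟨_, _, _⟩ rfl rfl rfl
    rfl
  refine hext _ _ (funext fun n => ?_) (funext fun n => ?_) (funext fun n => ?_)
  · have e1 := hWp n
    have e2 := hWm n
    simp only [frakWplus, frakWminus] at e1 e2
    exact mul_left_cancel₀ h4 (by linear_combination e1 + e2)
  · have e1 := hWp n
    have e2 := hWm n
    simp only [frakWplus, frakWminus] at e1 e2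
    exact mul_left_cancel₀ (mul_ne_zero two_ne_zero hΔ) (by linear_combination e1 - e2)
  · exact mul_left_cancel₀ (mul_ne_zero hΔ (C_ne_zero.2 (a_ne_zero hP hp n))) (hT n)

theorem existsUnique_isSpectral (hP : P.Standing t) (hp : P.IsOPS t p)
    (h : P.SpectralPolys t p τ A B) : ∃! σ, P.IsSpectral t p σ :=
  ⟨_, h.isSpectral hP hp, fun _ hσ => h.eq_coeffsOf hP hp hσ⟩

theorem spectral_eq (hP : P.Standing t) (hp : P.IsOPS t p)
    (h : P.SpectralPolys t p τ A B) : P.spectral t p = P.coeffsOf t τ A B :=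
  h.eq_coeffsOf hP hp (Classical.epsilon_spec (h.existsUnique_isSpectral hP hp).exists)

end SpectralPolys

end LaxParams

namespace LaxParams

variable {P : LaxParams} {t : ℂ}

/-! ### The deformation `t ↦ q t` -/

theorem pt_shift_zero (P : LaxParams) (t : ℂ) (s : ℕ) : P.pt (P.q * t) 0 s = P.pt t 0 s := by
  by_cases h : ‖P.q‖ < 1 <;> simp [pt, terminal, h]

theorem pt_shift_one (P : LaxParams) (t : ℂ) (s : ℕ) : P.pt (P.q * t) 1 s = P.pt t 1 s := by
  by_cases h : ‖P.q‖ < 1 <;> simp [pt, terminal, h]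

theorem pt_shift_two (P : LaxParams) (t : ℂ) (s : ℕ) : P.pt (P.q * t) 2 s = P.q * P.pt t 2 s := by
  by_cases h : ‖P.q‖ < 1 <;> simp [pt, terminal, h] <;> ring

/-- The first two lattices of the support do not meet those of the moving singular points. -/
theorem pt_ne_moving (hP : P.Standing t) {i : Fin 3} (hi : i ≠ 2) (s : ℕ) {j : Fin 6}
    (hj : j = 4 ∨ j = 5) : P.pt t i s ≠ P.singularPoints t j := by
  have hk : ∃ k : Fin 6, k ≠ 4 ∧ k ≠ 5 ∧ ∃ m : ℤ, P.pt t i s = P.singularPoints t k * P.q ^ m := by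
    by_cases h : ‖P.q‖ < 1
    · have e : P.q ^ ((s : ℤ) + 1) = P.q ^ (s + 1) := by exact_mod_cast rfl
      fin_cases i
      · exact ⟨1, by decide, by decide, (s : ℤ) + 1, by
          rw [e]; simp [pt, base, terminal, h, singularPoints]; ring⟩
      · exact ⟨2, by decide, by decide, (s : ℤ) + 1, by
          rw [e]; simp [pt, base, terminal, h, singularPoints]; ring⟩
      · exact absurd rfl hi
    · fin_cases i
      · exact ⟨0, by decide, by decide, -(s : ℤ), by
          simp [pt, base, terminal, h, singularPoints]⟩
      · exact ⟨3, by decide, by decide, -(s : ℤ), by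
          simp [pt, base, terminal, h, singularPoints]⟩
      · exact absurd rfl hi
  obtain ⟨k, h4, h5, m, hk⟩ := hk
  intro h
  have hne : j ≠ k := by rcases hj with rfl | rfl <;> [exact h4.symm; exact h5.symm]
  exact hP.generic j k hne m (h.symm.trans hk)

/-- The last lattice of the support does not meet those of the fixed singular points. -/
theorem pt_two_ne_fixed (hP : P.Standing t) (s : ℕ) {j : Fin 6} (h4 : j ≠ 4) (h5 : j ≠ 5) :
    P.pt t 2 s ≠ P.singularPoints t j := by
  have hk : ∃ k : Fin 6, (k = 4 ∨ k = 5) ∧ ∃ m : ℤ, P.pt t 2 s = P.singularPoints t k * P.q ^ m := by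
    by_cases h : ‖P.q‖ < 1
    · have e : P.q ^ ((s : ℤ) + 1) = P.q ^ (s + 1) := by exact_mod_cast rfl
      exact ⟨4, Or.inl rfl, (s : ℤ) + 1, by
        rw [e]; simp [pt, base, terminal, h, singularPoints]; ring⟩
    · exact ⟨5, Or.inr rfl, -(s : ℤ), by simp [pt, base, terminal, h, singularPoints]⟩
  obtain ⟨k, hk4, m, hk⟩ := hk
  intro h
  have hne : j ≠ k := by rcases hk4 with rfl | rfl <;> assumption
  exact hP.generic j k hne m (h.symm.trans hk)

/-- Only the two factors containing t change, each by one step of the recursion. -/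
theorem weight_deform (hP : P.Standing t) {x : ℂ} (h4 : x ≠ P.singularPoints (P.q * t) 4)
    (h5 : x ≠ P.singularPoints (P.q * t) 5) :
    P.weight (P.q * t) x * (P.b₆ * (P.q * t - P.b₆ * x)) =
      P.weight t x * (P.b₆ * (P.q * t) - x) := by
  have hb := hP.b₆_ne_zero
  have ht := hP.t_ne_zero
  have hq := hP.q_ne_zero
  have hT := hP.shift.t_ne_zero
  change x ≠ P.b₆ * (P.q * t) at h4
  change x ≠ P.q * t / P.b₆ at h5
  have h4' : x / (P.b₆ * (P.q * t)) ≠ 1 := fun h => h4 ((div_eq_one_iff_eq (mul_ne_zero hb hT)).1 h)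
  have h5' : P.b₆ * x / (P.q * t) ≠ 1 := fun h => h5 (by
    rw [eq_div_iff hb, mul_comm, (div_eq_one_iff_eq hT).1 h])
  rw [weight, weight, qPochInf_eq_mul hq hP.norm_q_ne_one h4',
    qPochInf_eq_mul hq hP.norm_q_ne_one h5',
    show x / (P.b₆ * (P.q * t)) * P.q = x / (P.b₆ * t) by field_simp,
    show P.b₆ * x / (P.q * t) * P.q = P.b₆ * x / t by field_simp,
    show P.b₆ * (P.q * t - P.b₆ * x) = P.b₆ * (P.q * t) * (1 - P.b₆ * x / (P.q * t)) by field_simp,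
    show P.b₆ * (P.q * t) - x = P.b₆ * (P.q * t) * (1 - x / (P.b₆ * (P.q * t))) by field_simp]
  have e5 := sub_ne_zero.2 h5'.symm
  generalize 1 - P.b₆ * x / (P.q * t) = B5 at *
  generalize 1 - x / (P.b₆ * (P.q * t)) = B4 at *
  simp only [div_eq_mul_inv, mul_inv]
  field_simp

/-- The factors containing t depend on x/t alone, so they are unchanged when x and t are both
multiplied by q. -/
theorem weight_shift_deform (hP : P.Standing t) {x : ℂ} (h1 : P.b₁ * x ≠ 1) (h2 : P.b₂ * x ≠ 1)
    (h3 : P.b₃ * x ≠ 1) (h4 : P.b₄ * x ≠ 1) :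
    P.weight (P.q * t) (P.q * x) * ((1 - P.b₂ * x) * (1 - P.b₃ * x)) =
      P.weight t x * ((1 - P.b₁ * x) * (1 - P.b₄ * x)) := by
  have hq := hP.q_ne_zero
  have hr := fun {a : ℂ} => qPochInf_eq_mul hP.q_ne_zero hP.norm_q_ne_one (a := a)
  rw [weight, weight, hr h1, hr h2, hr h3, hr h4,
    show P.b₁ * (P.q * x) = P.b₁ * x * P.q by ring, show P.b₂ * (P.q * x) = P.b₂ * x * P.q by ring,
    show P.b₃ * (P.q * x) = P.b₃ * x * P.q by ring, show P.b₄ * (P.q * x) = P.b₄ * x * P.q by ring,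
    show P.q * x / (P.b₆ * (P.q * t)) = x / (P.b₆ * t) by
      rw [mul_left_comm, mul_div_mul_left _ _ hq],
    show P.b₆ * (P.q * x) / (P.q * t) = P.b₆ * x / t by
      rw [mul_left_comm, mul_div_mul_left _ _ hq]]
  have e1 := sub_ne_zero.2 h1.symm
  have e4 := sub_ne_zero.2 h4.symm
  generalize 1 - P.b₁ * x = B1 at *
  generalize 1 - P.b₄ * x = B4 at *
  simp only [div_eq_mul_inv, mul_inv]
  field_simp

/-- The first two lattices stay in place. The third moves by one lattice step, and the terminal
point gained or lost is a zero of one of the two linear factors. -/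
theorem dIntegral_deform (hP : P.Standing t) (G : ℂ → ℂ) :
    P.dIntegral (P.q * t) (fun y => P.weight (P.q * t) y * (P.b₆ * (P.q * t - P.b₆ * y) * G y)) =
      P.dIntegral t (fun y => P.weight t y * ((P.b₆ * (P.q * t) - y) * G y)) := by
  have hb := hP.b₆_ne_zero
  have key : ∀ y, y ≠ P.singularPoints (P.q * t) 4 → y ≠ P.singularPoints (P.q * t) 5 →
      P.Δy y * (P.weight (P.q * t) y * (P.b₆ * (P.q * t - P.b₆ * y) * G y)) =
      P.Δy y * (P.weight t y * ((P.b₆ * (P.q * t) - y) * G y)) := fun y h4 h5 => by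
    linear_combination P.Δy y * G y * weight_deform hP h4 h5
  simp only [dIntegral_eq, Fin.sum_univ_three]
  refine congrArg₂ _ (congrArg₂ _ (congrArg _ ?_) (congrArg _ ?_)) (congrArg _ ?_)
  · refine tsum_congr fun s => ?_
    rw [key _ (pt_ne_moving hP.shift (by decide) s (Or.inl rfl))
      (pt_ne_moving hP.shift (by decide) s (Or.inr rfl)), pt_shift_zero]
  · refine tsum_congr fun s => ?_
    rw [key _ (pt_ne_moving hP.shift (by decide) s (Or.inl rfl))
      (pt_ne_moving hP.shift (by decide) s (Or.inr rfl)), pt_shift_one]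
  · by_cases h : ‖P.q‖ < 1
    · have h0 : P.b₆ * (P.q * t) - P.pt t 2 0 = 0 := by simp [pt, terminal, h]; ring
      rw [tsum_eq_tsum_succ (f := fun s => P.Δy (P.pt t 2 s) * (P.weight t (P.pt t 2 s) *
        ((P.b₆ * (P.q * t) - P.pt t 2 s) * G (P.pt t 2 s)))) (by simp [h0])]
      refine tsum_congr fun s => ?_
      rw [key _ (pt_ne_of_lt hP.shift h 2 s 4) (pt_ne_of_lt hP.shift h 2 s 5), pt_shift_two,
        pt_succ_of_lt h]
    · have h0 : P.q * t - P.b₆ * P.pt (P.q * t) 2 0 = 0 := by simp [pt, terminal, h]; field_simp; simp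
      rw [tsum_eq_tsum_succ (by simp [h0])]
      refine tsum_congr fun s => ?_
      rw [key _ (pt_succ_ne_of_not hP.shift h 2 s 4) (pt_succ_ne_of_not hP.shift h 2 s 5),
        pt_shift_two, q_mul_pt_succ_of_not hP h]

/-- Under simultaneous scaling of y and t the third lattice is carried onto its new position without
boundary term. On the two fixed lattices the unmatched terminal is a zero of one of the quadratic
factors. -/
theorem dIntegral_shift_deform (hP : P.Standing t) (G : ℂ → ℂ) :
    P.dIntegral (P.q * t) (fun y => P.weight (P.q * t) y *
      ((1 - P.b₂ * (P.q⁻¹ * y)) * (1 - P.b₃ * (P.q⁻¹ * y)) * G y)) =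
      P.q * P.dIntegral t (fun y => P.weight t y *
        ((1 - P.b₁ * y) * (1 - P.b₄ * y) * G (P.q * y))) := by
  have hb₁ := hP.b₁_ne_zero
  have hb₂ := hP.b₂_ne_zero
  have hb₃ := hP.b₃_ne_zero
  have hb₄ := hP.b₄_ne_zero
  have hq := hP.q_ne_zero
  have key : ∀ y, (∀ j : Fin 6, j ≠ 4 → j ≠ 5 → y ≠ P.singularPoints t j) →
      P.Δy (P.q * y) * (P.weight (P.q * t) (P.q * y) * ((1 - P.b₂ * (P.q⁻¹ * (P.q * y))) *
        (1 - P.b₃ * (P.q⁻¹ * (P.q * y))) * G (P.q * y))) =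
      P.q * (P.Δy y * (P.weight t y * ((1 - P.b₁ * y) * (1 - P.b₄ * y) * G (P.q * y)))) := by
    intro y hy
    have h1 : P.b₁ * y ≠ 1 := fun h => hy 0 (by decide) (by decide) (by
      rw [show P.singularPoints t 0 = 1 / P.b₁ from rfl, eq_div_iff hb₁, mul_comm, h])
    have h2 : P.b₂ * y ≠ 1 := fun h => hy 1 (by decide) (by decide) (by
      rw [show P.singularPoints t 1 = 1 / P.b₂ from rfl, eq_div_iff hb₂, mul_comm, h])
    have h3 : P.b₃ * y ≠ 1 := fun h => hy 2 (by decide) (by decide) (by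
      rw [show P.singularPoints t 2 = 1 / P.b₃ from rfl, eq_div_iff hb₃, mul_comm, h])
    have h4 : P.b₄ * y ≠ 1 := fun h => hy 3 (by decide) (by decide) (by
      rw [show P.singularPoints t 3 = 1 / P.b₄ from rfl, eq_div_iff hb₄, mul_comm, h])
    rw [inv_mul_cancel_left₀ hq, Δy, Δy]
    linear_combination (P.q - 1) * P.q * y * G (P.q * y) * weight_shift_deform hP h1 h2 h3 h4
  have fixed : ∀ i : Fin 3, i ≠ 2 → (∀ s, P.pt (P.q * t) i s = P.pt t i s) →
      ∑' s, P.Δy (P.pt (P.q * t) i s) * (P.weight (P.q * t) (P.pt (P.q * t) i s) *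
        ((1 - P.b₂ * (P.q⁻¹ * P.pt (P.q * t) i s)) * (1 - P.b₃ * (P.q⁻¹ * P.pt (P.q * t) i s)) *
          G (P.pt (P.q * t) i s))) =
      ∑' s, P.q * (P.Δy (P.pt t i s) * (P.weight t (P.pt t i s) *
        ((1 - P.b₁ * P.pt t i s) * (1 - P.b₄ * P.pt t i s) * G (P.q * P.pt t i s)))) := by
    intro i hi hs
    simp only [hs]
    by_cases h : ‖P.q‖ < 1
    · have h0 : (1 - P.b₂ * (P.q⁻¹ * P.pt t i 0)) * (1 - P.b₃ * (P.q⁻¹ * P.pt t i 0)) = 0 := by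
        fin_cases i
        · simp [pt, terminal, h]; field_simp; simp
        · simp [pt, terminal, h]; field_simp; simp
        · exact absurd rfl hi
      rw [tsum_eq_tsum_succ (by simp [h0])]
      refine tsum_congr fun s => ?_
      rw [pt_succ_of_lt h]
      exact key _ fun j _ _ => pt_ne_of_lt hP h i s j
    · have h0 : (1 - P.b₁ * P.pt t i 0) * (1 - P.b₄ * P.pt t i 0) = 0 := by
        fin_cases i
        · simp [pt, terminal, h, hb₁]
        · simp [pt, terminal, h, hb₄]
        · exact absurd rfl hi
      rw [tsum_eq_tsum_succ (f := fun s => P.q * (P.Δy (P.pt t i s) * (P.weight t (P.pt t i s) *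
        ((1 - P.b₁ * P.pt t i s) * (1 - P.b₄ * P.pt t i s) * G (P.q * P.pt t i s)))))
        (by simp [h0])]
      refine tsum_congr fun s => ?_
      rw [← q_mul_pt_succ_of_not hP h]
      exact key _ fun j _ _ => pt_succ_ne_of_not hP h i s j
  simp only [dIntegral_eq, Fin.sum_univ_three, mul_add, mul_left_comm P.q]
  simp only [← tsum_mul_left (a := P.q)]
  rw [fixed 0 (by decide) (pt_shift_zero P t), fixed 1 (by decide) (pt_shift_one P t)]
  congr 2
  refine tsum_congr fun s => ?_
  rw [pt_shift_two]
  exact key _ fun j h4 h5 => pt_two_ne_fixed hP s h4 h5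

theorem exists_stieltjes_deform (hP : P.Standing t) :
    ∃ R : ℂ[X], ∀ x, P.AwaySupport t x → P.AwaySupport (P.q * t) x →
      P.b₆ * (P.q * t - P.b₆ * x) * P.stieltjes (P.q * t) 1 x =
        (P.b₆ * (P.q * t) - x) * P.stieltjes t 1 x + R.eval x := by
  obtain ⟨ρ, h1, -⟩ := exists_stieltjes_eq hP.shift (C P.b₆ * (C (P.q * t) - C P.b₆ * X))
  obtain ⟨σ, h2, -⟩ := exists_stieltjes_eq hP (C (P.b₆ * (P.q * t)) - X)
  refine ⟨ρ - σ, fun x hx hx' => ?_⟩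
  have h3 := h1 x hx'
  have h4 := h2 x hx
  have h5 := dIntegral_deform hP fun y => (x - y)⁻¹
  simp only [eval_sub, eval_mul, eval_C, eval_X, stieltjes, mul_div_assoc] at h3 h4 ⊢
  simp only [← div_eq_mul_inv, mul_div_assoc] at h5
  rw [h5, h4] at h3
  linear_combination -h3

theorem exists_stieltjes_shift_deform (hP : P.Standing t) :
    ∃ R : ℂ[X], ∀ x, P.AwaySupport t x → P.AwaySupport (P.q * t) (P.q * x) →
      (1 - P.b₂ * x) * (1 - P.b₃ * x) * P.stieltjes (P.q * t) 1 (P.q * x) =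
        (1 - P.b₁ * x) * (1 - P.b₄ * x) * P.stieltjes t 1 x + R.eval x := by
  have hq := hP.q_ne_zero
  obtain ⟨ρ, h1, -⟩ := exists_stieltjes_eq hP.shift
    ((1 - C P.b₂ * (C P.q⁻¹ * X)) * (1 - C P.b₃ * (C P.q⁻¹ * X)))
  obtain ⟨σ, h2, -⟩ := exists_stieltjes_eq hP ((1 - C P.b₁ * X) * (1 - C P.b₄ * X))
  refine ⟨ρ.comp (C P.q * X) - σ, fun x hx hx' => ?_⟩
  have h3 := h1 _ hx'
  have h4 := h2 x hx
  have h5 := dIntegral_shift_deform hP fun y => (P.q * x - y)⁻¹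
  rw [← dIntegral_const_mul] at h5
  simp only [eval_sub, eval_mul, eval_C, eval_X, eval_one, inv_mul_cancel_left₀ hq] at h3 h4
  have h6 : P.stieltjes (P.q * t)
      ((1 - C P.b₂ * (C P.q⁻¹ * X)) * (1 - C P.b₃ * (C P.q⁻¹ * X))) (P.q * x) =
      P.stieltjes t ((1 - C P.b₁ * X) * (1 - C P.b₄ * X)) x := by
    rw [stieltjes, stieltjes]
    refine (dIntegral_congr fun i s => ?_).trans (h5.trans (dIntegral_congr fun i s => ?_))
    · simp only [eval_sub, eval_mul, eval_C, eval_X, eval_one]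
      ring
    · simp only [eval_sub, eval_mul, eval_C, eval_X, eval_one]
      rw [← mul_sub, mul_inv]
      field_simp
  rw [h6, h4] at h3
  simp only [eval_sub, eval_comp, eval_mul, eval_C, eval_X]
  linear_combination -h3

theorem SecondKind.exists_deform_bracket (hP : P.Standing t) {r s ρ σ : ℂ[X]} {φ ψ : ℂ → ℂ}
    (h : P.SecondKind (P.q * t) r φ ρ) (h' : P.SecondKind t s ψ σ) :
    ∃ T : ℂ[X], ∀ x, P.AwaySupport t x → P.AwaySupport (P.q * t) x →
      T.eval x = (P.b₆ * (P.q * t) - x) * r.eval x * ψ x -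
        P.b₆ * (P.q * t - P.b₆ * x) * φ x * s.eval x := by
  obtain ⟨R, hR⟩ := exists_stieltjes_deform hP
  refine ⟨C P.b₆ * (C (P.q * t) - C P.b₆ * X) * ρ * s - (C (P.b₆ * (P.q * t)) - X) * r * σ -
    R * r * s, fun x hx hx' => ?_⟩
  rw [h _ hx', h' _ hx]
  simp only [eval_sub, eval_mul, eval_C, eval_X]
  linear_combination r.eval x * s.eval x * hR x hx hx'

theorem SecondKind.exists_shift_deform_bracket (hP : P.Standing t) {r s ρ σ : ℂ[X]} {φ ψ : ℂ → ℂ}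
    (h : P.SecondKind (P.q * t) r φ ρ) (h' : P.SecondKind t s ψ σ) :
    ∃ T : ℂ[X], ∀ x, P.AwaySupport t x → P.AwaySupport (P.q * t) (P.q * x) →
      T.eval x = (1 - P.b₁ * x) * (1 - P.b₄ * x) * r.eval (P.q * x) * ψ x -
        (1 - P.b₂ * x) * (1 - P.b₃ * x) * φ (P.q * x) * s.eval x := by
  obtain ⟨R, hR⟩ := exists_stieltjes_shift_deform hP
  refine ⟨(1 - C P.b₂ * X) * (1 - C P.b₃ * X) * ρ.comp (C P.q * X) * s -
    (1 - C P.b₁ * X) * (1 - C P.b₄ * X) * r.comp (C P.q * X) * σ -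
    R * r.comp (C P.q * X) * s, fun x hx hx' => ?_⟩
  rw [h _ hx', h' _ hx]
  simp only [eval_sub, eval_mul, eval_comp, eval_C, eval_X, eval_one]
  linear_combination r.eval (P.q * x) * s.eval x * hR x hx hx'

section

variable {p p' τ A B τ' A' B' : ℕ → ℂ[X]}

/-- Compatibility of the spectral matrices at `t` and `q t`. -/
theorem exists_deformation (hP : P.Standing t) (hp : P.IsOPS t p) (hp' : P.IsOPS (P.q * t) p')
    (h : P.SpectralPolys t p τ A B) (h' : P.SpectralPolys (P.q * t) p' τ' A' B') (n : ℕ) :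
    ∃ s l₀ l₁ : ℂ, ∃ β β' : ℂ[X], β ≠ 0 ∧
      (∀ x, P.q * P.b₆ * ((x - P.b₆ * t) * (P.b₆ * x - t)) * (l₀ + l₁ * x) =
        β.eval x * (τ n).eval x + s * (B n).eval x) ∧
      ∀ x, P.b₆ * ((x - P.b₆ * (P.q * t)) * (P.b₆ * x - P.q * t)) * (l₀ + l₁ * x) =
        β'.eval x * (τ' n).eval x + s * (A' n).eval x := by
  have hP' := hP.shift
  have hq := hP.q_ne_zero
  obtain ⟨ρ, hρ⟩ := exists_secondKind_assoc hP p n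
  obtain ⟨σ, hσ⟩ := exists_secondKind_assocPrev hP p n
  obtain ⟨ρ', hρ'⟩ := exists_secondKind_assoc hP' p' n
  obtain ⟨σ', hσ'⟩ := exists_secondKind_assocPrev hP' p' n
  -- S, T, T' pair rows of the matrices at qt and at t at the same point; L pairs row n at (qx, qt)
  -- with row n at (x, t). All four are polynomials.
  obtain ⟨S, hS⟩ := hρ'.exists_deform_bracket hP hρ
  obtain ⟨T, hT⟩ := hρ'.exists_deform_bracket hP hσ
  obtain ⟨T', hT'⟩ := hσ'.exists_deform_bracket hP hρ
  obtain ⟨L, hL⟩ := hρ'.exists_shift_deform_bracket hP hρ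
  have ev1 := eventually_awaySupport hP
  have ev2 := eventually_awaySupport hP'
  have ev3 := eventually_awaySupport_q_mul hP
  have ev4 : ∀ᶠ x in Bornology.cobounded ℂ, P.AwaySupport (P.q * t) (P.q * x) :=
    eventually_awaySupport_q_mul hP'
  have ha := a_ne_zero hP hp n
  have hγ := hp.leadingCoeff_ne_zero n
  have hγ' := hp'.leadingCoeff_ne_zero n
  have leadN : LeadAt (fun x => P.b₆ * (P.q * t) - x) 1 (-1) := by
    simpa using leadAt_sub_mul (P.b₆ * (P.q * t)) 1
  have leadM := (leadAt_sub_mul (P.q * t) P.b₆).const_mul P.b₆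
  obtain ⟨c, hc⟩ := exists_leadAt_prevPoly hp n
  -- Both terms of S have order x^{1 + n - (n+1)}, so S is constant; the quadratic factors in L
  -- raise the order by one, so L is linear.
  obtain ⟨s, hs⟩ : ∃ s, S = C s := by
    have h1 := ((leadN.mul (leadAt_poly hp' n) rfl rfl).mul (leadAt_assoc hP hp n) (m := (0 : ℕ))
      (by push_cast; ring) rfl).sub ((leadM.mul (leadAt_assoc hP' hp' n) rfl rfl).mul
      (leadAt_poly hp n) (m := (0 : ℕ)) (by push_cast; ring) rfl)
    exact ⟨_, eq_C_of_natDegree_le_zero (h1.congr ((ev1.and ev2).mono fun x hx =>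
      (hS x hx.1 hx.2).symm)).natDegree_le_and_coeff.1⟩
  have hT0 : T ≠ 0 := by
    have h1 := ((leadN.mul (leadAt_poly hp' n) rfl rfl).mul (leadAt_assocPrev hP hp n)
      (m := (1 : ℕ)) (by push_cast; ring) rfl).sub (((leadM.mul (leadAt_assoc hP' hp' n) rfl rfl).mul
      hc (m := -1) (by ring) rfl).of_lt (m := (1 : ℕ)) (by norm_num))
    have h2 := (h1.congr ((ev1.and ev2).mono fun x hx =>
      (hT x hx.1 hx.2).symm)).natDegree_le_and_coeff.2
    intro h0
    rw [h0, coeff_zero, sub_zero] at h2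
    have : -1 * (p' n).leadingCoeff * (P.a p n * (p n).leadingCoeff)⁻¹ ≠ 0 :=
      mul_ne_zero (mul_ne_zero (by norm_num) hγ') (inv_ne_zero (mul_ne_zero ha hγ))
    exact this h2.symm
  obtain ⟨l₁, l₀, hl⟩ : ∃ l₁ l₀, L = C l₁ * X + C l₀ := by
    have h1 := ((((leadAt_sub_mul 1 P.b₁).mul (leadAt_sub_mul 1 P.b₄) rfl rfl).mul
      ((leadAt_poly hp' n).comp_mul hq) rfl rfl).mul (leadAt_assoc hP hp n) (m := (1 : ℕ))
      (by push_cast; ring) rfl).sub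
      ((((leadAt_sub_mul 1 P.b₂).mul (leadAt_sub_mul 1 P.b₃) rfl rfl).mul
      ((leadAt_assoc hP' hp' n).comp_mul hq) rfl rfl).mul (leadAt_poly hp n) (m := (1 : ℕ))
      (by push_cast; ring) rfl)
    exact exists_eq_X_add_C_of_natDegree_le_one (h1.congr ((ev1.and ev4).mono fun x hx =>
      (hL x hx.1 hx.2).symm)).natDegree_le_and_coeff.1
  have hLe : ∀ x, L.eval x = l₀ + l₁ * x := fun x => by rw [hl]; simp; ring
  refine ⟨s, l₀, l₁, C (P.a p n) * T.comp (C P.q * X), C (-P.a p' n) * T', ?_, ?_, ?_⟩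
  · refine mul_ne_zero (C_ne_zero.2 ha) fun h0 => hT0 ?_
    refine eq_of_eventually_cobounded (Eventually.of_forall fun x => ?_)
    have := congrArg (eval (P.q⁻¹ * x)) h0
    simpa [mul_inv_cancel_left₀ hq] using this
  -- Expand row n at (qx, qt) in the two rows of Y_n at (qx, t): by the Casoratian the coefficients
  -- are the brackets S and T at qx. Pairing with row n at (x, t) produces τ_n and B_n.
  · have e : C (P.q * P.b₆) * ((X - C (P.b₆ * t)) * (C P.b₆ * X - C t)) * L =
        C (P.a p n) * T.comp (C P.q * X) * τ n + C s * B n := by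
      refine eq_of_eventually_cobounded ?_
      filter_upwards [ev1, ev3, ev4] with x hx hqx hqx'
      have hSq := hS _ hqx hqx'
      rw [hs, eval_C] at hSq
      have hcas := casoratian hP hp n hqx
      simp only [eval_add, eval_sub, eval_mul, eval_comp, eval_C, eval_X]
      rw [hL x hx hqx', hT _ hqx hqx', hSq, h.tau_eval n x hx hqx, h.B_eval n x hx hqx,
        eval_WplusV, eval_WminusV]
      linear_combination -(P.q * P.b₆ * (x - P.b₆ * t) * (P.b₆ * x - t) *
        ((1 - P.b₁ * x) * (1 - P.b₄ * x) * (p' n).eval (P.q * x) * P.assoc t p n x -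
          (1 - P.b₂ * x) * (1 - P.b₃ * x) * P.assoc (P.q * t) p' n (P.q * x) * (p n).eval x)) * hcas
    intro x
    have := congrArg (eval x) e
    simp only [eval_add, eval_sub, eval_mul, eval_C, eval_X, hLe] at this ⊢
    exact this
  -- Symmetrically, expand row n at (x, t) in the two rows at (x, qt), with coefficients S and T'.
  -- Pairing with row n at (qx, qt) produces τ'_n and A'_n.
  · have e : C P.b₆ * ((X - C (P.b₆ * (P.q * t))) * (C P.b₆ * X - C (P.q * t))) * L =
        C (-P.a p' n) * T' * τ' n + C s * A' n := by
      refine eq_of_eventually_cobounded ?_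
      filter_upwards [ev1, ev2, ev4] with x hx hx' hqx'
      have hSx := hS _ hx hx'
      rw [hs, eval_C] at hSx
      have hcas := casoratian hP' hp' n hx'
      simp only [eval_add, eval_sub, eval_mul, eval_C, eval_X]
      rw [hL x hx hqx', hT' _ hx hx', hSx, h'.tau_eval n x hx' hqx', h'.A_eval n x hx' hqx',
        eval_WplusV, eval_WminusV]
      linear_combination -(P.b₆ * (x - P.b₆ * (P.q * t)) * (P.b₆ * x - P.q * t) *
        ((1 - P.b₁ * x) * (1 - P.b₄ * x) * (p' n).eval (P.q * x) * P.assoc t p n x -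
          (1 - P.b₂ * x) * (1 - P.b₃ * x) * P.assoc (P.q * t) p' n (P.q * x) * (p n).eval x)) * hcas
    intro x
    have := congrArg (eval x) e
    simp only [eval_add, eval_sub, eval_mul, eval_C, eval_X, hLe] at this ⊢
    exact this

/-- At the zeros of τ_n and τ'_n the two compatibility identities express B_n(g) and A'_n(g')
through the same linear polynomial l₀ + l₁x. Comparison at x = 0 gives s = q b₆ t l₀, so f = -l₁/l₀
serves both relations. -/
theorem exists_deformation_variable (hP : P.Standing t) (hp : P.IsOPS t p)
    (hp' : P.IsOPS (P.q * t) p') (h : P.SpectralPolys t p τ A B)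
    (h' : P.SpectralPolys (P.q * t) p' τ' A' B') (n : ℕ) {g g' : ℂ} (hτ : τ n ≠ 0)
    (hg : (τ n).eval g = 0) (hg' : (τ' n).eval g' = 0) (hg0 : g ≠ 0)
    (hK : (g - P.b₆ * t) * (P.b₆ * g - t) ≠ 0) :
    ∃ f, t * (B n).eval g = (g - P.b₆ * t) * (P.b₆ * g - t) * (1 - g * f) ∧
      P.q * t * (A' n).eval g' =
        (g' - P.b₆ * (P.q * t)) * (P.b₆ * g' - P.q * t) * (1 - g' * f) := by
  obtain ⟨s, l₀, l₁, β, β', hβ, h1, h2⟩ := exists_deformation hP hp hp' h h' n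
  have hq := hP.q_ne_zero
  have hb := hP.b₆_ne_zero
  have ht := hP.t_ne_zero
  have hl0 : P.q * P.b₆ * t * l₀ = s := by
    have h3 := h1 0
    rw [← coeff_zero_eq_eval_zero (τ n), ← coeff_zero_eq_eval_zero (B n), h.tau_coeff_zero,
      h.B_coeff_zero] at h3
    refine mul_left_cancel₀ (mul_ne_zero hb ht) ?_
    linear_combination h3
  have hg1 := h1 g
  have hg2 := h2 g'
  rw [hg] at hg1
  rw [hg'] at hg2
  -- If s = 0 then l₀ = 0; evaluation at g, which is neither 0 nor a moving singular point, gives l₁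
  -- = 0; then β τ_n = 0 with both factors nonzero.
  have hs : s ≠ 0 := by
    intro hs
    have hl00 : l₀ = 0 := by
      rw [hs] at hl0
      simpa [hq, hb, ht] using hl0
    rw [hs, hl00] at hg1
    have hl1 : l₁ = 0 := by
      have h3 : P.q * P.b₆ * ((g - P.b₆ * t) * (P.b₆ * g - t)) * g * l₁ = 0 := by
        linear_combination hg1
      exact (mul_eq_zero.1 h3).resolve_left
        (mul_ne_zero (mul_ne_zero (mul_ne_zero hq hb) hK) hg0)
    refine mul_ne_zero hβ hτ (eq_of_eventually_cobounded (Eventually.of_forall fun x => ?_))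
    have h3 := h1 x
    rw [hs, hl00, hl1] at h3
    rw [eval_mul, eval_zero]
    linear_combination -h3
  have hl0' : l₀ ≠ 0 := fun h0 => hs (by rw [← hl0, h0, mul_zero])
  refine ⟨-l₁ / l₀, ?_, ?_⟩
  · rw [← hl0] at hg1
    have h3 : P.q * P.b₆ * l₀ ≠ 0 := mul_ne_zero (mul_ne_zero hq hb) hl0'
    refine mul_left_cancel₀ h3 ?_
    field_simp
    refine mul_left_cancel₀ (mul_ne_zero hq hb) ?_
    linear_combination -hg1
  · rw [← hl0] at hg2
    have h3 : P.b₆ * l₀ ≠ 0 := mul_ne_zero hb hl0'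
    refine mul_left_cancel₀ h3 ?_
    field_simp
    refine mul_left_cancel₀ hb ?_
    linear_combination -hg2

end

end LaxParams

/-! ### The linear system for the diagonal entries. -/

section Diagonal

variable {b₅ b₆ t f g e₁ e₂ e₃ w₁ w₂ v₁ v₂ x : ℂ}

/-- The linear conditions that determine the diagonal entries of the polynomial spectral matrix;
`e₁`, `e₂`, `e₃` are the elementary symmetric functions of `b₁, …, b₄`. -/
structure DiagonalConditions (b₅ b₆ t f g e₁ e₂ e₃ w₁ w₂ v₁ v₂ : ℂ) : Prop where
  b₅_ne : b₅ ≠ 0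
  b₆_ne : b₆ ≠ 0
  t_ne : t ≠ 0
  g_ne : g ≠ 0
  sq_ne : 1 - b₅ ^ 2 ≠ 0
  fg_ne : 1 - f * g ≠ 0
  coeff_one : w₁ + v₁ = -(1 + b₆ ^ 2) - e₁ * b₆ * t
  coeff_five : b₅ * v₂ + w₂ / b₅ = (1 + b₆ ^ 2) * t + e₃ * b₆
  eval_A : (-(b₅ * b₆) * g ^ 3 + w₂ * g ^ 2 + w₁ * g + b₆ * t) * (1 - f * g) =
    b₆ * t * (1 - e₁ * g + e₂ * g ^ 2 - e₃ * g ^ 3 + g ^ 4)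
  eval_B : t * (-(b₆ / b₅) * g ^ 3 + v₂ * g ^ 2 + v₁ * g + b₆ * t) =
    (g - b₆ * t) * (b₆ * g - t) * (1 - g * f)

namespace DiagonalConditions

/-- Here π = Π(g)/(1 - fg), so that A_n(g) = b₆tπ. Adding the values of A_n and B_n at g and using
w₁ + v₁ gives w₂ + v₂; combined with b₅v₂ + w₂/b₅ this determines w₂, at the cost of dividing by 1 -
b₅². Trading e₂ for π removes the denominator 1 - fg from the solution. -/
theorem solve (h : DiagonalConditions b₅ b₆ t f g e₁ e₂ e₃ w₁ w₂ v₁ v₂) :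
    ∃ π, e₂ = (π * (1 - f * g) - 1 + e₁ * g + e₃ * g ^ 3 - g ^ 4) / g ^ 2 ∧
    w₂ = ((1 + b₆ ^ 2) * t + e₃ * b₆ - b₅ * (((b₆ * t * π + b₅ * b₆ * g ^ 3 - b₆ * t +
      ((g - b₆ * t) * (b₆ * g - t) * (1 - g * f) / t + b₆ / b₅ * g ^ 3 - b₆ * t)) / g +
      (1 + b₆ ^ 2) + e₁ * b₆ * t) / g)) * b₅ / (1 - b₅ ^ 2) ∧
    w₁ = (b₆ * t * π + b₅ * b₆ * g ^ 3 - b₆ * t) / g - w₂ * g ∧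
    v₂ = ((1 + b₆ ^ 2) * t + e₃ * b₆ - w₂ / b₅) / b₅ ∧
    v₁ = -(1 + b₆ ^ 2) - e₁ * b₆ * t - w₁ := by
  obtain ⟨h5, h6, ht, hg, hsq, hfg, c1, c5, hA, hB⟩ := h
  have hgf : 1 - g * f ≠ 0 := by rwa [mul_comm]
  have hπ : b₆ * t * ((1 - e₁ * g + e₂ * g ^ 2 - e₃ * g ^ 3 + g ^ 4) / (1 - f * g)) =
      -(b₅ * b₆) * g ^ 3 + w₂ * g ^ 2 + w₁ * g + b₆ * t := by
    rw [← mul_div_assoc, ← hA, mul_div_cancel_right₀ _ hfg]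
  refine ⟨(1 - e₁ * g + e₂ * g ^ 2 - e₃ * g ^ 3 + g ^ 4) / (1 - f * g), ?_, ?_, ?_, ?_, ?_⟩
  · field_simp
    ring
  · rw [hπ, show (g - b₆ * t) * (b₆ * g - t) *
      (1 - g * f) / t = -(b₆ / b₅) * g ^ 3 + v₂ * g ^ 2 + v₁ * g + b₆ * t by
      rw [← hB, mul_div_cancel_left₀ _ ht], ← c5]
    have : v₁ = -(1 + b₆ ^ 2) - e₁ * b₆ * t - w₁ := by linear_combination c1
    subst this
    field_simp
    ring
  · rw [hπ]
    field_simp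
    ring
  · rw [← c5]
    field_simp
    ring
  · linear_combination c1

theorem plus_at_g (h : DiagonalConditions b₅ b₆ t f g e₁ e₂ e₃ w₁ w₂ v₁ v₂) (hx : x ≠ 0)
    (hxg : x - g ≠ 0) (hf : f ≠ 0) :
    (-(b₅ * b₆) * x ^ 3 + w₂ * x ^ 2 + w₁ * x + b₆ * t) / (x * (x - g)) =
      -(x * b₅ * b₆) + b₆ / (1 - b₅ ^ 2) * (-(b₅ ^ 2 / t) + b₅ * e₃)
      - b₆ * (b₅ * f - t) / ((1 - b₅ ^ 2) * t) *
          (g * (t - f * b₅) / f + t * b₅ * (1 + b₆ ^ 2) / b₆)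
      + b₆ * t / (1 - b₅ ^ 2) *
          (b₅ ^ 2 / g ^ 2 - (1 - b₅ ^ 2) / (x * g) - e₁ * b₅ ^ 2 * (1 / g)
            + b₅ ^ 2 * (f / g) - g / f
            + (1 - e₁ * g + e₂ * g ^ 2 - e₃ * g ^ 3 + g ^ 4) * (g - x * b₅ ^ 2) /
                ((1 - f * g) * g ^ 2 * (x - g))) := by
  obtain ⟨π, he, hw2, hw1, -, -⟩ := h.solve
  obtain ⟨h5, h6, ht, hg, hsq, hfg, -, -, -, -⟩ := h
  have hgf : 1 - g * f ≠ 0 := by rwa [mul_comm]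
  have hπ : 1 - e₁ * g + e₂ * g ^ 2 - e₃ * g ^ 3 + g ^ 4 = π * (1 - f * g) := by
    rw [he]; field_simp; ring
  rw [hπ, hw1, hw2, show π * (1 - f * g) * (g - x * b₅ ^ 2) / ((1 - f * g) * g ^ 2 * (x - g)) =
    π * (g - x * b₅ ^ 2) / (g ^ 2 * (x - g)) by field_simp]
  clear hπ he hw2 hw1
  field_simp
  ring

theorem plus_at_f (h : DiagonalConditions b₅ b₆ t f g e₁ e₂ e₃ w₁ w₂ v₁ v₂) (hx : x ≠ 0)
    (hxg : x - g ≠ 0) (hf : f ≠ 0) (hfx : 1 - f * x ≠ 0) :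
    (-(b₅ * b₆) * x ^ 3 + w₂ * x ^ 2 + w₁ * x + b₆ * t) / (x * (x - g)) =
      -(b₆ * t / (1 - b₅ ^ 2) *
          ((f ^ 4 - e₁ * f ^ 3 + e₂ * f ^ 2 - e₃ * f + 1) * (1 - b₅ ^ 2 * f * x) /
            (f ^ 2 * (1 - f * g) * (1 - f * x))))
      + b₆ * t * (1 - e₁ * x + e₂ * x ^ 2 - e₃ * x ^ 3 + x ^ 4) / (x * (1 - f * x) * (x - g))
      - b₆ * (b₅ * f - t) / f * x
      - b₆ * (b₅ * f - t) / (b₅ * (1 - b₅ ^ 2) * t) *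
          (b₅ ^ 2 * (1 + b₆ ^ 2) * t / b₆ + b₅ * g / f * (t - b₅ * f)
            + b₅ / f ^ 2 * (t + b₅ * f - t * f * e₃)) := by
  obtain ⟨π, he, hw2, hw1, -, -⟩ := h.solve
  obtain ⟨h5, h6, ht, hg, hsq, hfg, -, -, -, -⟩ := h
  have hgf : 1 - g * f ≠ 0 := by rwa [mul_comm]
  have hxf : 1 - x * f ≠ 0 := by rwa [mul_comm]
  rw [hw1, hw2, he]
  clear he hw2 hw1
  field_simp
  ring

theorem minus_at_g (h : DiagonalConditions b₅ b₆ t f g e₁ e₂ e₃ w₁ w₂ v₁ v₂) (hx : x ≠ 0)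
    (hxg : x - g ≠ 0) (htg : t * g - b₅ ≠ 0) :
    t * (-(b₆ / b₅) * x ^ 3 + v₂ * x ^ 2 + v₁ * x + b₆ * t) / (x * (x - g)) =
      (1 - x * f) * (x - b₆ * t) * (x * b₆ - t) / (x * (x - g))
      - b₆ / (1 - b₅ ^ 2) *
          ((t ^ 4 - e₁ * t ^ 3 * b₅ + e₂ * t ^ 2 * b₅ ^ 2 - e₃ * t * b₅ ^ 3 + b₅ ^ 4) /
            (b₅ * (t * g - b₅)))
      + b₆ * (b₅ * f - t) / (b₅ * (1 - b₅ ^ 2)) *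
          ((1 - b₅ ^ 2) * x - t ^ 2 / g - g * b₅ ^ 2 + b₅ ^ 2 * (1 + b₆ ^ 2) * t / b₆
            - b₅ * t ^ 2 * (1 - e₁ * g + e₂ * g ^ 2 - e₃ * g ^ 3 + g ^ 4) /
                (g * (1 - f * g) * (t * g - b₅))) := by
  obtain ⟨π, he, hw2, hw1, hv2, hv1⟩ := h.solve
  obtain ⟨h5, h6, ht, hg, hsq, hfg, -, -, -, -⟩ := h
  have hgf : 1 - g * f ≠ 0 := by rwa [mul_comm]
  have hπ : 1 - e₁ * g + e₂ * g ^ 2 - e₃ * g ^ 3 + g ^ 4 = π * (1 - f * g) := by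
    rw [he]; field_simp; ring
  rw [hπ, show b₅ * t ^ 2 * (π * (1 - f * g)) / (g * (1 - f * g) * (t * g - b₅)) =
    b₅ * t ^ 2 * π / (g * (t * g - b₅)) by field_simp, hv1, hv2, hw1, hw2, he]
  clear hπ he hw2 hw1 hv1 hv2
  field_simp
  ring

theorem minus_at_f (h : DiagonalConditions b₅ b₆ t f g e₁ e₂ e₃ w₁ w₂ v₁ v₂) (hx : x ≠ 0)
    (hxg : x - g ≠ 0) (hf : f ≠ 0) :
    t * (-(b₆ / b₅) * x ^ 3 + v₂ * x ^ 2 + v₁ * x + b₆ * t) / (x * (x - g)) =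
      (1 - x * f) * (x - b₆ * t) * (b₆ * x - t) / (x * (x - g))
      + b₆ * t ^ 2 / (1 - b₅ ^ 2) *
          ((f ^ 4 - e₁ * f ^ 3 + e₂ * f ^ 2 - e₃ * f + 1) / (f ^ 2 * (1 - f * g)))
      + b₆ * (b₅ * f - t) / (b₅ * (1 - b₅ ^ 2)) *
          ((1 - b₅ ^ 2) * x + b₅ ^ 2 * (1 + b₆ ^ 2) * t / b₆ + b₅ * g / f * (t - b₅ * f)
            + b₅ / f ^ 2 * (t + b₅ * f - t * f * e₃)) := by
  obtain ⟨π, he, hw2, hw1, hv2, hv1⟩ := h.solve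
  obtain ⟨h5, h6, ht, hg, hsq, hfg, -, -, -, -⟩ := h
  have hgf : 1 - g * f ≠ 0 := by rwa [mul_comm]
  rw [hv1, hv2, hw1, hw2, he]
  clear he hw2 hw1 hv1 hv2
  field_simp
  ring

end DiagonalConditions

end Diagonal

/-! ### From the spectral polynomials to the variables g_n and f_n. -/

theorem coeff_one_five_eq_zero {c₀ c₁ c₂ c₃ c₄ c₅ c₆ : ℂ}
    (h : ∀ x, c₀ + c₁ * x + c₂ * x ^ 2 + c₃ * x ^ 3 + c₄ * x ^ 4 + c₅ * x ^ 5 + c₆ * x ^ 6 = 0) :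
    c₁ = 0 ∧ c₅ = 0 := by
  have h0 : C c₀ + C c₁ * X + C c₂ * X ^ 2 + C c₃ * X ^ 3 + C c₄ * X ^ 4 + C c₅ * X ^ 5 +
      C c₆ * X ^ 6 = (0 : ℂ[X]) := funext fun x => by simpa using h x
  have h1 := congrArg (coeff · 1) h0
  have h5 := congrArg (coeff · 5) h0
  simp [coeff_C, coeff_X_pow] at h1 h5
  exact ⟨h1, h5⟩

theorem eval_eq_of_natDegree_le_three {r : ℂ[X]} (hr : r.natDegree ≤ 3) (x : ℂ) :
    r.eval x = r.coeff 3 * x ^ 3 + r.coeff 2 * x ^ 2 + r.coeff 1 * x + r.coeff 0 := by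
  rw [eval_eq_sum_range' (Nat.lt_succ_of_le hr)]
  simp [Finset.sum_range_succ]
  ring

namespace LaxParams

variable {P : LaxParams} {t : ℂ} {p : ℕ → ℂ[X]}

theorem Standing.sum_one_div (hP : P.Standing t) :
    1 / P.b₁ + 1 / P.b₂ + 1 / P.b₃ + 1 / P.b₄ = P.b₂ * P.b₃ * P.b₄ + P.b₁ * P.b₃ * P.b₄ +
      P.b₁ * P.b₂ * P.b₄ + P.b₁ * P.b₂ * P.b₃ := by
  have hb1 := hP.b₁_ne_zero
  have hb2 := hP.b₂_ne_zero
  have hb3 := hP.b₃_ne_zero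
  have hb4 := hP.b₄_ne_zero
  field_simp
  linear_combination -(P.b₂ * P.b₃ * P.b₄ + P.b₁ * P.b₃ * P.b₄ +
    P.b₁ * P.b₂ * P.b₄ + P.b₁ * P.b₂ * P.b₃) * hP.prod_b

theorem b₅_succ (P : LaxParams) (n : ℕ) : P.b₅ (n + 1) = P.q * P.b₅ n := by
  simp only [b₅]; ring

theorem isRoot_g (P : LaxParams) (t : ℂ) (p : ℕ → ℂ[X]) (n : ℕ)
    (h : ∃ z, ((P.spectral t p).Θ n).IsRoot z) :
    ((P.spectral t p).Θ n).IsRoot (P.g t p n) := Classical.epsilon_spec h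

namespace SpectralPolys

variable {τ A B : ℕ → ℂ[X]}

theorem exists_tau_eq (h : P.SpectralPolys t p τ A B) {n : ℕ}
    (hk : P.b₆ / P.b₅ n * (P.q⁻¹ - P.b₅ n ^ 2) ≠ 0) :
    ∃ z, τ n = C (P.b₆ / P.b₅ n * (P.q⁻¹ - P.b₅ n ^ 2)) * X * (X - C z) := by
  set k := P.b₆ / P.b₅ n * (P.q⁻¹ - P.b₅ n ^ 2) with hkdef
  refine ⟨-(τ n).coeff 1 / k, ?_⟩
  have e : C k * X * (X - C (-(τ n).coeff 1 / k)) = C k * X ^ 2 + C ((τ n).coeff 1) * X := by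
    rw [show (τ n).coeff 1 = -(k * (-(τ n).coeff 1 / k)) by field_simp]
    simp only [C_neg, C_mul]
    rw [show -(k * (-(τ n).coeff 1 / k)) = (τ n).coeff 1 by field_simp]
    ring
  rw [e]
  ext m
  rcases m with _ | _ | _ | m
  · simp [h.tau_coeff_zero]
  · simp [coeff_X_pow]
  · simp [h.tau_coeff_two, ← hkdef]
  · rw [coeff_eq_zero_of_natDegree_lt (by have := h.tau_natDegree n; omega)]
    simp

theorem isRoot_Θ_iff (hP : P.Standing t) (hp : P.IsOPS t p) (h : P.SpectralPolys t p τ A B) {n : ℕ}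
    {k z : ℂ} (hk : k ≠ 0) (hτ : τ n = C k * X * (X - C z)) (y : ℂ) :
    ((P.spectral t p).Θ n).IsRoot y ↔ y = z := by
  have h1 := h.ΔyPoly_mul_Θ hP n
  have hq := sub_ne_zero.2 hP.q_ne_one
  have h2 : C (P.q - 1) * (P.coeffsOf t τ A B).Θ n = C k * (X - C z) :=
    mul_left_cancel₀ X_ne_zero (by rw [hτ, ΔyPoly] at h1; linear_combination h1)
  have h3 := congrArg (eval y) h2
  simp only [eval_mul, eval_C, eval_sub, eval_X] at h3
  rw [h.spectral_eq hP hp, IsRoot.def, ← sub_eq_zero (a := y)]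
  constructor
  · intro h0
    rw [h0, mul_zero] at h3
    exact (mul_eq_zero.1 h3.symm).resolve_left hk
  · intro h0
    rw [h0, mul_zero] at h3
    exact (mul_eq_zero.1 h3).resolve_left hq

theorem existsUnique_isRoot (hP : P.Standing t) (hp : P.IsOPS t p) (h : P.SpectralPolys t p τ A B)
    {n : ℕ} {k z : ℂ} (hk : k ≠ 0) (hτ : τ n = C k * X * (X - C z)) :
    ∃! y, ((P.spectral t p).Θ n).IsRoot y :=
  ⟨z, (h.isRoot_Θ_iff hP hp hk hτ z).2 rfl, fun _ hy => (h.isRoot_Θ_iff hP hp hk hτ _).1 hy⟩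

/-- The polynomial `τ_n` in terms of its zero `g_n`. -/
theorem tau_eq (hP : P.Standing t) (hp : P.IsOPS t p) (h : P.SpectralPolys t p τ A B) {n : ℕ}
    (hn : P.b₅ n ^ 2 ≠ P.q⁻¹) :
    (∃! y, ((P.spectral t p).Θ n).IsRoot y) ∧
      τ n = C (P.b₆ / P.b₅ n * (P.q⁻¹ - P.b₅ n ^ 2)) * X * (X - C (P.g t p n)) := by
  have hk : P.b₆ / P.b₅ n * (P.q⁻¹ - P.b₅ n ^ 2) ≠ 0 :=
    mul_ne_zero (div_ne_zero hP.b₆_ne_zero (b₅_ne_zero hP n)) (sub_ne_zero.2 hn.symm)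
  obtain ⟨z, hz⟩ := h.exists_tau_eq hk
  have hu := h.existsUnique_isRoot hP hp hk hz
  rw [(h.isRoot_Θ_iff hP hp hk hz _).1 (isRoot_g P t p n hu.exists)]
  exact ⟨hu, hz⟩

/-- The combination defining z₊ is therefore A_n(g)/g, which makes Z, and hence f_n, an expression
in A_n(g) and g. -/
theorem eval_A_g (hP : P.Standing t) (hp : P.IsOPS t p) (h : P.SpectralPolys t p τ A B) (n : ℕ) :
    (A n).eval (P.g t p n) = P.ν t p n + (P.q - 1) * P.g t p n * P.μ t p n := by
  rw [ν, μ, h.spectral_eq hP hp, ← h.frakWplus_eq hP]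
  simp [frakWplus, ΔyPoly]

/-- The linear conditions on the coefficients of the diagonal entries. -/
theorem diagonalConditions (hP : P.Standing t) (hp : P.IsOPS t p) (h : P.SpectralPolys t p τ A B)
    {n : ℕ} (hn : P.b₅ n ^ 2 ≠ 1) {f g : ℂ} (hτ : (τ n).eval g = 0) (hg : g ≠ 0)
    (hfg : f * g ≠ 1) (hK : (g - P.b₆ * t) * (P.b₆ * g - t) ≠ 0)
    (hB : t * (B n).eval g = (g - P.b₆ * t) * (P.b₆ * g - t) * (1 - g * f)) :
    DiagonalConditions (P.b₅ n) P.b₆ t f g (P.b₁ + P.b₂ + P.b₃ + P.b₄)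
      (P.b₁ * P.b₂ + P.b₁ * P.b₃ + P.b₁ * P.b₄ + P.b₂ * P.b₃ + P.b₂ * P.b₄ + P.b₃ * P.b₄)
      (1 / P.b₁ + 1 / P.b₂ + 1 / P.b₃ + 1 / P.b₄)
      ((A n).coeff 1) ((A n).coeff 2) ((B n).coeff 1) ((B n).coeff 2) := by
  have h5 := b₅_ne_zero hP n
  have h6 := hP.b₆_ne_zero
  have ht := hP.t_ne_zero
  have hprod := hP.prod_b
  have hA' := eval_eq_of_natDegree_le_three (h.A_natDegree n)
  have hB' := eval_eq_of_natDegree_le_three (h.B_natDegree n)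
  simp only [h.A_coeff_zero, h.A_coeff_three] at hA'
  simp only [h.B_coeff_zero, h.B_coeff_three] at hB'
  have tau : ∀ m x, (τ m).eval x = x * ((τ m).coeff 1 + (τ m).coeff 2 * x) := fun m x => by
    rw [eval_eq_of_natDegree_le_three ((h.tau_natDegree m).trans (by norm_num)), h.tau_coeff_zero,
      coeff_eq_zero_of_natDegree_lt (lt_of_le_of_lt (h.tau_natDegree m) (by norm_num))]
    ring
  -- The product τ_n τ_{n-1} is divisible by x² and has degree at most 4, so it is invisible in the
  -- coefficients of x and x⁵ of the determinant.
  obtain ⟨r₁, r₂, hr⟩ : ∃ r₁ r₂, ∀ x, (prevPoly τ n).eval x = x * (r₁ + r₂ * x) := by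
    cases n with
    | zero => exact ⟨0, 0, fun x => by simp [prevPoly]⟩
    | succ n => exact ⟨_, _, tau n⟩
  have hdet : ∀ x, (A n).eval x * (B n).eval x + P.a p n ^ 2 * (τ n).eval x *
      (prevPoly τ n).eval x = P.b₆ * (1 - P.b₁ * x) * (1 - P.b₄ * x) * (t - P.b₆ * x) *
      ((1 - P.b₂ * x) * (1 - P.b₃ * x) * (P.b₆ * t - x)) := fun x => by
    have := congrArg (eval x) (h.det hP hp n)
    simpa [eval_WplusV, eval_WminusV] using this
  rw [hP.sum_one_div]
  set e₁ := P.b₁ + P.b₂ + P.b₃ + P.b₄ with he1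
  set e₂ := P.b₁ * P.b₂ + P.b₁ * P.b₃ + P.b₁ * P.b₄ + P.b₂ * P.b₃ + P.b₂ * P.b₄ + P.b₃ * P.b₄
    with he2
  set e₃ := P.b₂ * P.b₃ * P.b₄ + P.b₁ * P.b₃ * P.b₄ + P.b₁ * P.b₂ * P.b₄ + P.b₁ * P.b₂ * P.b₃
    with he3'
  have hdet' : ∀ x, (A n).eval x * (B n).eval x + P.a p n ^ 2 * (τ n).eval x *
      (prevPoly τ n).eval x = P.b₆ * (1 - e₁ * x + e₂ * x ^ 2 - e₃ * x ^ 3 + x ^ 4) *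
      ((x - P.b₆ * t) * (P.b₆ * x - t)) := fun x => by
    rw [hdet, he1, he2, he3']
    linear_combination P.b₆ * x ^ 4 * ((x - P.b₆ * t) * (P.b₆ * x - t)) * hprod
  have hcoef := coeff_one_five_eq_zero (c₀ := 0)
    (c₁ := P.b₆ * t * ((A n).coeff 1 + (B n).coeff 1) +
      P.b₆ * ((1 + P.b₆ ^ 2) * t + e₁ * P.b₆ * t ^ 2))
    (c₂ := P.b₆ * t * ((A n).coeff 2 + (B n).coeff 2) + (A n).coeff 1 * (B n).coeff 1 +
      P.a p n ^ 2 * (τ n).coeff 1 * r₁ -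
      P.b₆ * (P.b₆ + e₁ * (1 + P.b₆ ^ 2) * t + e₂ * P.b₆ * t ^ 2))
    (c₃ := P.b₆ * t * (-(P.b₅ n * P.b₆) - P.b₆ / P.b₅ n) + (A n).coeff 1 * (B n).coeff 2 +
      (A n).coeff 2 * (B n).coeff 1 + P.a p n ^ 2 * ((τ n).coeff 1 * r₂ + (τ n).coeff 2 * r₁) +
      P.b₆ * (e₁ * P.b₆ + e₂ * (1 + P.b₆ ^ 2) * t + e₃ * P.b₆ * t ^ 2))
    (c₄ := -(P.b₅ n * P.b₆) * (B n).coeff 1 - P.b₆ / P.b₅ n * (A n).coeff 1 +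
      (A n).coeff 2 * (B n).coeff 2 + P.a p n ^ 2 * (τ n).coeff 2 * r₂ -
      P.b₆ * (e₂ * P.b₆ + e₃ * (1 + P.b₆ ^ 2) * t + P.b₆ * t ^ 2))
    (c₅ := -(P.b₅ n * P.b₆) * (B n).coeff 2 - P.b₆ / P.b₅ n * (A n).coeff 2 +
      P.b₆ * (e₃ * P.b₆ + (1 + P.b₆ ^ 2) * t)) (c₆ := 0) fun x => by
    have hx := hdet' x
    rw [hA', hB', tau, hr] at hx
    have e : P.b₅ n * P.b₆ * (P.b₆ / P.b₅ n) = P.b₆ ^ 2 := by field_simp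
    linear_combination hx - x ^ 6 * e
  refine ⟨h5, h6, ht, hg, sub_ne_zero.2 hn.symm, sub_ne_zero.2 hfg.symm, ?_, ?_, ?_, ?_⟩
  · refine mul_left_cancel₀ (mul_ne_zero h6 ht) ?_
    linear_combination hcoef.1
  · refine mul_left_cancel₀ h6 ?_
    rw [mul_add, ← mul_div_assoc, ← div_mul_eq_mul_div]
    linear_combination -hcoef.2
  -- At g the determinant is A_n(g) B_n(g); inserting the formula for t B_n(g), the common factor (g
  -- - b₆t)(b₆g - t) cancels.
  · rw [← hA']
    have hx := hdet' g
    rw [hτ] at hx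
    refine mul_left_cancel₀ hK ?_
    linear_combination t * hx - (A n).eval g * hB
  · rw [← hB, hB']

end SpectralPolys

/-- The defining relation of `f_n` at the value `q t` of the deformation variable. -/
theorem f_relation (hP : P.Standing t) {p : ℂ → ℕ → ℂ[X]} (hp' : P.IsOPS (P.q * t) (p (P.q * t)))
    {τ A B : ℕ → ℂ[X]} (h : P.SpectralPolys (P.q * t) (p (P.q * t)) τ A B) (n : ℕ) {g : ℂ}
    (hg : g = P.g (P.q * t) (p (P.q * t)) n) (hg0 : g ≠ 0)
    (h1 : g - P.b₆ * (P.q * t) ≠ 0) (h2 : P.b₆ * g - P.q * t ≠ 0) :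
    P.q * t * (A n).eval g =
      (g - P.b₆ * (P.q * t)) * (P.b₆ * g - P.q * t) * (1 - g * P.f t p n) := by
  have h5 := b₅_ne_zero hP n
  have h6 := hP.b₆_ne_zero
  have hA := h.eval_A_g hP.shift hp' n
  rw [← hg] at hA
  have hK := mul_ne_zero h1 h2
  rw [f, Zvar, zPlus, ← hg, hA]
  generalize (g - P.b₆ * (P.q * t)) * (P.b₆ * g - P.q * t) = K at *
  field_simp
  ring

theorem isRoot_of_eq_mul {r : ℂ[X]} {k z : ℂ} (h : r = C k * X * (X - C z)) : r.eval z = 0 := by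
  simp [h]

theorem ne_zero_of_eq_mul {r : ℂ[X]} {k z : ℂ} (hk : k ≠ 0) (h : r = C k * X * (X - C z)) :
    r ≠ 0 := by
  rw [h]
  exact mul_ne_zero (mul_ne_zero (C_ne_zero.2 hk) X_ne_zero) (X_sub_C_ne_zero z)

end LaxParams

end

/-! ### Assembly of the result. -/

theorem mainTheorem3 (P : LaxParams) (t : ℂ) (hP : P.Standing t) (p : ℂ → ℕ → ℂ[X])
    (hp : P.IsOPS t (p t)) (hp' : P.IsOPS (P.q * t) (p (P.q * t))) (n : ℕ)
    (b₁ b₂ b₃ b₄ b₅ b₆ q a f g g' : ℂ)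
    (hb₁ : b₁ = P.b₁) (hb₂ : b₂ = P.b₂) (hb₃ : b₃ = P.b₃) (hb₄ : b₄ = P.b₄) (hb₆ : b₆ = P.b₆)
    (hq : q = P.q) (hb₅ : b₅ = P.b₅ n) (ha : a = P.a (p t) n)
    (hf : f = P.f t p n) (hg : g = P.g t (p t) n) (hg' : g' = P.g (q * t) (p (q * t)) n)
    (h₁ : b₅ ^ 2 ≠ q⁻¹) (h₂ : b₅ ^ 2 ≠ 1) (h₃ : b₅ ^ 2 ≠ q) :
    -- the spectral coefficients and the zeros of `Θ_n` are well defined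
    (∃! σ, P.IsSpectral t (p t) σ) ∧ (∃! σ, P.IsSpectral (q * t) (p (q * t)) σ) ∧
    (∃! z, ((P.spectral t (p t)).Θ n).IsRoot z) ∧
    (∃! z, ((P.spectral (q * t) (p (q * t))).Θ n).IsRoot z) ∧
    -- the off-diagonal elements
    P.frakTplus (p t) (P.spectral t (p t)) n = C (b₆ / b₅ * (q⁻¹ - b₅ ^ 2) * a) * X * (X - C g) ∧
    (1 ≤ n → (∃! z, ((P.spectral t (p t)).Θ (n - 1)).IsRoot z) ∧
      P.frakTminus (p t) (P.spectral t (p t)) n =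
        C (b₆ / b₅ * (1 - q⁻¹ * b₅ ^ 2) * a) * X * (X - C (P.g t (p t) (n - 1)))) ∧
    -- the diagonal elements
    (g ≠ 0 → g ≠ b₆ * t → g ≠ b₆⁻¹ * t →
      g' ≠ 0 → g' ≠ b₆ * (q * t) → g' ≠ b₆⁻¹ * (q * t) → f * g ≠ 1 →
      ∀ x : ℂ, x ≠ 0 → x ≠ g →
      (f ≠ 0 →
        (P.frakWplus t (P.spectral t (p t)) n).eval x / (x * (x - g)) =
          -(x * b₅ * b₆)
          + b₆ / (1 - b₅ ^ 2) * (-(b₅ ^ 2 / t) + b₅ * (1 / b₁ + 1 / b₂ + 1 / b₃ + 1 / b₄))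
          - b₆ * (b₅ * f - t) / ((1 - b₅ ^ 2) * t) *
              (g * (t - f * b₅) / f + t * b₅ * (1 + b₆ ^ 2) / b₆)
          + b₆ * t / (1 - b₅ ^ 2) *
              (b₅ ^ 2 / g ^ 2 - (1 - b₅ ^ 2) / (x * g) - (b₁ + b₂ + b₃ + b₄) * b₅ ^ 2 * (1 / g)
                + b₅ ^ 2 * (f / g) - g / f
                + (1 - g * b₁) * (1 - g * b₂) * (1 - g * b₃) * (1 - g * b₄) * (g - x * b₅ ^ 2) /
                    ((1 - f * g) * g ^ 2 * (x - g)))) ∧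
      (f ≠ 0 → f * x ≠ 1 →
        (P.frakWplus t (P.spectral t (p t)) n).eval x / (x * (x - g)) =
          -(b₆ * t / (1 - b₅ ^ 2) *
              ((f - b₁) * (f - b₂) * (f - b₃) * (f - b₄) * (1 - b₅ ^ 2 * f * x) /
                (f ^ 2 * (1 - f * g) * (1 - f * x))))
          + b₆ * t * (1 - x * b₁) * (1 - x * b₂) * (1 - x * b₃) * (1 - x * b₄) /
              (x * (1 - x * f) * (x - g))
          - b₆ * (b₅ * f - t) / f * x
          - b₆ * (b₅ * f - t) / (b₅ * (1 - b₅ ^ 2) * t) *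
              (b₅ ^ 2 * (1 + b₆ ^ 2) * t / b₆ + b₅ * g / f * (t - b₅ * f)
                + b₅ / f ^ 2 * (t + b₅ * f - t * f * (1 / b₁ + 1 / b₂ + 1 / b₃ + 1 / b₄)))) ∧
      (t * g ≠ b₅ →
        t * (P.frakWminus t (P.spectral t (p t)) n).eval x / (x * (x - g)) =
          (1 - x * f) * (x - b₆ * t) * (x * b₆ - t) / (x * (x - g))
          - b₆ / (1 - b₅ ^ 2) *
              ((t - b₁ * b₅) * (t - b₂ * b₅) * (t - b₃ * b₅) * (t - b₄ * b₅) /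
                (b₅ * (t * g - b₅)))
          + b₆ * (b₅ * f - t) / (b₅ * (1 - b₅ ^ 2)) *
              ((1 - b₅ ^ 2) * x - t ^ 2 / g - g * b₅ ^ 2 + b₅ ^ 2 * (1 + b₆ ^ 2) * t / b₆
                - b₅ * t ^ 2 * (1 - g * b₁) * (1 - g * b₂) * (1 - g * b₃) * (1 - g * b₄) /
                    (g * (1 - f * g) * (t * g - b₅)))) ∧
      (f ≠ 0 →
        t * (P.frakWminus t (P.spectral t (p t)) n).eval x / (x * (x - g)) =
          (1 - x * f) * (x - b₆ * t) * (b₆ * x - t) / (x * (x - g))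
          + b₆ * t ^ 2 / (1 - b₅ ^ 2) *
              ((f - b₁) * (f - b₂) * (f - b₃) * (f - b₄) / (f ^ 2 * (1 - f * g)))
          + b₆ * (b₅ * f - t) / (b₅ * (1 - b₅ ^ 2)) *
              ((1 - b₅ ^ 2) * x + b₅ ^ 2 * (1 + b₆ ^ 2) * t / b₆ + b₅ * g / f * (t - b₅ * f)
                + b₅ / f ^ 2 *
                  (t + b₅ * f - t * f * (1 / b₁ + 1 / b₂ + 1 / b₃ + 1 / b₄))))) := by
  subst hb₁ hb₂ hb₃ hb₄ hb₆ hq hb₅ ha hf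
  obtain ⟨τ, A, B, h⟩ := LaxParams.exists_spectralPolys hP hp
  obtain ⟨τ', A', B', h'⟩ := LaxParams.exists_spectralPolys hP.shift hp'
  have hb₅ := LaxParams.b₅_ne_zero hP n
  have hb₆ := hP.b₆_ne_zero
  have hq := hP.q_ne_zero
  have ht := hP.t_ne_zero
  obtain ⟨hu, hτ⟩ := h.tau_eq hP hp h₁
  obtain ⟨hu', hτ'⟩ := h'.tau_eq hP.shift hp' h₁
  refine ⟨h.existsUnique_isSpectral hP hp, h'.existsUnique_isSpectral hP.shift hp', hu, hu',
    ?_, ?_, ?_⟩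
  · rw [h.spectral_eq hP hp, h.frakTplus_eq hP, hτ, hg]
    simp only [C_mul]
    ring
  · intro hn
    obtain ⟨m, rfl⟩ : ∃ m, n = m + 1 := ⟨n - 1, by omega⟩
    -- Since b₅ at n is q times b₅ at n - 1, the condition b₅² ≠ q is the one under which Θ_{n-1}
    -- has degree one.
    have h₃' : P.b₅ m ^ 2 ≠ P.q⁻¹ := fun h0 => h₃ (by
      rw [P.b₅_succ, mul_pow, h0]
      field_simp)
    obtain ⟨hum, hτm⟩ := h.tau_eq hP hp h₃'
    refine ⟨hum, ?_⟩
    have hbm := LaxParams.b₅_ne_zero hP m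
    rw [h.spectral_eq hP hp, h.frakTminus_eq hP, LaxParams.prevPoly, hτm, Nat.add_sub_cancel,
      P.b₅_succ, show P.b₆ / P.b₅ m * (P.q⁻¹ - P.b₅ m ^ 2) =
        P.b₆ / (P.q * P.b₅ m) * (1 - P.q⁻¹ * (P.q * P.b₅ m) ^ 2) by field_simp]
    simp only [C_mul]
    ring
  · intro hg0 hg1 hg2 hg0' hg1' hg2' hfg x hx hxg
    have hk : P.b₆ / P.b₅ n * (P.q⁻¹ - P.b₅ n ^ 2) ≠ 0 :=
      mul_ne_zero (div_ne_zero hb₆ hb₅) (sub_ne_zero.2 h₁.symm)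
    rw [← hg] at hτ
    rw [← hg'] at hτ'
    have aux : ∀ {y s : ℂ}, y ≠ P.b₆⁻¹ * s → P.b₆ * y - s ≠ 0 := fun {y s} hy h0 => hy (by
      rw [← sub_eq_zero.1 h0, inv_mul_cancel_left₀ hb₆])
    have hK := mul_ne_zero (sub_ne_zero.2 hg1) (aux hg2)
    obtain ⟨f, hf1, hf2⟩ := LaxParams.exists_deformation_variable hP hp hp' h h' n
      (LaxParams.ne_zero_of_eq_mul hk hτ) (LaxParams.isRoot_of_eq_mul hτ)
      (LaxParams.isRoot_of_eq_mul hτ') hg0 hK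
    -- The deformation variable and f_n satisfy the same relation at (g', qt), and that relation is
    -- affine in f with slope nonzero by the conditions on g'.
    have hff : P.f t p n = f := by
      rw [LaxParams.f_relation hP hp' h' n hg' hg0' (sub_ne_zero.2 hg1') (aux hg2')] at hf2
      have h3 := mul_left_cancel₀ (mul_ne_zero (sub_ne_zero.2 hg1') (aux hg2')) hf2
      exact mul_left_cancel₀ hg0' (by linear_combination -h3)
    rw [hff] at hfg ⊢
    have hD := h.diagonalConditions hP hp h₂ (LaxParams.isRoot_of_eq_mul hτ) hg0 hfg hK hf1
    have hxg' := sub_ne_zero.2 hxg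
    have hprod := hP.prod_b
    have hA : (P.frakWplus t (P.spectral t (p t)) n).eval x = -(P.b₅ n * P.b₆) * x ^ 3 +
        (A n).coeff 2 * x ^ 2 + (A n).coeff 1 * x + P.b₆ * t := by
      rw [h.spectral_eq hP hp, h.frakWplus_eq hP,
        eval_eq_of_natDegree_le_three (h.A_natDegree n), h.A_coeff_zero, h.A_coeff_three]
    have hB : (P.frakWminus t (P.spectral t (p t)) n).eval x = -(P.b₆ / P.b₅ n) * x ^ 3 +
        (B n).coeff 2 * x ^ 2 + (B n).coeff 1 * x + P.b₆ * t := by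
      rw [h.spectral_eq hP hp, h.frakWminus_eq hP,
        eval_eq_of_natDegree_le_three (h.B_natDegree n), h.B_coeff_zero, h.B_coeff_three]
    have he3 := hP.sum_one_div
    rw [hA, hB]
    -- Homogeneous expansion covering all the quartic products: (u, v) = (1, y) gives Π(y), (f, 1)
    -- gives Φ, and (t, b₅) gives ∏(t - b_i b₅). The product b₁b₂b₃b₄ = 1 makes the last coefficient
    -- 1 and the third one S'.
    have hsym : ∀ u v : ℂ, (u - P.b₁ * v) * (u - P.b₂ * v) * (u - P.b₃ * v) * (u - P.b₄ * v) =
        u ^ 4 - (P.b₁ + P.b₂ + P.b₃ + P.b₄) * u ^ 3 * v +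
        (P.b₁ * P.b₂ + P.b₁ * P.b₃ + P.b₁ * P.b₄ + P.b₂ * P.b₃ + P.b₂ * P.b₄ + P.b₃ * P.b₄) *
          u ^ 2 * v ^ 2 - (1 / P.b₁ + 1 / P.b₂ + 1 / P.b₃ + 1 / P.b₄) * u * v ^ 3 + v ^ 4 := by
      intro u v
      rw [he3]
      linear_combination v ^ 4 * hprod
    have hPi : ∀ y : ℂ, (1 - y * P.b₁) * (1 - y * P.b₂) * (1 - y * P.b₃) * (1 - y * P.b₄) =
        1 - (P.b₁ + P.b₂ + P.b₃ + P.b₄) * y +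
        (P.b₁ * P.b₂ + P.b₁ * P.b₃ + P.b₁ * P.b₄ + P.b₂ * P.b₃ + P.b₂ * P.b₄ + P.b₃ * P.b₄) *
          y ^ 2 - (1 / P.b₁ + 1 / P.b₂ + 1 / P.b₃ + 1 / P.b₄) * y ^ 3 + y ^ 4 := by
      intro y
      linear_combination hsym 1 y
    have hΦ : (f - P.b₁) * (f - P.b₂) * (f - P.b₃) * (f - P.b₄) =
        f ^ 4 - (P.b₁ + P.b₂ + P.b₃ + P.b₄) * f ^ 3 +
        (P.b₁ * P.b₂ + P.b₁ * P.b₃ + P.b₁ * P.b₄ + P.b₂ * P.b₃ + P.b₂ * P.b₄ + P.b₃ * P.b₄) *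
          f ^ 2 - (1 / P.b₁ + 1 / P.b₂ + 1 / P.b₃ + 1 / P.b₄) * f + 1 := by
      linear_combination hsym f 1
    refine ⟨fun hf => ?_, fun hf hfx => ?_, fun htg => ?_, fun hf => ?_⟩
    · rw [hPi g]
      exact hD.plus_at_g hx hxg' hf
    · have hmul : P.b₆ * t * (1 - x * P.b₁) * (1 - x * P.b₂) * (1 - x * P.b₃) * (1 - x * P.b₄) =
          P.b₆ * t * ((1 - x * P.b₁) * (1 - x * P.b₂) * (1 - x * P.b₃) * (1 - x * P.b₄)) := by ring
      rw [hΦ, hmul, hPi x, mul_comm x f]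
      exact hD.plus_at_f hx hxg' hf (sub_ne_zero.2 hfx.symm)
    · have hmul : P.b₅ n * t ^ 2 * (1 - g * P.b₁) * (1 - g * P.b₂) * (1 - g * P.b₃) *
          (1 - g * P.b₄) = P.b₅ n * t ^ 2 *
          ((1 - g * P.b₁) * (1 - g * P.b₂) * (1 - g * P.b₃) * (1 - g * P.b₄)) := by ring
      rw [hsym t (P.b₅ n), hmul, hPi g]
      exact hD.minus_at_g hx hxg' (sub_ne_zero.2 htg)
    · rw [hΦ]
      exact hD.minus_at_f hx hxg' hf
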